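/- **Theorem (entire solutions).** Let $K\ge 3$ and $a_{ij}>0$ for $i\neq j$ ($1\le i,j\le K$). Put $$\alpha=\frac1{2\pi}\ln\left(\frac{a_{12}}{a_{21}}\cdot\frac{a_{23}}{a_{32}}\cdots\frac{a_{K1}}{a_{1K}}\right),\qquad k=\frac K2,\qquad \nu=k-i\alpha,\qquad \Theta_\nu(z)=\sum_{n=0}^\infty\frac{1}{n!\,\Gamma(n+1+\nu)}\left(\frac z4\right)^n ,$$ and, for $(\mu,\omega)\in\mathbb R^2$, $\lambda=\omega\alpha-\mu+i\omega k$. An *entire solution* of the rotating segregated system is a $K$-tuple $U=(u_1,\dots,u_K)$ of nonnegative functions in $H^1_{\rm loc}(\mathbb R^2)$ such that $u_iu_j=0$ for $i\ne j$ and, for every $i$, in the weak sense (against Lipschitz, compactly supported, nonnegative test functions), $$-\Delta u_i+\omega\,\mathbf x^\perp\cdot\nabla u_i\le\mu u_i,\qquad -\Delta\widehat u_i+\omega\,\mathbf x^\perp\cdot\nabla\widehat u_i\ge\mu\widehat u_i\qquad\text{in }\mathbb R^2,$$ where $\mathbf x^\perp=(-x_2,x_1)$ and $\widehat u_i=u_i-\sum_{j\ne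 i}\frac{a_{ij}}{a_{ji}}u_j$. The *free boundary* of $U$ is the closure of $\bigcup_{i\ne j}\partial\{u_i>0\}\cap\partial\{u_j>0\}$. For almost every $(\mu,\omega)\in\mathbb R^2$ one has $$\Theta_\nu(t\lambda)\ne0\qquad\text{for all } t>0. \tag{1}$$ For every $(\mu,\omega)$ satisfying (1) (hence for almost every $(\mu,\omega)$) there exist an entire solution $U$, a real analytic function $\vartheta_0:(0,\infty)\to\mathbb R$ and $\beta\in\mathbb R$ with the following properties. Let $$v(r,\vartheta)=e^{\alpha\vartheta}r^{k}\,\mathrm{Re}\left(e^{i(k\vartheta-\alpha\ln r)}\,\Theta_\nu(\lambda r^2)\right),\qquad l_1=1,\quad l_i=\frac{a_{i(i-1)}}{a_{(i-1)i}}\,l_{i-1}\ (2\le i\le K),$$ $$S_i=\left\{(r,\vartheta): r>0,\ \vartheta_0(r)+\tfrac{2\pi(i-1)}K<\vartheta<\vartheta_0(r)+\tfrac{2\pi i}K\right\}\quad(1\le i\le K).$$ 1. For $r>0$ and $\vartheta\in\mathbb R$: $v(r,\vartheta)=0$ if and only if $\vartheta=\vartheta_0(r)+\frac{2\pi h}{K}$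 for some $h\in\mathbb Z$. 2. The set $\{u_i>0\}$ is the image of $S_i$ under $(r,\vartheta)\mapsto(r\cos\vartheta,r\sin\vartheta)$, and $u_i(r\cos\vartheta,r\sin\vartheta)=(-1)^{i+1}l_i\,v(r,\vartheta)$ for $(r,\vartheta)\in S_i$. 3. The free boundary of $U$ is the union of the origin and of the $K$ equi-distributed spirals $\vartheta=\vartheta_0(r)+\frac{2\pi i}{K}$, $r>0$, $i=0,\dots,K-1$. 4. (Logarithmic behaviour at $0$.) $\vartheta_0(r)=\frac1k(\beta+\alpha\ln r)+o(1)$ as $r\to0^+$. 5. (Arithmetic behaviour at infinity.) If $\omega\ne0$, then $\vartheta_0(r)=\gamma r+O(1)$ as $r\to+\infty$, where $$\gamma=-\frac1k\,\mathrm{sign}(\omega)\sqrt{\sqrt{\left(\tfrac{\omega\alpha-\mu}2\right)^2+\left(\tfrac{\omega k}2\right)^2}-\tfrac{\omega\alpha-\mu}2}\ \ne0 .$$ -/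

import Mathlib

open MeasureTheory Filter Topology Asymptotics
open scoped RealInnerProductSpace

noncomputable section

namespace RotatingSpirals

/-- The Euclidean plane. -/
abbrev Plane : Type := EuclideanSpace ℝ (Fin 2)

/-- The point with polar coordinates `(r, θ)`. -/
def polar (r θ : ℝ) : Plane := !₂[r * Real.cos θ, r * Real.sin θ]

/-- The rotation of `x` by the angle `π / 2`. -/
def perp (x : Plane) : Plane := !₂[-x 1, x 0]

/-! ### The rotating segregated system in the plane -/

/-- `u ∈ H¹_loc(ℝ²)` with weak gradient `G`: both belong to `L²` of every compact set, and
`G` is the distributional gradient of `u`. -/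
structure IsH1Loc (u : Plane → ℝ) (G : Plane → Plane) : Prop where
  memLp_fun : ∀ C : Set Plane, IsCompact C → MemLp u 2 (volume.restrict C)
  memLp_grad : ∀ C : Set Plane, IsCompact C → MemLp G 2 (volume.restrict C)
  weak_grad : ∀ φ : Plane → ℝ, ContDiff ℝ ((⊤ : ℕ∞) : WithTop ℕ∞) φ → HasCompactSupport φ →
    ∀ e : Plane, ∫ x, u x * fderiv ℝ φ x e = -∫ x, ⟪G x, e⟫ * φ x

/-- The weak form of `-Δu + ω x^⊥ · ∇u - μ u`, for a function `u` with weak gradient `G`, tested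
against `φ`; here `fderiv ℝ φ x (G x)` is `∇φ(x) · ∇u(x)`. -/
def weakForm (μ ω : ℝ) (u : Plane → ℝ) (G : Plane → Plane) (φ : Plane → ℝ) : ℝ :=
  ∫ x, (fderiv ℝ φ x (G x) + (ω * ⟪perp x, G x⟫ - μ * u x) * φ x)

/-- Admissible test functions: Lipschitz, compactly supported and nonnegative. -/
def IsTest (φ : Plane → ℝ) : Prop :=
  (∃ L, LipschitzWith L φ) ∧ HasCompactSupport φ ∧ ∀ x, 0 ≤ φ x

variable {K : ℕ}

/-- `û_i = u_i - ∑_{j ≠ i} (a_ij / a_ji) u_j`, for families of vectors (scalars in particular). -/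
def hat {V : Type*} [AddCommGroup V] [Module ℝ V] (a : Fin K → Fin K → ℝ) (u : Fin K → V)
    (i : Fin K) : V :=
  u i - ∑ j ∈ Finset.univ.erase i, (a i j / a j i) • u j

/-- `U = (u_1, …, u_K)` is an entire solution of the rotating segregated system: its components
are nonnegative functions in `H¹_loc(ℝ²)` with pairwise disjoint supports of positivity, and in
the weak sense `-Δu_i + ω x^⊥ · ∇u_i ≤ μ u_i` and `-Δû_i + ω x^⊥ · ∇û_i ≥ μ û_i` in `ℝ²`. -/
def IsEntireSolution (a : Fin K → Fin K → ℝ) (μ ω : ℝ) (U : Fin K → Plane → ℝ) : Prop :=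
  (∀ i x, 0 ≤ U i x) ∧
  (∀ i j, i ≠ j → ∀ x, U i x * U j x = 0) ∧
  ∃ G : Fin K → Plane → Plane,
    (∀ i, IsH1Loc (U i) (G i)) ∧
    ∀ i φ, IsTest φ →
      weakForm μ ω (U i) (G i) φ ≤ 0 ∧
      0 ≤ weakForm μ ω (hat a U i) (hat a G i) φ

/-- The free boundary of `U`: the closure of the union of the interfaces
`∂{u_i > 0} ∩ ∂{u_j > 0}`, `i ≠ j`. -/
def freeBoundary (U : Fin K → Plane → ℝ) : Set Plane :=
  closure {x | ∃ i j, i ≠ j ∧ x ∈ frontier {y | 0 < U i y} ∧ x ∈ frontier {y | 0 < U j y}}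

/-! ### The explicit single-mode functions -/

/-- `α = (1 / 2π) log ((a_12 / a_21) (a_23 / a_32) ⋯ (a_K1 / a_1K))`; `finRotate K` is the cyclic
successor on the indices. -/
def asymmetry (a : Fin K → Fin K → ℝ) : ℝ :=
  1 / (2 * Real.pi) * Real.log (∏ i, a i (finRotate K i) / a (finRotate K i) i)

/-- `l_1 = 1`, `l_{i+1} = (a_{(i+1)i} / a_{i(i+1)}) l_i`, written as a product. -/
def weight (a : Fin K → Fin K → ℝ) (i : Fin K) : ℝ :=
  ∏ j ∈ Finset.Iio i, a (finRotate K j) j / a j (finRotate K j)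

/-- `Θ_ν(z) = ∑ (z / 4)^n / (n! Γ(n + 1 + ν))`. -/
def Theta (ν z : ℂ) : ℂ :=
  ∑' n : ℕ, 1 / ((n.factorial : ℂ) * Complex.Gamma (n + 1 + ν)) * (z / 4) ^ n

/-- The order `ν = K/2 - iα`. -/
def order (a : Fin K → Fin K → ℝ) : ℂ := (K : ℂ) / 2 - Complex.I * (asymmetry a : ℂ)

/-- The parameter `λ = ωα - μ + iωK/2`. -/
def lam (a : Fin K → Fin K → ℝ) (μ ω : ℝ) : ℂ :=
  ((ω * asymmetry a - μ : ℝ) : ℂ) + Complex.I * ((ω * (K / 2) : ℝ) : ℂ)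

/-- `Θ_ν` has no zero on the open half-line from the origin through `λ`. -/
def NonResonant (a : Fin K → Fin K → ℝ) (μ ω : ℝ) : Prop :=
  ∀ t : ℝ, 0 < t → Theta (order a) ((t : ℂ) * lam a μ ω) ≠ 0

/-- The function `v` in polar coordinates:
`v(r, θ) = e^{αθ} r^{K/2} Re (e^{i((K/2) θ - α log r)} Θ_ν(λ r²))`. -/
def mode (a : Fin K → Fin K → ℝ) (μ ω r θ : ℝ) : ℝ :=
  Real.exp (asymmetry a * θ) * r ^ ((K : ℝ) / 2) *
    (Complex.exp (Complex.I * (((K : ℝ) / 2 * θ - asymmetry a * Real.log r : ℝ) : ℂ)) *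
      Theta (order a) (lam a μ ω * (r : ℂ) ^ 2)).re

/-- The slope of the arithmetic spirals at infinity,
`-(2/K) sign(ω) (|λ|/2 - Re(λ)/2)^{1/2}`. -/
def slope (a : Fin K → Fin K → ℝ) (μ ω : ℝ) : ℝ :=
  -(2 / K) * Real.sign ω *
    Real.sqrt (Real.sqrt (((ω * asymmetry a - μ) / 2) ^ 2 + (ω * K / 4) ^ 2)
      - (ω * asymmetry a - μ) / 2)

/-- Given an angle function `ϑ`, the `i`-th of the `K` sectors of opening `2π/K` (`0`-based),
bounded by the curves `θ = ϑ(r) + 2πi/K` and `θ = ϑ(r) + 2π(i+1)/K`; it is a set of polar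
coordinates `(r, θ)`. -/
def sector (ϑ : ℝ → ℝ) (i : Fin K) : Set (ℝ × ℝ) :=
  {p | 0 < p.1 ∧ ϑ p.1 + i * (2 * Real.pi / K) < p.2 ∧
    p.2 < ϑ p.1 + (i + 1) * (2 * Real.pi / K)}

/-- The `i`-th spiral: the curve `θ = ϑ(r) + 2πi/K`, `r > 0`. -/
def spiral (ϑ : ℝ → ℝ) (i : Fin K) : Set Plane :=
  {x | ∃ r : ℝ, 0 < r ∧ x = polar r (ϑ r + i * (2 * Real.pi / K))}

end RotatingSpirals

end

/-!
Write `v(r, θ)` for the explicit function `mode`. On the universal covering of the punctured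
plane it is the real part of `z ^ ν · Θ_ν(λ |z|²)`, and the second-order equation satisfied by the
entire function `Θ_ν` says exactly that `-Δv + ω x^⊥ · ∇v = μ v`. Non-resonance says that `Θ_ν` has
no zero on the ray through `λ`, so that `Θ_ν(λ r²)` has an analytic phase `Φ(r)`, and the zeros of
`v` at radius `r` are the angles at which `(K/2) θ - α log r + Φ(r) ∈ π/2 + πℤ`. Solving for `θ`
defines the angle function `ϑ` (`exists_angle`); its behaviour at the origin is the continuity of
`Φ` at `0`.

Turning once around the origin multiplies `v` by `(-1) ^ K e^{2πα}`. The product of the ratios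
`a_{i+1,i} / a_{i,i+1}` over a full cycle is `e^{-2πα}`, so the densities `(-1)^i l_i v` on the
`K` sectors between consecutive zeros fit together: across the interface of two neighbouring
sectors one has `l_{i+1} / l_i = a_{i+1,i} / a_{i,i+1}`, also for the last and the first sector.
Consequently (`coverWeight_succ`, `IsAngle.hat_solution_eq`), near the closure of the `i`-th
sector, apart from the origin, `û_i` is a constant multiple of `v`, hence a classical solution.

The differential inequality for `u_i` holds because a nonnegative function which is a solution
where it is positive is a subsolution (`weakForm_nonpos`). The inequality for `û_i` is local: `û_i`
is a solution on the `i`-th sector and its neighbours, and elsewhere it is minus a positive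
combination of such subsolutions (`weakForm_combination_nonneg`). The origin does not matter,
because the gradients, which are `O(r ^ (K/2 - 1))` up to the factor `e^{αθ}` bounded on the
sectors, are bounded there, and a point of the plane can be cut off at no cost.

For the behaviour at infinity, `Θ_ν(z²)` is up to a constant the Euler integral
`∫₀¹ (x (1 - x))^{ν - 1/2} e^{z (1 - 2x)} dx` (`euler_integral_eq`). When `ω ≠ 0` the square root
of `λ` may be chosen with positive real part, and Watson's lemma at the endpoint `x = 0` shows that
`Θ_ν(λ r²)` is asymptotic to a constant multiple of `r^{-ν - 1/2} e^{r √λ}`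
(`exists_tendsto_Theta`), whose phase is `r Im √λ + α log r` up to a constant. The logarithm
cancels the one in the definition of `ϑ`, and `Im √λ` gives the slope.

Finally `Θ_ν` is entire and not identically zero, so that it has countably many zeros,
and `(μ, ω) ↦ λ` is a linear isomorphism; the resonant parameters lie on countably many rays, a
null set (`ae_nonResonant`).
-/

noncomputable section

namespace RotatingSpirals

/-! ### The function `Θ_ν` -/

/-- The coefficient of `(z / 4)^n` in `Θ_ν(z)`. -/
def thetaCoeff (ν : ℂ) (n : ℕ) : ℂ := 1 / ((n.factorial : ℂ) * Complex.Gamma (n + 1 + ν))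

lemma thetaCoeff_succ (ν : ℂ) (n : ℕ) :
    thetaCoeff ν n = (n + 1) * (n + 1 + ν) * thetaCoeff ν (n + 1) := by
  have h := Complex.one_div_Gamma_eq_self_mul_one_div_Gamma_add_one ((n : ℂ) + 1 + ν)
  have h1 : ((n : ℂ) + 1) ≠ 0 := by exact_mod_cast Nat.succ_ne_zero n
  have h2 : ((n.factorial : ℂ)) ≠ 0 := by exact_mod_cast n.factorial_ne_zero
  simp only [thetaCoeff, one_div, mul_inv, Nat.factorial_succ]
  rw [h]
  push_cast
  rw [show (n : ℂ) + 1 + 1 + ν = n + 1 + ν + 1 by ring]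
  field_simp

lemma thetaCoeff_shift (ν : ℂ) (n : ℕ) :
    thetaCoeff (ν + 1) n = (n + 1) * thetaCoeff ν (n + 1) := by
  have h1 : ((n : ℂ) + 1) ≠ 0 := by exact_mod_cast Nat.succ_ne_zero n
  have h2 : ((n.factorial : ℂ)) ≠ 0 := by exact_mod_cast n.factorial_ne_zero
  simp only [thetaCoeff, one_div, mul_inv, Nat.factorial_succ]
  push_cast
  rw [show (n : ℂ) + 1 + 1 + ν = n + 1 + (ν + 1) by ring]
  field_simp

lemma thetaCoeff_ne_zero {ν : ℂ} (hν : 0 < ν.re) (n : ℕ) : thetaCoeff ν n ≠ 0 := by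
  have h2 : ((n.factorial : ℂ)) ≠ 0 := by exact_mod_cast n.factorial_ne_zero
  refine one_div_ne_zero (mul_ne_zero h2 (Complex.Gamma_ne_zero_of_re_pos ?_))
  simp only [Complex.add_re, Complex.natCast_re, Complex.one_re]
  positivity

lemma thetaCoeff_norm_succ_le {ν : ℂ} (hν : 0 < ν.re) (n : ℕ) :
    ((n : ℝ) + 1) * ‖thetaCoeff ν (n + 1)‖ ≤ ‖thetaCoeff ν n‖ := by
  rw [thetaCoeff_succ ν n, norm_mul, norm_mul]
  have h1 : ‖(n : ℂ) + 1‖ = n + 1 := by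
    have : ‖((n + 1 : ℕ) : ℂ)‖ = ((n + 1 : ℕ) : ℝ) := Complex.norm_natCast _
    push_cast at this
    exact this
  have h2 : 1 ≤ ‖(n : ℂ) + 1 + ν‖ := by
    refine le_trans ?_ (Complex.re_le_norm _)
    simp only [Complex.add_re, Complex.natCast_re, Complex.one_re]
    have : (0 : ℝ) ≤ n := n.cast_nonneg
    linarith
  rw [h1]
  have h3 : (0 : ℝ) ≤ n + 1 := by positivity
  have := mul_le_mul_of_nonneg_left h2 h3
  have := mul_le_mul_of_nonneg_right this (norm_nonneg (thetaCoeff ν (n + 1)))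
  linarith

lemma thetaCoeff_norm_le {ν : ℂ} (hν : 0 < ν.re) (n : ℕ) :
    ‖thetaCoeff ν n‖ ≤ ‖thetaCoeff ν 0‖ / n.factorial := by
  induction n with
  | zero => simp
  | succ n ih =>
    have h := thetaCoeff_norm_succ_le hν n
    rw [le_div_iff₀ (by positivity)] at ih ⊢
    rw [Nat.factorial_succ]
    push_cast
    calc _ = (((n : ℝ) + 1) * ‖thetaCoeff ν (n + 1)‖) * n.factorial := by ring
      _ ≤ ‖thetaCoeff ν n‖ * n.factorial := by gcongr
      _ ≤ _ := ih

lemma thetaTerm_norm_le {ν : ℂ} (hν : 0 < ν.re) {R : ℝ} {z : ℂ} (hz : ‖z‖ ≤ R) (n : ℕ) :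
    ‖thetaCoeff ν n * (z / 4) ^ n‖ ≤ ‖thetaCoeff ν 0‖ * (R ^ n / n.factorial) := by
  have hR : 0 ≤ R := (norm_nonneg z).trans hz
  rw [norm_mul, norm_pow]
  have h1 : ‖z / 4‖ ≤ R := by
    rw [norm_div]
    norm_num
    linarith [norm_nonneg z]
  calc _ ≤ (‖thetaCoeff ν 0‖ / n.factorial) * R ^ n := by
        gcongr
        exact thetaCoeff_norm_le hν n
    _ = _ := by ring

lemma summable_thetaBound (ν : ℂ) (R : ℝ) :
    Summable fun n : ℕ => ‖thetaCoeff ν 0‖ * (R ^ n / n.factorial) :=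
  (Real.summable_pow_div_factorial R).mul_left _

lemma hasSum_Theta {ν : ℂ} (hν : 0 < ν.re) (z : ℂ) :
    HasSum (fun n : ℕ => thetaCoeff ν n * (z / 4) ^ n) (Theta ν z) :=
  (Summable.of_norm_bounded (summable_thetaBound ν ‖z‖)
    (fun n => thetaTerm_norm_le hν le_rfl n)).hasSum

/-- `Θ_ν' = Θ_{ν+1} / 4`. -/
lemma hasDerivAt_Theta {ν : ℂ} (hν : 0 < ν.re) (z : ℂ) :
    HasDerivAt (Theta ν) (Theta (ν + 1) z / 4) z := by
  set U : Set ℂ := Metric.ball 0 (‖z‖ + 1) with hU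
  have hzU : z ∈ U := by simp [hU]
  have hf : ∀ n : ℕ, DifferentiableOn ℂ (fun w : ℂ => thetaCoeff ν n * (w / 4) ^ n) U :=
    fun n => by fun_prop
  have hb : ∀ (n : ℕ) (w : ℂ), w ∈ U → ‖thetaCoeff ν n * (w / 4) ^ n‖ ≤
      ‖thetaCoeff ν 0‖ * ((‖z‖ + 1) ^ n / n.factorial) := fun n w hw =>
    thetaTerm_norm_le hν (by simpa [hU] using (Metric.mem_ball.1 hw).le) n
  have hs := summable_thetaBound ν (‖z‖ + 1)
  have hd := Complex.differentiableOn_tsum_of_summable_norm hs hf Metric.isOpen_ball hb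
  have hsum := Complex.hasSum_deriv_of_summable_norm hs hf Metric.isOpen_ball hb hzU
  have hD : HasDerivAt (Theta ν) (deriv (Theta ν) z) z :=
    (hd.differentiableAt (Metric.isOpen_ball.mem_nhds hzU)).hasDerivAt
  have hderiv : ∀ n : ℕ, deriv (fun w : ℂ => thetaCoeff ν n * (w / 4) ^ n) z =
      thetaCoeff ν n * (n * (z / 4) ^ (n - 1) * (1 / 4)) := fun n => by
    have h := (((hasDerivAt_id z).div_const 4).pow n).const_mul (thetaCoeff ν n)
    exact h.deriv
  have hsum' : HasSum (fun n : ℕ => thetaCoeff ν n * (n * (z / 4) ^ (n - 1) * (1 / 4)))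
      (deriv (Theta ν) z) := by
    refine hsum.congr_fun ?_ |> fun h => h
    intro n
    exact (hderiv n).symm
  have h1 := (hasSum_nat_add_iff' 1).2 hsum'
  have h2 := (hasSum_Theta (ν := ν + 1) (by simp; linarith) z).div_const 4
  have h3 : deriv (Theta ν) z - ∑ i ∈ Finset.range 1,
      thetaCoeff ν i * (i * (z / 4) ^ (i - 1) * (1 / 4)) = Theta (ν + 1) z / 4 := by
    refine h1.unique (h2.congr_fun ?_)
    intro n
    rw [thetaCoeff_shift]
    simp only [Nat.add_sub_cancel]
    push_cast
    ring
  simp only [Finset.range_one, Finset.sum_singleton, Nat.cast_zero, zero_mul, mul_zero,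
    sub_zero] at h3
  rwa [h3] at hD

/-- The three-term recurrence of the modified Bessel functions, which amounts to the differential
equation `z Θ_ν'' + (ν + 1) Θ_ν' = Θ_ν / 4`. -/
lemma Theta_recurrence {ν : ℂ} (hν : 0 < ν.re) (z : ℂ) :
    Theta ν z = (ν + 1) * Theta (ν + 1) z + z / 4 * Theta (ν + 1 + 1) z := by
  have h0 := hasSum_Theta hν z
  have h1 := (hasSum_Theta (ν := ν + 1) (by simp; linarith) z).mul_left (ν + 1)
  have h2 := (hasSum_Theta (ν := ν + 1 + 1) (by simp; linarith) z).mul_left (z / 4)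
  have h3 : HasSum (fun n : ℕ => (n : ℂ) * thetaCoeff (ν + 1) n * (z / 4) ^ n)
      (z / 4 * Theta (ν + 1 + 1) z) := by
    rw [← hasSum_nat_add_iff' 1]
    simp only [Finset.range_one, Finset.sum_singleton, Nat.cast_zero, zero_mul, sub_zero]
    refine h2.congr_fun fun n => ?_
    rw [thetaCoeff_shift (ν + 1)]
    push_cast
    ring
  refine h0.unique ((h1.add h3).congr_fun fun n => ?_)
  rw [thetaCoeff_succ, thetaCoeff_shift]
  ring

lemma differentiable_Theta {ν : ℂ} (hν : 0 < ν.re) : Differentiable ℂ (Theta ν) :=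
  fun z => (hasDerivAt_Theta hν z).differentiableAt

lemma Theta_zero_ne_zero {ν : ℂ} (hν : 0 < ν.re) : Theta ν 0 ≠ 0 := by
  have h : Theta ν 0 = thetaCoeff ν 0 := by
    refine (hasSum_Theta hν 0).unique ?_
    convert hasSum_ite_eq (0 : ℕ) (thetaCoeff ν 0) using 2 with n
    rcases Nat.eq_zero_or_pos n with rfl | hn
    · simp
    · simp [hn.ne']
  rw [h]
  exact thetaCoeff_ne_zero hν 0

/-! ### Non-resonance for almost every pair of parameters -/

lemma countable_Theta_zeros {ν : ℂ} (hν : 0 < ν.re) : {z : ℂ | Theta ν z = 0}.Countable := by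
  have han : AnalyticOnNhd ℂ (Theta ν) Set.univ :=
    (differentiable_Theta hν).differentiableOn.analyticOnNhd isOpen_univ
  have h := han.preimage_zero_mem_codiscreteWithin (x := 0) (Theta_zero_ne_zero hν)
    (Set.mem_univ _) isConnected_univ
  have h2 : Theta ν ⁻¹' {0}ᶜ ∈ codiscrete ℂ := h
  have h3 : IsDiscrete {z : ℂ | Theta ν z = 0} := by
    convert (mem_codiscrete'.1 h2).2 using 1
    ext z
    simp
  have : DiscreteTopology {z : ℂ | Theta ν z = 0} := h3.to_subtype
  exact (HereditarilyLindelofSpace.isLindelof _).countable this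

lemma order_re (K : ℕ) (a : Fin K → Fin K → ℝ) : (order a).re = (K : ℝ) / 2 := by
  simp [order]

lemma order_im (K : ℕ) (a : Fin K → Fin K → ℝ) : (order a).im = -asymmetry a := by
  simp [order]

lemma lam_re {K : ℕ} (a : Fin K → Fin K → ℝ) (μ ω : ℝ) :
    (lam a μ ω).re = ω * asymmetry a - μ := by
  simp [lam]

lemma lam_im {K : ℕ} (a : Fin K → Fin K → ℝ) (μ ω : ℝ) :
    (lam a μ ω).im = ω * (K / 2) := by
  simp [lam]

lemma ae_nonResonant {K : ℕ} (hK : 0 < K) (a : Fin K → Fin K → ℝ) :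
    ∀ᵐ p : ℝ × ℝ, NonResonant a p.1 p.2 := by
  have hν : 0 < (order a).re := by rw [order_re]; positivity
  have hK' : (K : ℝ) ≠ 0 := by positivity
  -- the pairs `(μ, ω)` for which `λ` is a multiple of the complex number `z`
  let L : ℂ → Submodule ℝ (ℝ × ℝ) := fun z => LinearMap.ker
    ({ toFun := fun p => (p.2 * asymmetry a - p.1) * z.im - p.2 * (K / 2) * z.re
       map_add' := fun p q => by simp only [Prod.fst_add, Prod.snd_add]; ring
       map_smul' := fun c p => by
        simp only [Prod.smul_fst, Prod.smul_snd, smul_eq_mul, RingHom.id_apply]; ring } :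
      ℝ × ℝ →ₗ[ℝ] ℝ)
  have hL : ∀ z : ℂ, z ≠ 0 → volume (L z : Set (ℝ × ℝ)) = 0 := by
    intro z hz
    refine Measure.addHaar_submodule _ _ fun htop => hz ?_
    have h1 : ((-1, 0) : ℝ × ℝ) ∈ L z := htop ▸ Submodule.mem_top
    have h2 : ((asymmetry a, 1) : ℝ × ℝ) ∈ L z := htop ▸ Submodule.mem_top
    simp only [L, LinearMap.mem_ker, LinearMap.coe_mk, AddHom.coe_mk] at h1 h2
    have h3 : z.im = 0 := by linarith
    have h4 : (K : ℝ) / 2 * z.re = 0 := by rw [h3] at h2; linarith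
    have h5 : z.re = 0 := by
      rcases mul_eq_zero.1 h4 with h | h
      · exact absurd h (by positivity)
      · exact h
    exact Complex.ext h5 h3
  have hnull : volume (⋃ z ∈ {z : ℂ | Theta (order a) z = 0}, (L z : Set (ℝ × ℝ))) = 0 := by
    rw [measure_biUnion_null_iff (countable_Theta_zeros hν)]
    intro z hz
    refine hL z ?_
    rintro rfl
    exact Theta_zero_ne_zero hν hz
  rw [ae_iff]
  refine measure_mono_null ?_ hnull
  intro p hp
  simp only [NonResonant, not_forall, Set.mem_ofPred_eq, not_not] at hp
  obtain ⟨t, ht, h⟩ := hp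
  simp only [Set.mem_iUnion]
  refine ⟨_, h, ?_⟩
  simp only [L, SetLike.mem_coe, LinearMap.mem_ker, LinearMap.coe_mk, AddHom.coe_mk,
    Complex.mul_im, Complex.mul_re, Complex.ofReal_re, Complex.ofReal_im, lam_re, lam_im]
  ring

/-! ### An Euler integral for `Θ_ν` -/

/-- The kernel `(x (1 - x))^s` of the Euler integral. -/
def eulerKernel (s : ℂ) (x : ℝ) : ℂ := ((x * (1 - x) : ℝ) : ℂ) ^ s

/-- The moments `∫₀¹ (x (1 - x))^s (1 - 2x)^m dx`. -/
def eulerMoment (s : ℂ) (m : ℕ) : ℂ :=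
  ∫ x in (0 : ℝ)..1, eulerKernel s x * (1 - 2 * x) ^ m

lemma continuous_eulerKernel {s : ℂ} (hs : 0 < s.re) : Continuous (eulerKernel s) :=
  (Complex.continuous_ofReal_cpow_const hs).comp (by fun_prop : Continuous fun x : ℝ => x * (1 - x))

lemma eulerMoment_odd (s : ℂ) {m : ℕ} (hm : Odd m) : eulerMoment s m = 0 := by
  have h := intervalIntegral.integral_comp_sub_left (a := 0) (b := 1)
    (fun x : ℝ => eulerKernel s x * (1 - 2 * x) ^ m) 1
  have h2 : ∀ x : ℝ, eulerKernel s (1 - x) * (1 - 2 * ((1 - x : ℝ) : ℂ)) ^ m =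
      -(eulerKernel s x * (1 - 2 * x) ^ m) := by
    intro x
    rw [show (1 - 2 * ((1 - x : ℝ) : ℂ)) = -(1 - 2 * x) by push_cast; ring, hm.neg_pow]
    simp only [eulerKernel]
    rw [show (1 - x) * (1 - (1 - x)) = x * (1 - x) by ring]
    ring
  simp only [h2, intervalIntegral.integral_neg, sub_self, sub_zero] at h
  have h3 : -eulerMoment s m = eulerMoment s m := h
  exact self_eq_neg.1 h3.symm

/-- Integration of the derivative of `(x (1 - x))^{s + 1} (1 - 2x)^{m + 1}`, together with
`4 x (1 - x) = 1 - (1 - 2x)²`. -/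
lemma eulerMoment_add_two {s : ℂ} (hs : 0 < s.re) (m : ℕ) :
    (s + 1 + (m + 1) / 2) * eulerMoment s (m + 2) = (m + 1) / 2 * eulerMoment s m := by
  have hc := continuous_eulerKernel hs
  have hs1 : 0 < (s + 1).re := by simp; linarith
  have hder : ∀ x ∈ Set.Ioo (0 : ℝ) 1,
      HasDerivAt (fun x : ℝ => eulerKernel (s + 1) x * (1 - 2 * x) ^ (m + 1))
        ((s + 1 + (m + 1) / 2) * (eulerKernel s x * (1 - 2 * x) ^ (m + 2)) -
          (m + 1) / 2 * (eulerKernel s x * (1 - 2 * x) ^ m)) x := by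
    intro x hx
    have hpos : 0 < x * (1 - x) := mul_pos hx.1 (by linarith [hx.2])
    have h1 : HasDerivAt (fun x : ℝ => ((x * (1 - x) : ℝ) : ℂ)) ((1 - 2 * x : ℝ) : ℂ) x := by
      refine HasDerivAt.ofReal_comp ?_
      convert! (hasDerivAt_id x).mul ((hasDerivAt_id x).const_sub 1) using 1
      simp; ring
    have h2 : HasDerivAt (fun x : ℝ => (1 - 2 * (x : ℂ))) (-2) x := by
      have := ((hasDerivAt_id x).ofReal_comp.const_mul (2 : ℂ)).const_sub 1
      simpa using this
    have h0 : HasDerivAt (fun z : ℂ => z ^ (s + 1))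
        ((s + 1) * ((x * (1 - x) : ℝ) : ℂ) ^ (s + 1 - 1)) ((x * (1 - x) : ℝ) : ℂ) :=
      (hasStrictDerivAt_id _).cpow_const (Complex.ofReal_mem_slitPlane.2 hpos)
        |>.hasDerivAt |>.congr_deriv (mul_one _)
    have h3 := (h0.comp x h1).mul (h2.pow (m + 1))
    refine h3.congr_deriv ?_
    have hne : ((x * (1 - x) : ℝ) : ℂ) ≠ 0 := by exact_mod_cast hpos.ne'
    simp only [eulerKernel, add_sub_cancel_right, Nat.add_sub_cancel, Function.comp, Pi.pow_apply]
    rw [Complex.cpow_add _ _ hne, Complex.cpow_one]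
    push_cast
    ring
  have hint : ∀ m : ℕ, Continuous fun x : ℝ => eulerKernel s x * (1 - 2 * (x : ℂ)) ^ m :=
    fun m => by fun_prop
  have hFTC := intervalIntegral.integral_eq_sub_of_hasDerivAt_of_le (zero_le_one' ℝ)
    (f := fun x : ℝ => eulerKernel (s + 1) x * (1 - 2 * x) ^ (m + 1))
    (((continuous_eulerKernel hs1).mul (by fun_prop)).continuousOn) hder
    (Continuous.intervalIntegrable (by fun_prop) _ _)
  have hne : s + 1 ≠ 0 := fun h => by simp [h] at hs1
  rw [intervalIntegral.integral_sub ((hint _).const_mul _ |>.intervalIntegrable _ _)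
    ((hint _).const_mul _ |>.intervalIntegrable _ _), intervalIntegral.integral_const_mul,
    intervalIntegral.integral_const_mul] at hFTC
  simp only [eulerKernel, sub_self, mul_zero, zero_mul, Complex.ofReal_zero,
    Complex.zero_cpow hne] at hFTC
  exact sub_eq_zero.1 hFTC

/-- Both sides satisfy the same recursion in `n`; they are the coefficients of `z^{2n}` in
`euler_integral_eq`. -/
lemma eulerMoment_even {ν : ℂ} (hν : 1 / 2 < ν.re) (n : ℕ) :
    eulerMoment (ν - 1 / 2) (2 * n) / (2 * n).factorial =
      eulerMoment (ν - 1 / 2) 0 * Complex.Gamma (1 + ν) * (thetaCoeff ν n / 4 ^ n) := by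
  have hs : 0 < (ν - 1 / 2).re := by simp; linarith
  induction n with
  | zero =>
    have : Complex.Gamma (1 + ν) ≠ 0 := Complex.Gamma_ne_zero_of_re_pos (by simp; linarith)
    simp [thetaCoeff, this]
  | succ n ih =>
    have h1 := eulerMoment_add_two hs (2 * n)
    have h2 := thetaCoeff_succ ν n
    have hne : (n : ℂ) + 1 + ν ≠ 0 := by
      intro h
      have := congrArg Complex.re h
      simp at this
      have : (0 : ℝ) ≤ n := n.cast_nonneg
      linarith
    have hn1 : ((n : ℂ) + 1) ≠ 0 := by exact_mod_cast Nat.succ_ne_zero n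
    have hn2 : (2 * (n : ℂ) + 1) ≠ 0 := by exact_mod_cast Nat.succ_ne_zero (2 * n)
    have hf : (((2 * n).factorial : ℕ) : ℂ) ≠ 0 := by exact_mod_cast (2 * n).factorial_ne_zero
    have h3 : (n + 1 + ν) * eulerMoment (ν - 1 / 2) (2 * n + 2) =
        (2 * n + 1) / 2 * eulerMoment (ν - 1 / 2) (2 * n) := by
      push_cast at h1
      rw [← h1]; ring
    rw [show 2 * (n + 1) = 2 * n + 1 + 1 by ring, Nat.factorial_succ, Nat.factorial_succ]
    push_cast
    rw [h2, div_eq_iff hf] at ih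
    rw [ih] at h3
    have h4 : eulerMoment (ν - 1 / 2) (2 * n + 1 + 1) = (n + 1 + ν)⁻¹ * ((2 * n + 1) / 2 *
      (eulerMoment (ν - 1 / 2) 0 * Complex.Gamma (1 + ν) *
        ((n + 1) * (n + 1 + ν) * thetaCoeff ν (n + 1) / 4 ^ n) * (2 * n).factorial)) := by
      rw [← h3, inv_mul_cancel_left₀ hne]
    rw [h4, show (2 * (n : ℂ) + 1 + 1) = 2 * (n + 1) by ring, pow_succ]
    generalize 2 * (n : ℂ) + 1 = A at hn2
    field_simp
    ring

/-- `∫₀¹ (x (1 - x))^{ν - 1/2} e^{z (1 - 2x)} dx` is a multiple of `Θ_ν(z²)`. -/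
lemma euler_integral_eq {ν : ℂ} (hν : 1 / 2 < ν.re) (z : ℂ) :
    ∫ x in (0 : ℝ)..1, eulerKernel (ν - 1 / 2) x * Complex.exp (z * (1 - 2 * x)) =
      eulerMoment (ν - 1 / 2) 0 * Complex.Gamma (1 + ν) * Theta ν (z ^ 2) := by
  have hs : 0 < (ν - 1 / 2).re := by simp; linarith
  set s := ν - 1 / 2 with hsdef
  have hc := continuous_eulerKernel hs
  have hsum : HasSum (fun m : ℕ => ∫ x in (0 : ℝ)..1,
      eulerKernel s x * ((z * (1 - 2 * x)) ^ m / m.factorial))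
      (∫ x in (0 : ℝ)..1, eulerKernel s x * Complex.exp (z * (1 - 2 * x))) := by
    refine intervalIntegral.hasSum_integral_of_dominated_convergence
      (fun m x => ‖eulerKernel s x‖ * (‖z‖ ^ m / m.factorial)) (fun m => ?_) (fun m => ?_) ?_ ?_ ?_
    · exact (Continuous.aestronglyMeasurable (by fun_prop))
    · refine ae_of_all _ fun x hx => ?_
      rw [Set.uIoc_of_le zero_le_one] at hx
      rw [norm_mul, norm_div, norm_pow, norm_mul, Complex.norm_natCast]
      have h1 : ‖(1 - 2 * (x : ℂ))‖ ≤ 1 := by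
        rw [show (1 - 2 * (x : ℂ)) = ((1 - 2 * x : ℝ) : ℂ) by push_cast; ring, Complex.norm_real,
          Real.norm_eq_abs, abs_le]
        constructor <;> linarith [hx.1, hx.2]
      gcongr
      calc ‖z‖ * ‖(1 - 2 * (x : ℂ))‖ ≤ ‖z‖ * 1 := by gcongr
        _ = ‖z‖ := mul_one _
    · exact ae_of_all _ fun x _ => (Real.summable_pow_div_factorial ‖z‖).mul_left _
    · simp only [tsum_mul_left]
      exact (hc.norm.mul continuous_const).intervalIntegrable _ _
    · refine ae_of_all _ fun x _ => ?_
      rw [Complex.exp_eq_exp_ℂ]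
      exact (NormedSpace.expSeries_div_hasSum_exp (z * (1 - 2 * x))).mul_left _
  have hterm : ∀ m : ℕ, (∫ x in (0 : ℝ)..1,
      eulerKernel s x * ((z * (1 - 2 * x)) ^ m / m.factorial)) =
      z ^ m * (eulerMoment s m / m.factorial) := by
    intro m
    have : ∀ x : ℝ, eulerKernel s x * ((z * (1 - 2 * x)) ^ m / m.factorial) =
        z ^ m / m.factorial * (eulerKernel s x * (1 - 2 * x) ^ m) := fun x => by
      rw [mul_pow]; ring
    simp only [this, intervalIntegral.integral_const_mul]
    rw [eulerMoment]
    ring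
  simp only [hterm] at hsum
  -- only the even moments survive, which turns the exponential series in `z` into one in `z²`
  have hinj : Function.Injective fun n : ℕ => 2 * n := fun a b h => by
    simpa using h
  have heven := (hinj.hasSum_iff (f := fun m : ℕ => z ^ m * (eulerMoment s m / m.factorial)) (by
    intro m hm
    have : Odd m := by
      rw [← Nat.not_even_iff_odd]
      rintro ⟨n, rfl⟩
      exact hm ⟨n, by simp; ring⟩
    rw [eulerMoment_odd s this]
    simp)).2 hsum
  refine heven.unique ?_
  refine ((hasSum_Theta (by linarith) (z ^ 2)).mul_left _).congr_fun fun n => ?_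
  simp only [Function.comp]
  rw [hsdef, eulerMoment_even hν, pow_mul, div_pow]
  ring

/-! ### Growth of `Θ_ν` along a ray -/

/-- The Laplace integral `∫₀^∞ u^s e^{-wu} du`. -/
def laplacePow (s w : ℂ) : ℂ := ∫ u in Set.Ioi (0 : ℝ), (u : ℂ) ^ s * Complex.exp (-(w * u))

lemma norm_laplace_integrand (s w : ℂ) {u : ℝ} (hu : 0 < u) :
    ‖(u : ℂ) ^ s * Complex.exp (-(w * u))‖ = u ^ s.re * Real.exp (-w.re * u) := by
  rw [norm_mul, Complex.norm_cpow_eq_rpow_re_of_pos hu, Complex.norm_exp]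
  simp

lemma integrableOn_rpow_mul_exp {p b : ℝ} (hp : 0 < p) (hb : 0 < b) :
    IntegrableOn (fun u : ℝ => u ^ p * Real.exp (-b * u)) (Set.Ioi 0) := by
  have := integrableOn_rpow_mul_exp_neg_mul_rpow (s := p) (p := 1) (b := b) (by linarith)
    one_pos hb
  simpa using this

lemma measurable_laplace_integrand (s w : ℂ) :
    Measurable fun u : ℝ => (u : ℂ) ^ s * Complex.exp (-(w * u)) := by
  fun_prop

lemma integrableOn_laplace {s w : ℂ} (hs : 0 < s.re) (hw : 0 < w.re) :
    IntegrableOn (fun u : ℝ => (u : ℂ) ^ s * Complex.exp (-(w * u))) (Set.Ioi 0) := by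
  refine (integrableOn_rpow_mul_exp hs hw).mono'
    (measurable_laplace_integrand s w).aestronglyMeasurable ?_
  refine (ae_restrict_iff' measurableSet_Ioi).2 (ae_of_all _ fun u hu => ?_)
  exact (norm_laplace_integrand s w hu).le

/-- Integration by parts. -/
lemma laplacePow_add_one {s w : ℂ} (hs : 0 < s.re) (hw : 0 < w.re) :
    w * laplacePow (s + 1) w = (s + 1) * laplacePow s w := by
  have hs1 : 0 < (s + 1).re := by simp; linarith
  have hne : s + 1 ≠ 0 := fun h => by simp [h] at hs1
  have hder : ∀ u ∈ Set.Ioi (0 : ℝ),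
      HasDerivAt (fun u : ℝ => (u : ℂ) ^ (s + 1) * Complex.exp (-(w * u)))
        ((s + 1) * ((u : ℂ) ^ s * Complex.exp (-(w * u))) -
          w * ((u : ℂ) ^ (s + 1) * Complex.exp (-(w * u)))) u := by
    intro u hu
    have h0 : HasDerivAt (fun z : ℂ => z ^ (s + 1)) ((s + 1) * (u : ℂ) ^ (s + 1 - 1)) (u : ℂ) :=
      (hasStrictDerivAt_id _).cpow_const (Complex.ofReal_mem_slitPlane.2 hu)
        |>.hasDerivAt |>.congr_deriv (mul_one _)
    have h1 : HasDerivAt (fun u : ℝ => -(w * (u : ℂ))) (-(w * 1)) u :=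
      ((hasDerivAt_id u).ofReal_comp.const_mul w).neg
    have h2 := (h0.comp_ofReal).mul h1.cexp
    refine h2.congr_deriv ?_
    simp only [add_sub_cancel_right]
    ring
  have hcont : ContinuousWithinAt (fun u : ℝ => (u : ℂ) ^ (s + 1) * Complex.exp (-(w * u)))
      (Set.Ici 0) 0 :=
    ((Complex.continuous_ofReal_cpow_const hs1).mul (by fun_prop)).continuousWithinAt
  have hlim : Tendsto (fun u : ℝ => (u : ℂ) ^ (s + 1) * Complex.exp (-(w * u))) atTop (𝓝 0) := by
    rw [tendsto_zero_iff_norm_tendsto_zero]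
    refine (tendsto_rpow_mul_exp_neg_mul_atTop_nhds_zero (s + 1).re w.re hw).congr' ?_
    filter_upwards [eventually_gt_atTop 0] with u hu
    exact (norm_laplace_integrand _ _ hu).symm
  have hi0 := (integrableOn_laplace hs hw).const_mul (s + 1)
  have hi1 := (integrableOn_laplace hs1 hw).const_mul w
  have h := integral_Ioi_of_hasDerivAt_of_tendsto hcont hder (hi0.sub hi1) hlim
  rw [integral_sub hi0 hi1, integral_const_mul, integral_const_mul] at h
  simp only [Complex.ofReal_zero, Complex.zero_cpow hne, zero_mul, sub_zero] at h
  exact (sub_eq_zero.1 h).symm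

lemma hasDerivAt_laplacePow {s w : ℂ} (hs : 0 < s.re) (hw : 0 < w.re) :
    HasDerivAt (laplacePow s) (-laplacePow (s + 1) w) w := by
  have hs1 : 0 < (s + 1).re := by simp; linarith
  have hball : ∀ v ∈ Metric.ball w (w.re / 2), w.re / 2 < v.re := by
    intro v hv
    have h1 : |(v - w).re| ≤ ‖v - w‖ := Complex.abs_re_le_norm _
    rw [← dist_eq_norm] at h1
    have h2 := (abs_lt.1 (h1.trans_lt (Metric.mem_ball.1 hv))).1
    simp at h2
    linarith
  have h := hasDerivAt_integral_of_dominated_loc_of_deriv_le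
    (μ := volume.restrict (Set.Ioi (0 : ℝ)))
    (F := fun v (u : ℝ) => (u : ℂ) ^ s * Complex.exp (-(v * u)))
    (F' := fun v (u : ℝ) => -((u : ℂ) ^ (s + 1) * Complex.exp (-(v * u))))
    (bound := fun u : ℝ => u ^ (s + 1).re * Real.exp (-(w.re / 2) * u))
    (Metric.ball_mem_nhds w (half_pos hw))
    (Eventually.of_forall fun v => (measurable_laplace_integrand s v).aestronglyMeasurable)
    (integrableOn_laplace hs hw)
    (measurable_laplace_integrand (s + 1) w).neg.aestronglyMeasurable
    ((ae_restrict_iff' measurableSet_Ioi).2 (ae_of_all _ fun u hu v hv => by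
      rw [norm_neg, norm_laplace_integrand _ _ hu]
      have := hball v hv
      have hu' : (0 : ℝ) < u := hu
      gcongr))
    (integrableOn_rpow_mul_exp hs1 (half_pos hw))
    ((ae_restrict_iff' measurableSet_Ioi).2 (ae_of_all _ fun u hu v hv => by
      have hu' : (u : ℂ) ≠ 0 := by exact_mod_cast (ne_of_gt hu)
      have h1 : HasDerivAt (fun v : ℂ => -(v * (u : ℂ))) (-(1 * (u : ℂ))) v :=
        ((hasDerivAt_id v).mul_const (u : ℂ)).neg
      refine (h1.cexp.const_mul _).congr_deriv ?_
      rw [Complex.cpow_add _ _ hu', Complex.cpow_one]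
      ring))
  refine h.2.congr_deriv ?_
  rw [integral_neg, laplacePow]

lemma laplacePow_one {s : ℂ} (hs : 0 < s.re) : laplacePow s 1 = Complex.Gamma (s + 1) := by
  rw [Complex.Gamma_eq_integral (by simp; linarith), Complex.GammaIntegral, laplacePow]
  refine setIntegral_congr_fun measurableSet_Ioi fun u _ => ?_
  simp [mul_comm]

/-- The function `w^{s+1} ∫₀^∞ u^s e^{-wu} du` is constant on the half-plane `Re w > 0`, hence
equal to its value `Γ(s + 1)` at `1`. -/
lemma laplacePow_ne_zero {s w : ℂ} (hs : 0 < s.re) (hw : 0 < w.re) : laplacePow s w ≠ 0 := by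
  have hs1 : 0 < (s + 1).re := by simp; linarith
  have hne : s + 1 ≠ 0 := fun h => by simp [h] at hs1
  have hder : ∀ v ∈ {v : ℂ | 0 < v.re},
      HasDerivAt (fun v : ℂ => v ^ (s + 1) * laplacePow s v) 0 v := by
    intro v hv
    have hv0 : v ≠ 0 := fun h => by simp [h] at hv
    have h0 : HasDerivAt (fun z : ℂ => z ^ (s + 1)) ((s + 1) * v ^ (s + 1 - 1)) v :=
      (hasStrictDerivAt_id _).cpow_const (Or.inl hv) |>.hasDerivAt |>.congr_deriv (mul_one _)
    refine (h0.mul (hasDerivAt_laplacePow hs hv)).congr_deriv ?_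
    rw [add_sub_cancel_right, Complex.cpow_add _ _ hv0, Complex.cpow_one]
    have := laplacePow_add_one hs hv
    linear_combination (-v ^ s) * this
  have hconst := (isOpen_lt continuous_const Complex.continuous_re).is_const_of_deriv_eq_zero
    (s := {v : ℂ | 0 < v.re}) (convex_halfSpace_re_gt 0).isPreconnected
    (fun v hv => (hder v hv).differentiableAt.differentiableWithinAt)
    (fun v hv => (hder v hv).deriv) (x := w) (y := 1) hw (by simp)
  rw [Complex.one_cpow, one_mul, laplacePow_one hs] at hconst
  intro h
  rw [h, mul_zero] at hconst
  exact Complex.Gamma_ne_zero_of_re_pos hs1 hconst.symm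

/-- Watson's lemma at leading order for the Euler integral: after the substitution `u = r x` the
integral over `[0, r]` converges by domination. -/
lemma tendsto_euler_integral {s z : ℂ} (hs : 0 < s.re) (hz : 0 < z.re) :
    Tendsto (fun r : ℝ => (r : ℂ) ^ (s + 1) * Complex.exp (-(z * r)) *
      ∫ x in (0 : ℝ)..1, eulerKernel s x * Complex.exp (z * r * (1 - 2 * x))) atTop
      (𝓝 (laplacePow s (2 * z))) := by
  have key : ∀ᶠ r : ℝ in atTop, (∫ u in Set.Ioi (0 : ℝ), Set.indicator (Set.Iic r)
      (fun u : ℝ => ((u * (1 - u / r) : ℝ) : ℂ) ^ s * Complex.exp (-(2 * z * u))) u) =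
      (r : ℂ) ^ (s + 1) * Complex.exp (-(z * r)) *
      ∫ x in (0 : ℝ)..1, eulerKernel s x * Complex.exp (z * r * (1 - 2 * x)) := by
    filter_upwards [eventually_gt_atTop 0] with r hr
    have hr' : (r : ℂ) ≠ 0 := by exact_mod_cast hr.ne'
    rw [integral_indicator measurableSet_Iic, Measure.restrict_restrict measurableSet_Iic,
      Set.inter_comm, Set.Ioi_inter_Iic, ← intervalIntegral.integral_of_le hr.le]
    have h1 := intervalIntegral.integral_comp_mul_left (a := 0) (b := 1)
      (fun u : ℝ => ((u * (1 - u / r) : ℝ) : ℂ) ^ s * Complex.exp (-(2 * z * u))) hr.ne'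
    simp only [mul_zero, mul_one] at h1
    have h2 : (∫ u in (0 : ℝ)..r, ((u * (1 - u / r) : ℝ) : ℂ) ^ s * Complex.exp (-(2 * z * u))) =
        r * ∫ x in (0 : ℝ)..1, ((r * x * (1 - r * x / r) : ℝ) : ℂ) ^ s *
          Complex.exp (-(2 * z * ((r * x : ℝ) : ℂ))) := by
      rw [h1, Complex.real_smul]
      push_cast
      rw [mul_inv_cancel_left₀ hr']
    rw [h2, ← intervalIntegral.integral_const_mul, ← intervalIntegral.integral_const_mul]
    refine intervalIntegral.integral_congr fun x hx => ?_
    rw [Set.uIcc_of_le zero_le_one] at hx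
    simp only [eulerKernel]
    rw [show r * x * (1 - r * x / r) = r * (x * (1 - x)) by field_simp, Complex.ofReal_mul,
      Complex.mul_cpow_ofReal_nonneg hr.le (mul_nonneg hx.1 (by linarith [hx.2])),
      Complex.cpow_add _ _ hr', Complex.cpow_one,
      show -(2 * z * ((r * x : ℝ) : ℂ)) = -(z * r) + z * r * (1 - 2 * x) by push_cast; ring,
      Complex.exp_add]
    ring
  refine Tendsto.congr' key ?_
  refine tendsto_integral_filter_of_dominated_convergence
    (fun u : ℝ => u ^ s.re * Real.exp (-(2 * z).re * u)) (Eventually.of_forall fun r => ?_) ?_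
    (integrableOn_rpow_mul_exp hs (by simpa using hz)) ?_
  · refine (Measurable.indicator ?_ measurableSet_Iic).aestronglyMeasurable
    fun_prop
  · filter_upwards [eventually_gt_atTop 0] with r hr
    refine (ae_restrict_iff' measurableSet_Ioi).2 (ae_of_all _ fun u hu => ?_)
    have hu : 0 < u := hu
    by_cases hur : u ≤ r
    · rw [Set.indicator_of_mem (Set.mem_Iic.2 hur), norm_mul, Complex.norm_exp]
      have h0 : 0 ≤ 1 - u / r := sub_nonneg.2 ((div_le_one hr).2 hur)
      have h1 : 1 - u / r ≤ 1 := sub_le_self _ (by positivity)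
      have h2 : (-(2 * z * (u : ℂ))).re = -(2 * z).re * u := by simp
      rw [h2]
      gcongr
      rw [Complex.norm_cpow_eq_rpow_re_of_nonneg (by positivity) hs.ne']
      gcongr
      nlinarith
    · rw [Set.indicator_of_notMem (by simpa using hur)]
      simp only [norm_zero]
      positivity
  · refine (ae_restrict_iff' measurableSet_Ioi).2 (ae_of_all _ fun u hu => ?_)
    have h1 : Tendsto (fun r : ℝ => ((u * (1 - u / r) : ℝ) : ℂ) ^ s *
        Complex.exp (-(2 * z * u))) atTop (𝓝 ((u : ℂ) ^ s * Complex.exp (-(2 * z * u)))) := by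
      refine Tendsto.mul_const _ ?_
      refine ((Complex.continuous_ofReal_cpow_const hs).tendsto u).comp ?_
      have := ((tendsto_const_nhds (x := u)).div_atTop tendsto_id).const_sub (1 : ℝ)
      simpa using this.const_mul u
    refine h1.congr' ?_
    filter_upwards [eventually_ge_atTop u] with r hr
    rw [Set.indicator_of_mem (Set.mem_Iic.2 hr)]

/-- On a ray in the right half-plane, `Θ_ν(z²r²)` is asymptotic to a nonzero multiple of
`r^{-ν - 1/2} e^{zr}`. -/
lemma exists_tendsto_Theta {ν z : ℂ} (hν : 1 / 2 < ν.re) (hz : 0 < z.re) :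
    ∃ L : ℂ, L ≠ 0 ∧ Tendsto (fun r : ℝ => (r : ℂ) ^ (ν + 1 / 2) * Complex.exp (-(z * r)) *
      Theta ν (z ^ 2 * (r : ℂ) ^ 2)) atTop (𝓝 L) := by
  have hs : 0 < (ν - 1 / 2).re := by simp; linarith
  have hlim := tendsto_euler_integral hs hz
  have hL := laplacePow_ne_zero (s := ν - 1 / 2) (w := 2 * z) hs (by simpa using hz)
  simp only [euler_integral_eq hν] at hlim
  set C := eulerMoment (ν - 1 / 2) 0 * Complex.Gamma (1 + ν)
  -- the constant need not be computed: if it vanished, so would the limit of the Euler integral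
  have hC : C ≠ 0 := by
    rintro h
    simp only [h, zero_mul, mul_zero] at hlim
    exact hL (tendsto_nhds_unique hlim tendsto_const_nhds)
  refine ⟨C⁻¹ * laplacePow (ν - 1 / 2) (2 * z), mul_ne_zero (inv_ne_zero hC) hL, ?_⟩
  refine (hlim.const_mul C⁻¹).congr fun r => ?_
  rw [show ν - 1 / 2 + 1 = ν + 1 / 2 by ring, mul_pow]
  field_simp

/-! ### The phase of `Θ_ν` along a ray, and the angle function of the spirals -/

/-- A nonvanishing `C¹` curve in `ℂ` has a differentiable logarithm. -/
lemma exists_log_lift {f f' : ℝ → ℂ} (hf : ∀ r, HasDerivAt f (f' r) r) (hf' : Continuous f')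
    (h0 : ∀ r, f r ≠ 0) : ∃ Λ : ℝ → ℂ, Differentiable ℝ Λ ∧ ∀ r, f r = Complex.exp (Λ r) := by
  have hfc : Continuous f := continuous_iff_continuousAt.2 fun r => (hf r).continuousAt
  have hg : Continuous fun r => f' r / f r := hf'.div hfc h0
  set Λ : ℝ → ℂ := fun r => Complex.log (f 0) + ∫ t in (0 : ℝ)..r, f' t / f t with hΛ
  have hd : ∀ r, HasDerivAt Λ (f' r / f r) r := fun r =>
    ((hg.integral_hasStrictDerivAt 0 r).hasDerivAt).const_add _
  refine ⟨Λ, fun r => (hd r).differentiableAt, fun r => ?_⟩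
  have hq : ∀ r, HasDerivAt (fun r => f r * Complex.exp (-Λ r)) 0 r := fun r => by
    refine ((hf r).mul (hd r).neg.cexp).congr_deriv ?_
    have := h0 r
    field_simp
    simp
  have hc := is_const_of_deriv_eq_zero (fun r => (hq r).differentiableAt)
    (fun r => (hq r).deriv) r 0
  have hΛ0 : Λ 0 = Complex.log (f 0) := by simp [hΛ]
  simp only [hΛ0, Complex.exp_neg, Complex.exp_log (h0 0), mul_inv_cancel₀ (h0 0)] at hc
  exact (mul_inv_eq_one₀ (Complex.exp_ne_zero _)).1 hc

/-- A continuous logarithm of an analytic function is analytic: locally it differs from a branch of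
the principal logarithm by a constant. -/
lemma analyticAt_of_exp {f Λ : ℝ → ℂ} {r : ℝ} (hΛ : ContinuousAt Λ r)
    (h : ∀ t, f t = Complex.exp (Λ t)) (hf : AnalyticAt ℝ f r) : AnalyticAt ℝ Λ r := by
  have h0 : f r ≠ 0 := h r ▸ Complex.exp_ne_zero _
  have h1 : AnalyticAt ℝ (fun t => Λ r + Complex.log (f t / f r)) r := by
    have hlog : AnalyticAt ℝ Complex.log (f r / f r) := by
      rw [div_self h0]
      exact (analyticAt_clog (by simp)).restrictScalars
    have hdiv : AnalyticAt ℝ (fun t => f t / f r) r := hf.div analyticAt_const h0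
    exact analyticAt_const.add (AnalyticAt.fun_comp (f := fun t => f t / f r) hlog hdiv)
  refine h1.congr ?_
  have h2 : Tendsto (fun t => (Λ t - Λ r).im) (𝓝 r) (𝓝 0) := by
    have h3 : ContinuousAt (fun t => (Λ t - Λ r).im) r := by fun_prop
    simpa using h3.tendsto
  filter_upwards [h2.eventually (Ioo_mem_nhds (neg_lt_zero.2 Real.pi_pos) Real.pi_pos)] with t ht
  rw [h t, h r, ← Complex.exp_sub, Complex.log_exp ht.1 ht.2.le]
  ring

/-- A curve in `ℂ` whose exponential has a nonzero limit at infinity has bounded imaginary part. -/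
lemma exists_bound_im_of_tendsto_exp {H : ℝ → ℂ} (hd : ∀ r, 0 < r → DifferentiableAt ℝ H r)
    {L : ℂ} (hL : L ≠ 0) (h : Tendsto (fun r => Complex.exp (H r)) atTop (𝓝 L)) :
    ∃ C : ℝ, ∀ᶠ r in atTop, |(H r).im| ≤ C := by
  have h1 : Tendsto (fun r => Complex.exp (H r) / L) atTop (𝓝 1) := by
    simpa [hL] using h.div_const L
  have h2 : ∀ᶠ r in atTop, Complex.exp (H r) / L ∈ Complex.slitPlane :=
    h1.eventually (Complex.isOpen_slitPlane.mem_nhds (by simp))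
  obtain ⟨R, hR⟩ := eventually_atTop.1 (h2.and (eventually_gt_atTop (0 : ℝ)))
  have hD : ∀ r ∈ Set.Ioi R, HasDerivAt (fun r => H r - Complex.log (Complex.exp (H r) / L)) 0 r := by
    intro r hr
    have hr := hR r (le_of_lt hr)
    have hH := (hd r hr.2).hasDerivAt
    refine (hH.sub ((hH.cexp.div_const L).clog_real hr.1)).congr_deriv ?_
    have := Complex.exp_ne_zero (H r)
    field_simp
    simp
  -- `H` differs by a constant from a principal logarithm, whose imaginary part is at most `π`
  have hconst := fun x y (hx : x ∈ Set.Ioi R) (hy : y ∈ Set.Ioi R) =>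
    isOpen_Ioi.is_const_of_deriv_eq_zero isPreconnected_Ioi
    (fun r hr => (hD r hr).differentiableAt.differentiableWithinAt) (fun r hr => (hD r hr).deriv)
    hx hy
  refine ⟨|(H (R + 1) - Complex.log (Complex.exp (H (R + 1)) / L)).im| + Real.pi, ?_⟩
  filter_upwards [eventually_gt_atTop R] with r hr
  have hc := hconst r (R + 1) hr (by simp)
  have : H r = (H (R + 1) - Complex.log (Complex.exp (H (R + 1)) / L)) +
      Complex.log (Complex.exp (H r) / L) := by rw [← hc]; ring
  rw [this, Complex.add_im]
  refine (abs_add_le _ _).trans (add_le_add le_rfl ?_)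
  rw [Complex.log_im]
  exact Complex.abs_arg_le_pi _

/-- The slope is `-(2/K) Im √λ` for the square root with positive real part; the sign of `ω` enters
because `Im λ = ωK/2 = 2 Re √λ Im √λ`. -/
lemma slope_eq_im {K : ℕ} (hK : 0 < K) (a : Fin K → Fin K → ℝ) {μ ω : ℝ} (hω : ω ≠ 0) :
    ∃ z : ℂ, 0 < z.re ∧ z ^ 2 = lam a μ ω ∧ slope a μ ω = -(2 / K) * z.im ∧ z.im ≠ 0 := by
  have hK' : (0 : ℝ) < K := by exact_mod_cast hK
  set l := lam a μ ω with hl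
  have him : l.im = ω * (K / 2) := lam_im a μ ω
  have hre : l.re = ω * asymmetry a - μ := lam_re a μ ω
  have him0 : l.im ≠ 0 := by rw [him]; positivity
  have hl0 : l ≠ 0 := fun h => him0 (by simp [h])
  set z := Complex.exp (Complex.log l / 2) with hz
  have hz2 : z ^ 2 = l := by
    rw [hz, ← Complex.exp_nat_mul]
    push_cast
    rw [mul_div_cancel₀ _ two_ne_zero, Complex.exp_log hl0]
  have harg : |l.arg| < Real.pi := by
    refine lt_of_le_of_ne (Complex.abs_arg_le_pi l) fun h => ?_
    rcases abs_cases l.arg with ⟨h1, _⟩ | ⟨h1, _⟩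
    · exact him0 (Complex.arg_eq_pi_iff.1 (h1.symm.trans h)).2
    · linarith [Complex.neg_pi_lt_arg l]
  have hzre : 0 < z.re := by
    rw [hz, Complex.exp_re]
    refine mul_pos (Real.exp_pos _) (Real.cos_pos_of_mem_Ioo ?_)
    have : (Complex.log l / 2).im = l.arg / 2 := by
      rw [show Complex.log l / 2 = ((1 / 2 : ℝ) : ℂ) * Complex.log l by push_cast; ring,
        Complex.im_ofReal_mul, Complex.log_im]
      ring
    rw [this]
    rw [abs_lt] at harg
    constructor <;> linarith
  have h1 : z.re ^ 2 - z.im ^ 2 = l.re := by rw [← hz2]; simp [sq]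
  have h2 : 2 * z.re * z.im = l.im := by rw [← hz2]; simp [sq]; ring
  have hzim : z.im ≠ 0 := fun h => him0 (by rw [← h2, h, mul_zero])
  refine ⟨z, hzre, hz2, ?_, hzim⟩
  have h3 : ((ω * asymmetry a - μ) / 2) ^ 2 + (ω * K / 4) ^ 2 =
      ((z.re ^ 2 + z.im ^ 2) / 2) ^ 2 := by
    rw [← hre, show ω * K / 4 = l.im / 2 by rw [him]; ring, ← h1, ← h2]
    ring
  rw [slope, h3, Real.sqrt_sq (by positivity), ← hre,
    show (z.re ^ 2 + z.im ^ 2) / 2 - l.re / 2 = z.im ^ 2 by rw [← h1]; ring, Real.sqrt_sq_eq_abs]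
  have hmul : 0 < ω * z.im := by
    have h4 : ω * z.im = ω ^ 2 * K / (4 * z.re) := by
      rw [him] at h2
      field_simp
      linear_combination 2 * h2
    rw [h4]
    positivity
  rcases lt_or_gt_of_ne hω with h | h
  · rw [Real.sign_of_neg h, abs_of_neg (by nlinarith)]; ring
  · rw [Real.sign_of_pos h, abs_of_pos (by nlinarith)]; ring

/-- The polar form of the explicit function: its amplitude, and the angle function of its nodal
lines together with the behaviour of the latter at the origin and at infinity. -/
lemma exists_angle {K : ℕ} (hK : 3 ≤ K) (a : Fin K → Fin K → ℝ) {μ ω : ℝ}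
    (hres : NonResonant a μ ω) :
    ∃ (A ϑ : ℝ → ℝ) (β : ℝ), (∀ r, 0 < r → 0 < A r) ∧ AnalyticOnNhd ℝ ϑ (Set.Ioi 0) ∧
      (∀ r θ : ℝ, 0 < r → mode a μ ω r θ =
        Real.exp (asymmetry a * θ) * A r * Real.sin (K / 2 * (θ - ϑ r))) ∧
      Tendsto (fun r => ϑ r - 2 / K * (β + asymmetry a * Real.log r)) (𝓝[>] 0) (𝓝 0) ∧
      (ω ≠ 0 → slope a μ ω ≠ 0 ∧
        (fun r => ϑ r - slope a μ ω * r) =O[atTop] (fun _ => (1 : ℝ))) := by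
  have hK' : (3 : ℝ) ≤ K := by exact_mod_cast hK
  have hν : 1 / 2 < (order a).re := by rw [order_re]; linarith
  have hν0 : 0 < (order a).re := by linarith
  set ν := order a with hνdef
  set l := lam a μ ω with hl
  set f : ℝ → ℂ := fun r => Theta ν (l * (r : ℂ) ^ 2) with hf
  have hfd : ∀ r : ℝ, HasDerivAt f (Theta (ν + 1) (l * (r : ℂ) ^ 2) / 4 * (l * (2 * r))) r := by
    intro r
    have h1 : HasDerivAt (fun z : ℂ => l * z ^ 2) (l * (2 * r)) (r : ℂ) := by
      simpa using ((hasDerivAt_id (r : ℂ)).pow 2).const_mul l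
    exact ((hasDerivAt_Theta hν0 _).comp (r : ℂ) h1).comp_ofReal
  have hcont : Continuous (Theta (ν + 1)) :=
    (differentiable_Theta (by simp; linarith)).continuous
  have hf0 : ∀ r, f r ≠ 0 := by
    intro r
    rcases eq_or_ne r 0 with rfl | hr
    · simpa [hf] using Theta_zero_ne_zero hν0
    · have := hres (r ^ 2) (by positivity)
      simp only [hf]
      rw [mul_comm]
      simpa using this
  obtain ⟨Λ, hΛd, hΛ⟩ := exists_log_lift hfd (by fun_prop) hf0
  have hΛan : ∀ r, AnalyticAt ℝ Λ r := by
    intro r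
    refine analyticAt_of_exp hΛd.continuous.continuousAt hΛ ?_
    have h1 : AnalyticAt ℝ (Theta ν) (l * (r : ℂ) ^ 2) :=
      ((differentiable_Theta hν0).analyticAt _).restrictScalars
    have h2 : AnalyticAt ℝ (fun r : ℝ => l * (r : ℂ) ^ 2) r :=
      analyticAt_const.mul ((Complex.ofRealCLM.analyticAt r).pow 2)
    exact AnalyticAt.fun_comp (f := fun r : ℝ => l * (r : ℂ) ^ 2) h1 h2
  have hΛim : ∀ r, AnalyticAt ℝ (fun r => (Λ r).im) r := fun r =>
    (Complex.imCLM.analyticAt _).fun_comp (hΛan r)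
  -- the shift by `π / 2` turns the cosine in the real part into the sine of the statement
  set ϑ : ℝ → ℝ := fun r => 2 / K * (asymmetry a * Real.log r - (Λ r).im - Real.pi / 2) with hϑ
  refine ⟨fun r => r ^ ((K : ℝ) / 2) * Real.exp (Λ r).re, ϑ, -(Λ 0).im - Real.pi / 2,
    fun r hr => by positivity, ?_, ?_, ?_, ?_⟩
  · intro r hr
    exact analyticAt_const.mul (((analyticAt_const.mul (analyticAt_log hr)).sub (hΛim r)).sub
      analyticAt_const)
  · intro r θ hr
    have h1 : Theta ν (l * (r : ℂ) ^ 2) = Complex.exp (Λ r) := hΛ r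
    rw [mode, ← hνdef, ← hl, h1, ← Complex.exp_add, Complex.exp_re]
    have h2 : (Complex.I * (((K : ℝ) / 2 * θ - asymmetry a * Real.log r : ℝ) : ℂ) + Λ r).im =
        K / 2 * (θ - ϑ r) - Real.pi / 2 := by
      simp only [Complex.add_im, Complex.I_mul_im, Complex.ofReal_re, hϑ]
      field_simp
      ring
    have h3 : (Complex.I * (((K : ℝ) / 2 * θ - asymmetry a * Real.log r : ℝ) : ℂ) + Λ r).re =
        (Λ r).re := by
      simp only [Complex.add_re, Complex.I_mul_re, Complex.ofReal_im]
      ring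
    rw [h2, h3, Real.cos_sub_pi_div_two]
    ring
  · have h1 : Tendsto (fun r => 2 / K * ((Λ 0).im - (Λ r).im)) (𝓝[>] 0)
        (𝓝 (2 / K * ((Λ 0).im - (Λ 0).im))) := by
      refine Tendsto.mono_left ?_ nhdsWithin_le_nhds
      exact ((hΛim 0).continuousAt.tendsto.const_sub _).const_mul _
    rw [sub_self, mul_zero] at h1
    refine h1.congr fun r => ?_
    simp only [hϑ]
    ring
  · intro hω
    obtain ⟨z, hzre, hz2, hslope, hzim⟩ := slope_eq_im (by omega) a (μ := μ) hω
    refine ⟨by rw [hslope]; have : (K : ℝ) ≠ 0 := by positivity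
               exact mul_ne_zero (by simpa using this) hzim, ?_⟩
    obtain ⟨L, hL, hlim⟩ := exists_tendsto_Theta hν hzre
    rw [hz2, ← hl] at hlim
    -- `Λ` minus its expected asymptotics, up to a bounded imaginary part
    set H : ℝ → ℂ := fun r => Λ r - z * r + (ν + 1 / 2) * (Real.log r : ℂ) with hH
    have hexp : Tendsto (fun r => Complex.exp (H r)) atTop (𝓝 L) := by
      refine hlim.congr' ?_
      filter_upwards [eventually_gt_atTop 0] with r hr
      have hr' : (r : ℂ) ≠ 0 := by exact_mod_cast hr.ne'
      have h1 : Theta ν (l * (r : ℂ) ^ 2) = Complex.exp (Λ r) := hΛ r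
      rw [h1, Complex.cpow_def_of_ne_zero hr', ← Complex.exp_add, ← Complex.exp_add,
        ← Complex.ofReal_log hr.le]
      congr 1
      simp only [hH]
      ring
    obtain ⟨C, hC⟩ := exists_bound_im_of_tendsto_exp (H := H) (fun r hr => by
      have h1 : DifferentiableAt ℝ (fun r : ℝ => (Real.log r : ℂ)) r :=
        (Real.hasDerivAt_log hr.ne').ofReal_comp.differentiableAt
      have h2 : DifferentiableAt ℝ (fun r : ℝ => (r : ℂ)) r :=
        (hasDerivAt_id r).ofReal_comp.differentiableAt
      exact ((hΛd r).sub (h2.const_mul z)).add (h1.const_mul _)) hL hexp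
    refine IsBigO.of_bound (2 / K * (C + Real.pi / 2)) ?_
    filter_upwards [hC, eventually_gt_atTop 0] with r hr hr0
    have him : (H r).im = (Λ r).im - z.im * r - asymmetry a * Real.log r := by
      have : (ν + 1 / 2).im = -asymmetry a := by
        rw [Complex.add_im, hνdef, order_im]
        norm_num
      simp only [hH, Complex.add_im, Complex.sub_im]
      rw [Complex.im_mul_ofReal, Complex.im_mul_ofReal, this]
      ring
    have h2 : ϑ r - slope a μ ω * r = 2 / K * (-(H r).im - Real.pi / 2) := by
      rw [hslope, him]
      simp only [hϑ]
      ring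
    rw [h2, norm_one, mul_one, Real.norm_eq_abs, abs_mul, abs_of_pos (by positivity)]
    gcongr
    rw [abs_le] at hr ⊢
    constructor <;> linarith [Real.pi_pos]

/-! ### Integration by parts against Lipschitz test functions -/

/-- The standard basis of the plane. -/
abbrev unitVec (i : Fin 2) : Plane := EuclideanSpace.single i 1

lemma clm_apply_eq_sum (L : Plane →L[ℝ] ℝ) (v : Plane) : L v = ∑ i, v i * L (unitVec i) := by
  have h : v = ∑ i, v i • unitVec i := by
    ext j
    fin_cases j <;> simp [Fin.sum_univ_two]
  conv_lhs => rw [h]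
  simp

lemma gradient_apply (u : Plane → ℝ) (x : Plane) (i : Fin 2) :
    gradient u x i = fderiv ℝ u x (unitVec i) := by
  rw [← inner_gradient_left, EuclideanSpace.inner_single_right]
  simp

lemma norm_gradient (u : Plane → ℝ) (x : Plane) : ‖gradient u x‖ = ‖fderiv ℝ u x‖ := by
  simp [gradient]

lemma measurable_gradient (u : Plane → ℝ) : Measurable (gradient u) := by
  have : Measurable fun x => (InnerProductSpace.toDual ℝ Plane).symm (fderiv ℝ u x) :=
    (InnerProductSpace.toDual ℝ Plane).symm.continuous.measurable.comp (measurable_fderiv ℝ u)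
  exact this

lemma exists_smooth_cutoff {C D : Set Plane} (hC : IsCompact C) (hD : IsOpen D) (h : C ⊆ D) :
    ∃ χ : Plane → ℝ, ContDiff ℝ ((⊤ : ℕ∞) : WithTop ℕ∞) χ ∧ HasCompactSupport χ ∧ tsupport χ ⊆ D ∧
      (∀ x ∈ C, ∀ᶠ y in 𝓝 x, χ y = 1) ∧ ∀ x, χ x ∈ Set.Icc (0 : ℝ) 1 := by
  obtain ⟨E, hE, hCE, hED⟩ := exists_compact_between hC hD h
  obtain ⟨χ, h1, h0, hI⟩ := exists_contMDiffMap_one_nhds_of_subset_interior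
    (modelWithCornersSelf ℝ Plane) (n := (⊤ : ℕ∞)) hC.isClosed hCE
  have hts : tsupport χ ⊆ E := closure_minimal
    (fun x hx => by by_contra hxE; exact hx (h0 x hxE)) hE.isClosed
  exact ⟨χ, χ.contMDiff.contDiff, HasCompactSupport.of_support_subset_isCompact hE
    (subset_closure.trans hts), hts.trans hED, fun x hx => 
    h1.filter_mono (nhds_le_nhdsSet hx), hI⟩

lemma integrable_of_bounded_of_support {F : Plane → ℝ} (hF : Measurable F) {S : Set Plane}
    (hS : IsCompact S) {C : ℝ} (hb : ∀ x ∈ S, |F x| ≤ C) (h0 : ∀ x, x ∉ S → F x = 0) :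
    Integrable F := by
  refine (integrableOn_iff_integrable_of_support_subset
    (s := S) (fun x hx => by by_contra h; exact hx (h0 x h))).1 ?_
  refine Measure.integrableOn_of_bounded hS.measure_lt_top.ne hF.aestronglyMeasurable (M := C) ?_
  exact (ae_restrict_iff' hS.measurableSet).2 (ae_of_all _ hb)

lemma lipschitz_mul {f g : Plane → ℝ} {K L : NNReal} {A B : ℝ} (hf : LipschitzWith K f)
    (hg : LipschitzWith L g) (hA : ∀ x, |f x| ≤ A) (hB : ∀ x, |g x| ≤ B) :
    LipschitzWith (Real.toNNReal (A * L + B * K)) (fun x => f x * g x) := by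
  have hA0 : 0 ≤ A := (abs_nonneg _).trans (hA 0)
  have hB0 : 0 ≤ B := (abs_nonneg _).trans (hB 0)
  refine LipschitzWith.of_dist_le_mul fun x y => ?_
  rw [Real.coe_toNNReal _ (by positivity), Real.dist_eq,
    show f x * g x - f y * g y = f x * (g x - g y) + g y * (f x - f y) by ring]
  refine (abs_add_le _ _).trans ?_
  rw [abs_mul, abs_mul, add_mul, mul_assoc, mul_assoc]
  have h1 := hf.dist_le_mul x y
  have h2 := hg.dist_le_mul x y
  rw [Real.dist_eq] at h1 h2
  exact add_le_add (mul_le_mul (hA x) h2 (abs_nonneg _) hA0)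
    (mul_le_mul (hB y) h1 (abs_nonneg _) hB0)

lemma exists_bound_of_hasCompactSupport {φ : Plane → ℝ} (hc : Continuous φ)
    (hφ : HasCompactSupport φ) : ∃ M, 0 ≤ M ∧ ∀ x, |φ x| ≤ M := by
  obtain ⟨M, hM⟩ := hφ.exists_bound_of_continuous hc
  exact ⟨M, (norm_nonneg _).trans (hM 0), hM⟩

/-- Integration by parts against a Lipschitz test function, for a function which is `C¹` on a
neighbourhood of the support of the test function. -/
lemma integral_fderiv_mul_lipschitz {D : Set Plane} (hD : IsOpen D) {f φ : Plane → ℝ} {L : NNReal}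
    (hφ : LipschitzWith L φ) (hφc : HasCompactSupport φ) (hφD : tsupport φ ⊆ D)
    (hf : ∀ x ∈ D, ContDiffAt ℝ 1 f x) (e : Plane) :
    Integrable (fun x => fderiv ℝ f x e * φ x) ∧ Integrable (fun x => f x * fderiv ℝ φ x e) ∧
      ∫ x, fderiv ℝ f x e * φ x = -∫ x, f x * fderiv ℝ φ x e := by
  obtain ⟨χ, hχs, hχc, hχD, hχ1, -⟩ := exists_smooth_cutoff hφc hD hφD
  set g : Plane → ℝ := fun x => χ x * f x with hg
  have hgs : ContDiff ℝ 1 g := by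
    rw [contDiff_iff_contDiffAt]
    intro x
    by_cases hx : x ∈ tsupport χ
    · exact ((hχs.of_le (by norm_cast)).contDiffAt).mul (hf x (hχD hx))
    · have : g =ᶠ[𝓝 x] fun _ => 0 := by
        filter_upwards [(isClosed_tsupport χ).isOpen_compl.mem_nhds hx] with y hy
        simp [hg, image_eq_zero_of_notMem_tsupport hy]
      exact contDiffAt_const.congr_of_eventuallyEq this
  have hgc : HasCompactSupport g := hχc.mul_right
  obtain ⟨M, hM⟩ := ContDiff.lipschitzWith_of_hasCompactSupport hgc hgs one_ne_zero
  have hgf : ∀ x ∈ tsupport φ, g =ᶠ[𝓝 x] f := fun x hx => by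
    filter_upwards [hχ1 x hx] with y hy
    simp [hg, hy]
  have h := hM.integral_lineDeriv_mul_eq (μ := volume) hφ hφc e
  have e1 : ∀ x, lineDeriv ℝ g x e * φ x = fderiv ℝ f x e * φ x := by
    intro x
    by_cases hx : x ∈ tsupport φ
    · rw [(hgs.differentiable one_ne_zero x).lineDeriv_eq_fderiv, (hgf x hx).fderiv_eq]
    · simp [image_eq_zero_of_notMem_tsupport hx]
  have e2 : (fun x => lineDeriv ℝ φ x (-e) * g x) =ᵐ[volume] fun x => -(f x * fderiv ℝ φ x e) := by
    filter_upwards [hφ.ae_differentiableAt] with x hx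
    rw [hx.lineDeriv_eq_fderiv]
    by_cases hxs : x ∈ tsupport φ
    · rw [(hgf x hxs).eq_of_nhds, map_neg]
      ring
    · simp [fderiv_of_notMem_tsupport ℝ hxs]
  have e3 : ∀ x, f x * fderiv ℝ φ x e = g x * fderiv ℝ φ x e := by
    intro x
    by_cases hx : x ∈ tsupport φ
    · rw [(hgf x hx).eq_of_nhds]
    · simp [fderiv_of_notMem_tsupport ℝ hx]
  refine ⟨?_, ?_, ?_⟩
  · have : Continuous fun x => fderiv ℝ g x e * φ x :=
      ((hgs.continuous_fderiv one_ne_zero).clm_apply continuous_const).mul hφ.continuous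
    refine (this.integrable_of_hasCompactSupport hφc.mul_left).congr (ae_of_all _ fun x => ?_)
    simp only
    rw [← e1, (hgs.differentiable one_ne_zero x).lineDeriv_eq_fderiv]
  · simp only [e3]
    obtain ⟨A, hA0, hA⟩ := exists_bound_of_hasCompactSupport hgs.continuous hgc
    refine integrable_of_bounded_of_support (S := tsupport φ) (C := A * (L * ‖e‖))
      (hgs.continuous.measurable.mul (measurable_fderiv_apply_const ℝ φ e)) hφc
      (fun x _ => ?_) (fun x hx => by simp [fderiv_of_notMem_tsupport ℝ hx])
    rw [abs_mul]
    refine mul_le_mul (hA x) ?_ (abs_nonneg _) hA0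
    refine ((fderiv ℝ φ x).le_opNorm e).trans ?_
    gcongr
    exact norm_fderiv_le_of_lipschitz ℝ hφ
  · simp only [e1] at h
    rw [h, integral_congr_ae e2, integral_neg]

/-! ### Classical solutions and the weak form -/

/-- `u` is `C²` at `x` and satisfies `-Δu + ω x^⊥ · ∇u = μ u` at `x`. -/
def ClassicalAt (μ ω : ℝ) (u : Plane → ℝ) (x : Plane) : Prop :=
  ContDiffAt ℝ 2 u x ∧ ∑ i, fderiv ℝ (fun y => fderiv ℝ u y (unitVec i)) x (unitVec i) =
    ω * fderiv ℝ u x (perp x) - μ * u x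

lemma ClassicalAt.congr {μ ω : ℝ} {u w : Plane → ℝ} {x : Plane} (h : ClassicalAt μ ω u x)
    (hw : w =ᶠ[𝓝 x] u) : ClassicalAt μ ω w x := by
  refine ⟨h.1.congr_of_eventuallyEq hw, ?_⟩
  have h1 : ∀ i, (fun y => fderiv ℝ w y (unitVec i)) =ᶠ[𝓝 x]
      fun y => fderiv ℝ u y (unitVec i) := fun i => by
    filter_upwards [hw.eventuallyEq_nhds] with y hy
    rw [hy.fderiv_eq]
  simp only [(h1 _).fderiv_eq, hw.fderiv_eq, hw.eq_of_nhds]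
  exact h.2

lemma contDiffAt_fderiv_apply {u : Plane → ℝ} {x : Plane} (h : ContDiffAt ℝ 2 u x) (e : Plane) :
    ContDiffAt ℝ 1 (fun y => fderiv ℝ u y e) x :=
  (h.fderiv_right (m := 1) (by norm_num [one_add_one_eq_two])).clm_apply contDiffAt_const

lemma ClassicalAt.const_mul {μ ω : ℝ} {u : Plane → ℝ} {x : Plane} (h : ClassicalAt μ ω u x)
    (c : ℝ) : ClassicalAt μ ω (fun y => c * u y) x := by
  refine ⟨contDiffAt_const.mul h.1, ?_⟩
  have h0 : ∀ᶠ y in 𝓝 x, ContDiffAt ℝ 2 u y := h.1.eventually (by simp)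
  have h1 : ∀ᶠ y in 𝓝 x, fderiv ℝ (fun y => c * u y) y = c • fderiv ℝ u y := by
    filter_upwards [h0] with y hy
    exact fderiv_const_mul (hy.differentiableAt two_ne_zero) c
  have h2 : ∀ i, (fun y => fderiv ℝ (fun y => c * u y) y (unitVec i)) =ᶠ[𝓝 x]
      fun y => c * fderiv ℝ u y (unitVec i) := fun i => by
    filter_upwards [h1] with y hy
    rw [hy]
    rfl
  have h3 : ∀ i, fderiv ℝ (fun y => c * fderiv ℝ u y (unitVec i)) x =
      c • fderiv ℝ (fun y => fderiv ℝ u y (unitVec i)) x := fun i =>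
    fderiv_const_mul ((contDiffAt_fderiv_apply h.1 _).differentiableAt one_ne_zero) c
  simp only [(h2 _).fderiv_eq, h3, h1.self_of_nhds, smul_apply, smul_eq_mul,
    ← Finset.mul_sum, h.2]
  ring

/-- A continuous function `u` together with a measurable, locally bounded vector field `G`
(in the applications, its gradient). -/
structure LocBdd (u : Plane → ℝ) (G : Plane → Plane) : Prop where
  cont : Continuous u
  meas : Measurable G
  bdd : ∀ R : ℝ, ∃ C : ℝ, 0 ≤ C ∧ ∀ x, ‖x‖ ≤ R → ‖G x‖ ≤ C

lemma LocBdd.zero : LocBdd 0 0 :=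
  ⟨continuous_const, measurable_const, fun _ => ⟨0, le_rfl, by simp⟩⟩

lemma LocBdd.add {u w : Plane → ℝ} {G H : Plane → Plane} (h : LocBdd u G) (h' : LocBdd w H) :
    LocBdd (u + w) (G + H) := by
  refine ⟨h.cont.add h'.cont, h.meas.add h'.meas, fun R => ?_⟩
  obtain ⟨C, hC0, hC⟩ := h.bdd R
  obtain ⟨C', hC0', hC'⟩ := h'.bdd R
  exact ⟨C + C', by positivity, fun x hx =>
    (norm_add_le _ _).trans (add_le_add (hC x hx) (hC' x hx))⟩

lemma LocBdd.smul {u : Plane → ℝ} {G : Plane → Plane} (h : LocBdd u G) (c : ℝ) :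
    LocBdd (c • u) (c • G) := by
  refine ⟨h.cont.const_smul c, h.meas.const_smul c, fun R => ?_⟩
  obtain ⟨C, hC0, hC⟩ := h.bdd R
  refine ⟨|c| * C, by positivity, fun x hx => ?_⟩
  rw [Pi.smul_apply, norm_smul, Real.norm_eq_abs]
  exact mul_le_mul_of_nonneg_left (hC x hx) (abs_nonneg c)

lemma LocBdd.sum {ι : Type*} (s : Finset ι) {u : ι → Plane → ℝ} {G : ι → Plane → Plane}
    (h : ∀ j, LocBdd (u j) (G j)) : LocBdd (∑ j ∈ s, u j) (∑ j ∈ s, G j) := by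
  classical
  induction s using Finset.induction with
  | empty => simpa using LocBdd.zero
  | insert j s hj ih => rw [Finset.sum_insert hj, Finset.sum_insert hj]; exact (h j).add ih

/-- The integrand of the weak form. -/
def weakIntegrand (μ ω : ℝ) (u : Plane → ℝ) (G : Plane → Plane) (φ : Plane → ℝ) (x : Plane) : ℝ :=
  fderiv ℝ φ x (G x) + (ω * ⟪perp x, G x⟫ - μ * u x) * φ x

lemma continuous_perp : Continuous perp := by
  refine (PiLp.continuous_toLp 2 _).comp (continuous_pi fun i => ?_)
  fin_cases i <;> simp <;> fun_prop

lemma norm_perp (x : Plane) : ‖perp x‖ = ‖x‖ := by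
  simp only [EuclideanSpace.norm_eq, perp, Fin.sum_univ_two]
  simp [add_comm]

lemma measurable_weakIntegrand {μ ω : ℝ} {u : Plane → ℝ} {G : Plane → Plane} (h : LocBdd u G)
    {φ : Plane → ℝ} (hφ : Continuous φ) : Measurable (weakIntegrand μ ω u G φ) := by
  have h1 : Measurable fun x => fderiv ℝ φ x (G x) := by
    rw [funext fun x => clm_apply_eq_sum (fderiv ℝ φ x) (G x)]
    refine Finset.measurable_fun_sum _ fun i _ => Measurable.mul ?_
      (measurable_fderiv_apply_const ℝ φ _)
    exact (EuclideanSpace.proj i : Plane →L[ℝ] ℝ).continuous.measurable.comp h.meas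
  have h2 := continuous_perp.measurable.inner (𝕜 := ℝ) h.meas
  exact h1.add (((h2.const_mul ω).sub (h.cont.measurable.const_mul μ)).mul hφ.measurable)

/-- This holds also at the points where the test function is not differentiable, as `fderiv` vanishes
off the topological support. -/
lemma weakIntegrand_of_notMem {μ ω : ℝ} {u : Plane → ℝ} {G : Plane → Plane} {φ : Plane → ℝ}
    {x : Plane} (hx : x ∉ tsupport φ) : weakIntegrand μ ω u G φ x = 0 := by
  simp [weakIntegrand, fderiv_of_notMem_tsupport ℝ hx, image_eq_zero_of_notMem_tsupport hx]

/-- Bound of the weak integrand on a ball, in terms of the Lipschitz constant and of the supremum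
of the test function. -/
lemma LocBdd.exists_bound {u : Plane → ℝ} {G : Plane → Plane} (h : LocBdd u G) (μ ω R : ℝ) :
    ∃ C : ℝ, 0 ≤ C ∧ ∀ (φ : Plane → ℝ) (L : NNReal) (M : ℝ), LipschitzWith L φ →
      (∀ x, |φ x| ≤ M) → ∀ x, ‖x‖ ≤ R → |weakIntegrand μ ω u G φ x| ≤ C * (L + M) := by
  obtain ⟨C, hC0, hC⟩ := h.bdd R
  obtain ⟨B, hB⟩ := (isCompact_closedBall (0 : Plane) R).exists_bound_of_continuousOn
    h.cont.continuousOn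
  refine ⟨C + |ω| * (|R| * C) + |μ| * |B|, by positivity, fun φ L M hL hM x hx => ?_⟩
  have hM0 : 0 ≤ M := (abs_nonneg _).trans (hM 0)
  have h1 : |fderiv ℝ φ x (G x)| ≤ L * C :=
    ((fderiv ℝ φ x).le_opNorm (G x)).trans (mul_le_mul (norm_fderiv_le_of_lipschitz ℝ hL)
      (hC x hx) (norm_nonneg _) L.2)
  have h2 : |⟪perp x, G x⟫| ≤ |R| * C := by
    refine (abs_real_inner_le_norm _ _).trans ?_
    rw [norm_perp]
    exact mul_le_mul (hx.trans (le_abs_self R)) (hC x hx) (norm_nonneg _) (abs_nonneg _)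
  have h3 : |u x| ≤ |B| := (hB x (by simpa using hx)).trans (le_abs_self B)
  have h4 : |ω * ⟪perp x, G x⟫ - μ * u x| ≤ |ω| * (|R| * C) + |μ| * |B| := by
    refine (abs_sub _ _).trans ?_
    rw [abs_mul, abs_mul]
    gcongr
  calc |weakIntegrand μ ω u G φ x| ≤ L * C + (|ω| * (|R| * C) + |μ| * |B|) * M := by
        refine (abs_add_le _ _).trans (add_le_add h1 ?_)
        rw [abs_mul]
        exact mul_le_mul h4 (hM x) (abs_nonneg _) (by positivity)
    _ ≤ (C + |ω| * (|R| * C) + |μ| * |B|) * (L + M) := by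
        have hL0 : (0 : ℝ) ≤ L := L.2
        have : 0 ≤ (|ω| * (|R| * C) + |μ| * |B|) * L := by positivity
        have : 0 ≤ C * M := by positivity
        nlinarith

lemma LocBdd.integrable {u : Plane → ℝ} {G : Plane → Plane} (h : LocBdd u G) (μ ω : ℝ)
    {φ : Plane → ℝ} {L : NNReal} (hL : LipschitzWith L φ) (hφ : HasCompactSupport φ) :
    Integrable (weakIntegrand μ ω u G φ) := by
  obtain ⟨R, hR⟩ := hφ.isBounded.exists_norm_le
  obtain ⟨M, -, hM⟩ := exists_bound_of_hasCompactSupport hL.continuous hφ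
  obtain ⟨C, -, hC⟩ := h.exists_bound μ ω R
  exact integrable_of_bounded_of_support (measurable_weakIntegrand h hL.continuous) hφ
    (fun x hx => hC φ L M hL hM x (hR x hx)) (fun x hx => weakIntegrand_of_notMem hx)

lemma weakForm_eq (μ ω : ℝ) (u : Plane → ℝ) (G : Plane → Plane) (φ : Plane → ℝ) :
    weakForm μ ω u G φ = ∫ x, weakIntegrand μ ω u G φ x := rfl

lemma weakForm_sum {ι : Type*} (s : Finset ι) (μ ω : ℝ) (κ : ι → ℝ) {u : ι → Plane → ℝ}
    {G : ι → Plane → Plane} (h : ∀ j, LocBdd (u j) (G j)) {φ : Plane → ℝ} {L : NNReal}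
    (hL : LipschitzWith L φ) (hφ : HasCompactSupport φ) :
    weakForm μ ω (∑ j ∈ s, κ j • u j) (∑ j ∈ s, κ j • G j) φ =
      ∑ j ∈ s, κ j * weakForm μ ω (u j) (G j) φ := by
  simp only [weakForm_eq, ← integral_const_mul]
  rw [← integral_finsetSum _ fun j _ => ((h j).integrable μ ω hL hφ).const_mul _]
  refine integral_congr_ae (ae_of_all _ fun x => ?_)
  simp only [weakIntegrand, Finset.sum_apply, Pi.smul_apply, map_sum, map_smul, inner_sum,
    inner_smul_right, smul_eq_mul, Finset.mul_sum, Finset.sum_mul, sub_mul, mul_add, mul_sub,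
    Finset.sum_add_distrib, Finset.sum_sub_distrib]
  congr 2 <;> exact Finset.sum_congr rfl fun _ _ => by ring

lemma weakForm_add_test {μ ω : ℝ} {u : Plane → ℝ} {G : Plane → Plane} (h : LocBdd u G)
    {φ ψ : Plane → ℝ} {L M : NNReal} (hL : LipschitzWith L φ) (hφ : HasCompactSupport φ)
    (hM : LipschitzWith M ψ) (hψ : HasCompactSupport ψ) :
    weakForm μ ω u G (fun x => φ x + ψ x) = weakForm μ ω u G φ + weakForm μ ω u G ψ := by
  simp only [weakForm_eq]
  rw [← integral_add (h.integrable μ ω hL hφ) (h.integrable μ ω hM hψ)]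
  refine integral_congr_ae ?_
  filter_upwards [hL.ae_differentiableAt, hM.ae_differentiableAt] with x h1 h2
  simp only [weakIntegrand]
  rw [fderiv_fun_add h1 h2]
  simp only [add_apply]
  ring

lemma weakIntegrand_gradient (μ ω : ℝ) (u φ : Plane → ℝ) (x : Plane) :
    weakIntegrand μ ω u (gradient u) φ x =
      ∑ i, fderiv ℝ u x (unitVec i) * fderiv ℝ φ x (unitVec i) +
        (ω * fderiv ℝ u x (perp x) - μ * u x) * φ x := by
  rw [weakIntegrand, clm_apply_eq_sum, real_inner_comm, inner_gradient_left]
  simp only [gradient_apply]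

/-- A classical solution on an open set satisfies the weak equation against the test functions
supported there. -/
lemma weakForm_eq_zero {μ ω : ℝ} {D : Set Plane} (hD : IsOpen D) {u φ : Plane → ℝ} {L : NNReal}
    (hL : LipschitzWith L φ) (hφ : HasCompactSupport φ) (hφD : tsupport φ ⊆ D)
    (hu : ∀ x ∈ D, ClassicalAt μ ω u x) : weakForm μ ω u (gradient u) φ = 0 := by
  have h := fun i : Fin 2 => integral_fderiv_mul_lipschitz hD hL hφ hφD
    (fun x hx => contDiffAt_fderiv_apply (hu x hx).1 (unitVec i)) (unitVec i)
  have h1 : ∀ x, weakIntegrand μ ω u (gradient u) φ x =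
      ∑ i, (fderiv ℝ (fun y => fderiv ℝ u y (unitVec i)) x (unitVec i) * φ x +
        fderiv ℝ u x (unitVec i) * fderiv ℝ φ x (unitVec i)) := by
    intro x
    by_cases hx : x ∈ tsupport φ
    · rw [weakIntegrand_gradient, ← (hu x (hφD hx)).2, Finset.sum_add_distrib, Finset.sum_mul]
      ring
    · rw [weakIntegrand_of_notMem hx]
      simp [image_eq_zero_of_notMem_tsupport hx, fderiv_of_notMem_tsupport ℝ hx]
  have h2 : ∀ i, Integrable fun x =>
      fderiv ℝ (fun y => fderiv ℝ u y (unitVec i)) x (unitVec i) * φ x +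
        fderiv ℝ u x (unitVec i) * fderiv ℝ φ x (unitVec i) := fun i => (h i).1.add (h i).2.1
  rw [weakForm_eq]
  simp only [h1]
  rw [integral_finsetSum _ fun i _ => h2 i]
  refine Finset.sum_eq_zero fun i _ => ?_
  rw [integral_add (h i).1 (h i).2.1, (h i).2.2]
  ring

/-! ### Truncation: nonnegative functions that are solutions where they are positive -/

/-- A smooth nondecreasing cutoff, equal to `0` on `(-∞, 1/n]` and to `1` on `[2/n, ∞)`. -/
def stepFun (n : ℕ) (t : ℝ) : ℝ := Real.smoothTransition (n * t - 1)

lemma contDiff_stepFun (n : ℕ) : ContDiff ℝ 2 (stepFun n) := by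
  have : ContDiff ℝ 2 Real.smoothTransition := Real.smoothTransition.contDiff (n := 2)
  exact this.comp (by fun_prop)

lemma stepFun_mem (n : ℕ) (t : ℝ) : 0 ≤ stepFun n t ∧ stepFun n t ≤ 1 :=
  ⟨Real.smoothTransition.nonneg _, Real.smoothTransition.le_one _⟩

lemma stepFun_zero_of_lt {n : ℕ} {t : ℝ} (h : (n : ℝ) * t < 1) : stepFun n t = 0 :=
  Real.smoothTransition.zero_of_nonpos (by linarith)

lemma deriv_stepFun (n : ℕ) (t : ℝ) :
    HasDerivAt (stepFun n) (n * deriv Real.smoothTransition (n * t - 1)) t := by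
  have h1 : HasDerivAt Real.smoothTransition (deriv Real.smoothTransition (n * t - 1)) (n * t - 1) :=
    ((Real.smoothTransition.contDiff (n := 1)).differentiable (by norm_num) _).hasDerivAt
  have h2 : HasDerivAt (fun t : ℝ => (n : ℝ) * t - 1) n t := by
    simpa using ((hasDerivAt_id t).const_mul (n : ℝ)).sub_const 1
  refine (h1.comp t h2).congr_deriv (mul_comm _ _)

lemma deriv_smoothTransition_nonneg (t : ℝ) : 0 ≤ deriv Real.smoothTransition t :=
  Real.smoothTransition.monotone.deriv_nonneg

lemma deriv_smoothTransition_eq_zero {t : ℝ} (h : t < 0 ∨ 1 < t) :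
    deriv Real.smoothTransition t = 0 := by
  rcases h with h | h
  · have : Real.smoothTransition =ᶠ[𝓝 t] fun _ => 0 := by
      filter_upwards [Iio_mem_nhds h] with s hs
      exact Real.smoothTransition.zero_of_nonpos (le_of_lt hs)
    rw [this.deriv_eq, deriv_const]
  · have : Real.smoothTransition =ᶠ[𝓝 t] fun _ => 1 := by
      filter_upwards [Ioi_mem_nhds h] with s hs
      exact Real.smoothTransition.one_of_one_le (le_of_lt hs)
    rw [this.deriv_eq, deriv_const]

lemma tendsto_stepFun {t : ℝ} (ht : 0 < t) : Tendsto (fun n => stepFun n t) atTop (𝓝 1) := by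
  have h : Tendsto (fun n : ℕ => (n : ℝ) * t) atTop atTop :=
    tendsto_natCast_atTop_atTop.atTop_mul_const ht
  refine tendsto_const_nhds.congr' ?_
  filter_upwards [h.eventually_ge_atTop 2] with n hn
  exact (Real.smoothTransition.one_of_one_le (by linarith)).symm

/-- The derivatives of `t ↦ η_n(t) t`, with `η_n` the cutoffs, are bounded uniformly in `n`. -/
lemma exists_bound_stepFun : ∃ M : ℝ, 0 ≤ M ∧ ∀ (n : ℕ) (t : ℝ), 0 ≤ t →
    |n * deriv Real.smoothTransition (n * t - 1) * t| ≤ M := by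
  have hc : Continuous (deriv Real.smoothTransition) :=
    (Real.smoothTransition.contDiff (n := 1)).continuous_deriv (by norm_num)
  obtain ⟨M, hM⟩ := (isCompact_Icc (a := (0 : ℝ)) (b := 1)).exists_bound_of_continuousOn
    hc.continuousOn
  have hM0 : 0 ≤ M := (norm_nonneg _).trans (hM 0 (by simp))
  refine ⟨2 * M, by positivity, fun n t ht => ?_⟩
  by_cases h : (n : ℝ) * t - 1 ∈ Set.Icc (0 : ℝ) 1
  · have h1 := hM _ h
    rw [show n * deriv Real.smoothTransition (n * t - 1) * t =
      (n * t) * deriv Real.smoothTransition (n * t - 1) by ring, abs_mul]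
    refine mul_le_mul ?_ h1 (abs_nonneg _) (by norm_num)
    rw [abs_of_nonneg (by positivity)]
    linarith [h.2]
  · rw [deriv_smoothTransition_eq_zero]
    · simpa using hM0
    · by_contra hc
      push Not at hc
      exact h ⟨hc.1, hc.2⟩

section Truncation

variable {u : Plane → ℝ}

/-- At a zero of a nonnegative function the derivative vanishes, also where the function is not
differentiable, since `fderiv` is `0` there by convention. Thus `gradient u` represents the weak
gradient without redefining it on the free boundary. -/
lemma gradient_eq_zero_of_eq_zero (h0 : ∀ x, 0 ≤ u x) {x : Plane} (hx : u x = 0) :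
    fderiv ℝ u x = 0 :=
  IsLocalMin.fderiv_eq_zero (Eventually.of_forall fun y => hx ▸ h0 y)

lemma eventually_mul_lt_one (hc : Continuous u) {x : Plane} (hx : u x = 0) (n : ℕ) :
    ∀ᶠ y in 𝓝 x, (n : ℝ) * u y < 1 := by
  have : ContinuousAt (fun y => (n : ℝ) * u y) x := (continuous_const.mul hc).continuousAt
  exact this.eventually_lt_const (by simp [hx])

/-- The truncation `η_n(u)` vanishes near the zeros of `u`, so that it makes a function which is
regular on `{u > 0}` regular everywhere. -/
lemma contDiffAt_stepFun_mul (h0 : ∀ x, 0 ≤ u x) (hc : Continuous u)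
    (hu : ∀ x, 0 < u x → ContDiffAt ℝ 2 u x) (n : ℕ) {g : Plane → ℝ}
    (hg : ∀ x, 0 < u x → ContDiffAt ℝ 1 g x) (x : Plane) :
    ContDiffAt ℝ 1 (fun y => stepFun n (u y) * g y) x := by
  rcases (h0 x).eq_or_lt with hx | hx
  · refine (contDiffAt_const (c := (0 : ℝ))).congr_of_eventuallyEq ?_
    filter_upwards [eventually_mul_lt_one hc hx.symm n] with y hy
    rw [stepFun_zero_of_lt hy, zero_mul]
  · exact (((contDiff_stepFun n).of_le one_le_two).contDiffAt.comp x
      ((hu x hx).of_le one_le_two)).mul (hg x hx)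

lemma fderiv_stepFun_mul (hu : ∀ x, 0 < u x → ContDiffAt ℝ 2 u x) (n : ℕ) {g : Plane → ℝ}
    {x : Plane} (hx : 0 < u x) (hg : ContDiffAt ℝ 1 g x) (e : Plane) :
    fderiv ℝ (fun y => stepFun n (u y) * g y) x e = stepFun n (u x) * fderiv ℝ g x e +
      n * deriv Real.smoothTransition (n * u x - 1) * fderiv ℝ u x e * g x := by
  have h1 : HasFDerivAt (fun y => stepFun n (u y))
      ((n * deriv Real.smoothTransition (n * u x - 1)) • fderiv ℝ u x) x :=
    (deriv_stepFun n (u x)).comp_hasFDerivAt x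
      ((hu x hx).differentiableAt two_ne_zero).hasFDerivAt
  have h2 : HasFDerivAt (fun y => stepFun n (u y) * g y) _ x :=
    h1.mul (hg.differentiableAt one_ne_zero).hasFDerivAt
  rw [h2.fderiv]
  simp
  ring

lemma fderiv_stepFun_mul_of_zero (hc : Continuous u) (n : ℕ) {g : Plane → ℝ}
    {x : Plane} (hx : u x = 0) : fderiv ℝ (fun y => stepFun n (u y) * g y) x = 0 := by
  have : (fun y => stepFun n (u y) * g y) =ᶠ[𝓝 x] fun _ => 0 := by
    filter_upwards [eventually_mul_lt_one hc hx n] with y hy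
    rw [stepFun_zero_of_lt hy, zero_mul]
  rw [this.fderiv_eq]
  simp

/-- A nonnegative continuous function with locally bounded gradient that solves the equation where
it is positive is a weak subsolution: its equation is tested with `η_n(u) φ`, where the term
containing `η_n'(u) |∇u|²` has a sign. -/
lemma weakForm_nonpos {μ ω : ℝ} (h0 : ∀ x, 0 ≤ u x) (hb : LocBdd u (gradient u))
    (hu : ∀ x, 0 < u x → ClassicalAt μ ω u x) {φ : Plane → ℝ} (hφ : IsTest φ) :
    weakForm μ ω u (gradient u) φ ≤ 0 := by
  obtain ⟨⟨L, hL⟩, hφc, hφ0⟩ := hφ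
  have hint := hb.integrable μ ω hL hφc
  have hstep : ∀ n : ℕ, ∫ x, stepFun n (u x) * weakIntegrand μ ω u (gradient u) φ x ≤ 0 := by
    intro n
    have hC := fun i : Fin 2 => contDiffAt_stepFun_mul h0 hb.cont (fun x hx => (hu x hx).1) n
      (g := fun y => fderiv ℝ u y (unitVec i))
      (fun x hx => contDiffAt_fderiv_apply (hu x hx).1 (unitVec i))
    have h := fun i : Fin 2 => integral_fderiv_mul_lipschitz isOpen_univ hL hφc
      (Set.subset_univ _) (fun x _ => hC i x) (unitVec i)
    have h2 : ∀ i : Fin 2, Integrable fun x =>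
        fderiv ℝ (fun y => stepFun n (u y) * fderiv ℝ u y (unitVec i)) x (unitVec i) * φ x +
          stepFun n (u x) * fderiv ℝ u x (unitVec i) * fderiv ℝ φ x (unitVec i) :=
      fun i => (h i).1.add (h i).2.1
    have hzero : ∫ x, ∑ i : Fin 2,
        (fderiv ℝ (fun y => stepFun n (u y) * fderiv ℝ u y (unitVec i)) x (unitVec i) * φ x +
          stepFun n (u x) * fderiv ℝ u x (unitVec i) * fderiv ℝ φ x (unitVec i)) = 0 := by
      rw [integral_finsetSum _ fun i _ => h2 i]
      refine Finset.sum_eq_zero fun i _ => ?_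
      rw [integral_add (h i).1 (h i).2.1, (h i).2.2]
      ring
    rw [← hzero]
    refine integral_mono ?_ (integrable_finsetSum _ fun i _ => h2 i) fun x => ?_
    · refine hint.mono (((contDiff_stepFun n).continuous.comp hb.cont).measurable.mul
        (measurable_weakIntegrand hb hL.continuous)).aestronglyMeasurable (ae_of_all _ fun x => ?_)
      rw [norm_mul, Real.norm_eq_abs, abs_of_nonneg (stepFun_mem n _).1]
      exact mul_le_of_le_one_left (norm_nonneg _) (stepFun_mem n _).2
    · simp only
      rw [weakIntegrand_gradient]
      rcases (h0 x).eq_or_lt with hx | hx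
      · simp only [fderiv_stepFun_mul_of_zero hb.cont n hx.symm,
          gradient_eq_zero_of_eq_zero h0 hx.symm, ← hx]
        simp
      · have hfd := fun i : Fin 2 => fderiv_stepFun_mul (fun x hx => (hu x hx).1) n hx
          (contDiffAt_fderiv_apply (hu x hx).1 (unitVec i)) (unitVec i)
        simp only [hfd]
        rw [← (hu x hx).2]
        have hd := deriv_smoothTransition_nonneg (n * u x - 1)
        have hsq : ∀ i : Fin 2, 0 ≤ n * deriv Real.smoothTransition (n * u x - 1) *
            fderiv ℝ u x (unitVec i) * fderiv ℝ u x (unitVec i) * φ x := fun i => by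
          rw [mul_assoc (n * deriv Real.smoothTransition (n * u x - 1))]
          exact mul_nonneg (mul_nonneg (by positivity) (mul_self_nonneg _)) (hφ0 x)
        have h3 := hsq 0
        have h4 := hsq 1
        simp only [Fin.sum_univ_two]
        linarith
  have hlim : Tendsto (fun n : ℕ => ∫ x, stepFun n (u x) * weakIntegrand μ ω u (gradient u) φ x)
      atTop (𝓝 (∫ x, weakIntegrand μ ω u (gradient u) φ x)) := by
    refine tendsto_integral_of_dominated_convergence
      (fun x => |weakIntegrand μ ω u (gradient u) φ x|) (fun n => ?_) hint.abs (fun n => ?_) ?_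
    · exact (((contDiff_stepFun n).continuous.comp hb.cont).measurable.mul
        (measurable_weakIntegrand hb hL.continuous)).aestronglyMeasurable
    · refine ae_of_all _ fun x => ?_
      rw [Real.norm_eq_abs, abs_mul, abs_of_nonneg (stepFun_mem n _).1]
      exact mul_le_of_le_one_left (abs_nonneg _) (stepFun_mem n _).2
    · refine ae_of_all _ fun x => ?_
      rcases (h0 x).eq_or_lt with hx | hx
      · have : weakIntegrand μ ω u (gradient u) φ x = 0 := by
          rw [weakIntegrand_gradient, gradient_eq_zero_of_eq_zero h0 hx.symm, ← hx]
          simp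
        simp [this]
      · simpa using (tendsto_stepFun hx).mul_const (weakIntegrand μ ω u (gradient u) φ x)
  exact le_of_tendsto' hlim hstep

/-- The pointwise gradient is the weak gradient: integrate `η_n(u) u` by parts and let `n → ∞`. -/
lemma hasWeakGrad_gradient (h0 : ∀ x, 0 ≤ u x) (hb : LocBdd u (gradient u))
    (hu : ∀ x, 0 < u x → ContDiffAt ℝ 2 u x) {φ : Plane → ℝ} {L : NNReal}
    (hL : LipschitzWith L φ) (hφc : HasCompactSupport φ) (e : Plane) :
    ∫ x, u x * fderiv ℝ φ x e = -∫ x, ⟪gradient u x, e⟫ * φ x := by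
  obtain ⟨M, hM0, hM⟩ := exists_bound_stepFun
  have hC := fun n : ℕ => contDiffAt_stepFun_mul h0 hb.cont hu n (g := u)
    (fun x hx => (hu x hx).of_le one_le_two)
  have h := fun n : ℕ => (integral_fderiv_mul_lipschitz isOpen_univ hL hφc
    (Set.subset_univ _) (fun x _ => hC n x) e).2.2
  obtain ⟨A, hA0, hA⟩ := exists_bound_of_hasCompactSupport hL.continuous hφc
  obtain ⟨R, hR⟩ := hφc.isBounded.exists_norm_le
  obtain ⟨C, hC0, hCb⟩ := hb.bdd R
  have hcomp : Integrable (fun x => u x * fderiv ℝ φ x e) := by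
    obtain ⟨B, hB⟩ := hφc.isCompact.exists_bound_of_continuousOn hb.cont.continuousOn
    refine integrable_of_bounded_of_support (S := tsupport φ) (C := |B| * (L * ‖e‖))
      (hb.cont.measurable.mul (measurable_fderiv_apply_const ℝ φ e)) hφc
      (fun x hx => ?_) (fun x hx => by simp [fderiv_of_notMem_tsupport ℝ hx])
    rw [abs_mul]
    refine mul_le_mul ((hB x hx).trans (le_abs_self B)) ?_ (abs_nonneg _) (abs_nonneg _)
    refine ((fderiv ℝ φ x).le_opNorm e).trans ?_
    gcongr
    exact norm_fderiv_le_of_lipschitz ℝ hL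
  have hl1 : Tendsto (fun n : ℕ => ∫ x, stepFun n (u x) * u x * fderiv ℝ φ x e) atTop
      (𝓝 (∫ x, u x * fderiv ℝ φ x e)) := by
    refine tendsto_integral_of_dominated_convergence
      (fun x => |u x * fderiv ℝ φ x e|) (fun n => ?_) hcomp.abs (fun n => ?_) ?_
    · exact ((((contDiff_stepFun n).continuous.comp hb.cont).measurable.mul
        hb.cont.measurable).mul (measurable_fderiv_apply_const ℝ φ e)).aestronglyMeasurable
    · refine ae_of_all _ fun x => ?_
      rw [Real.norm_eq_abs, mul_assoc, abs_mul, abs_of_nonneg (stepFun_mem n _).1]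
      exact mul_le_of_le_one_left (abs_nonneg _) (stepFun_mem n _).2
    · refine ae_of_all _ fun x => ?_
      rcases (h0 x).eq_or_lt with hx | hx
      · simp [← hx]
      · simpa using ((tendsto_stepFun hx).mul_const (u x)).mul_const (fderiv ℝ φ x e)
  have hl2 : Tendsto (fun n : ℕ => ∫ x, fderiv ℝ (fun y => stepFun n (u y) * u y) x e * φ x) atTop
      (𝓝 (∫ x, ⟪gradient u x, e⟫ * φ x)) := by
    have hfd : ∀ (n : ℕ) x, fderiv ℝ (fun y => stepFun n (u y) * u y) x e =
        (stepFun n (u x) + n * deriv Real.smoothTransition (n * u x - 1) * u x) *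
          fderiv ℝ u x e := by
      intro n x
      rcases (h0 x).eq_or_lt with hx | hx
      · rw [fderiv_stepFun_mul_of_zero hb.cont n hx.symm, gradient_eq_zero_of_eq_zero h0 hx.symm]
        simp
      · rw [fderiv_stepFun_mul hu n hx ((hu x hx).of_le one_le_two)]
        ring
    simp only [hfd, inner_gradient_left]
    refine tendsto_integral_of_dominated_convergence
      ((tsupport φ).indicator fun x => (1 + M) * (C * ‖e‖) * A) (fun n => ?_) ?_ (fun n => ?_) ?_
    · have hd : Continuous (deriv Real.smoothTransition) :=
        (Real.smoothTransition.contDiff (n := 1)).continuous_deriv (by norm_num)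
      have hcu := hb.cont
      have hcs := (contDiff_stepFun n).continuous
      have : Continuous fun x => stepFun n (u x) +
        n * deriv Real.smoothTransition (n * u x - 1) * u x := by fun_prop
      exact ((this.measurable.mul (measurable_fderiv_apply_const ℝ u e)).mul
        hL.continuous.measurable).aestronglyMeasurable
    · exact (integrable_indicator_iff hφc.measurableSet).2
        (integrableOn_const hφc.measure_lt_top.ne)
    · refine ae_of_all _ fun x => ?_
      by_cases hx : x ∈ tsupport φ
      · rw [Set.indicator_of_mem hx, Real.norm_eq_abs, abs_mul, abs_mul]
        have h1 : |fderiv ℝ u x e| ≤ C * ‖e‖ := by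
          refine ((fderiv ℝ u x).le_opNorm e).trans ?_
          rw [← norm_gradient]
          gcongr
          exact hCb x (hR x hx)
        have h2 : |stepFun n (u x) + n * deriv Real.smoothTransition (n * u x - 1) * u x| ≤
            1 + M := by
          refine (abs_add_le _ _).trans (add_le_add ?_ (hM n _ (h0 x)))
          rw [abs_of_nonneg (stepFun_mem n _).1]
          exact (stepFun_mem n _).2
        gcongr
        exact hA x
      · rw [Set.indicator_of_notMem hx, image_eq_zero_of_notMem_tsupport hx]
        simp
    · refine ae_of_all _ fun x => Tendsto.mul_const _ ?_
      rcases (h0 x).eq_or_lt with hx | hx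
      · simp [gradient_eq_zero_of_eq_zero h0 hx.symm]
      · have h1 : Tendsto (fun n : ℕ => n * deriv Real.smoothTransition (n * u x - 1) * u x) atTop
            (𝓝 0) := by
          refine tendsto_const_nhds.congr' ?_
          have h : Tendsto (fun n : ℕ => (n : ℝ) * u x) atTop atTop :=
            tendsto_natCast_atTop_atTop.atTop_mul_const hx
          filter_upwards [h.eventually_gt_atTop 2] with n hn
          rw [deriv_smoothTransition_eq_zero (Or.inr (by linarith))]
          simp
        simpa using ((tendsto_stepFun hx).add h1).mul_const (fderiv ℝ u x e)
  refine tendsto_nhds_unique hl1 ((hl2.neg).congr fun n => ?_)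
  rw [h n, neg_neg]

lemma isH1Loc_gradient (h0 : ∀ x, 0 ≤ u x) (hb : LocBdd u (gradient u))
    (hu : ∀ x, 0 < u x → ContDiffAt ℝ 2 u x) : IsH1Loc u (gradient u) := by
  refine ⟨fun C hC => ?_, fun C hC => ?_, fun φ hφ hφc e => ?_⟩
  · have : IsFiniteMeasure (volume.restrict C) := ⟨by simpa using hC.measure_lt_top⟩
    obtain ⟨B, hB⟩ := hC.exists_bound_of_continuousOn hb.cont.continuousOn
    exact MemLp.of_bound hb.cont.aestronglyMeasurable B
      ((ae_restrict_iff' hC.measurableSet).2 (ae_of_all _ hB))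
  · have : IsFiniteMeasure (volume.restrict C) := ⟨by simpa using hC.measure_lt_top⟩
    obtain ⟨R, hR⟩ := hC.isBounded.exists_norm_le
    obtain ⟨B, -, hB⟩ := hb.bdd R
    exact MemLp.of_bound hb.meas.aestronglyMeasurable B
      ((ae_restrict_iff' hC.measurableSet).2 (ae_of_all _ fun x hx => hB x (hR x hx)))
  · obtain ⟨L, hL⟩ := ContDiff.lipschitzWith_of_hasCompactSupport hφc hφ (by simp)
    exact hasWeakGrad_gradient h0 hb hu hL hφc e

end Truncation

/-! ### Supersolutions that change sign across regular interfaces -/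

/-- A weak gradient agrees with the classical one almost everywhere where the function is `C¹`. In
particular, on the set where `∑ κ_j u_j` is smooth, `∑ κ_j ∇u_j` is its gradient, although the
single `u_j` need not be differentiable there. -/
lemma ae_eq_gradient {D : Set Plane} (hD : IsOpen D) {w : Plane → ℝ} {G : Plane → Plane}
    (hb : LocBdd w G)
    (hweak : ∀ φ : Plane → ℝ, ContDiff ℝ ((⊤ : ℕ∞) : WithTop ℕ∞) φ → HasCompactSupport φ →
      ∀ e : Plane, ∫ x, w x * fderiv ℝ φ x e = -∫ x, ⟪G x, e⟫ * φ x)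
    (hw : ∀ x ∈ D, ContDiffAt ℝ 1 w x) : ∀ᵐ x, x ∈ D → G x = gradient w x := by
  have hcoord : ∀ i : Fin 2, ∀ᵐ x, x ∈ D → G x i - fderiv ℝ w x (unitVec i) = 0 := by
    intro i
    have hGi : LocallyIntegrable (fun x => G x i) := by
      rw [locallyIntegrable_iff]
      intro k hk
      obtain ⟨R, hR⟩ := hk.isBounded.exists_norm_le
      obtain ⟨B, -, hB⟩ := hb.bdd R
      refine Measure.integrableOn_of_bounded hk.measure_lt_top.ne
        ((EuclideanSpace.proj i : Plane →L[ℝ] ℝ).continuous.measurable.comp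
          hb.meas).aestronglyMeasurable (M := B) ?_
      refine (ae_restrict_iff' hk.measurableSet).2 (ae_of_all _ fun x hx => ?_)
      exact (PiLp.norm_apply_le (G x) i).trans (hB x (hR x hx))
    have hwi : ContinuousOn (fun x => fderiv ℝ w x (unitVec i)) D := fun x hx =>
      (((hw x hx).fderiv_right (m := 0) (by simp)).continuousAt.clm_apply
        continuousAt_const).continuousWithinAt
    refine hD.ae_eq_zero_of_integral_contDiff_smul_eq_zero
      ((hGi.locallyIntegrableOn D).sub (hwi.locallyIntegrableOn hD.measurableSet)) ?_
    intro g hg hgc hgD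
    obtain ⟨L, hL⟩ := ContDiff.lipschitzWith_of_hasCompactSupport hgc hg (by simp)
    obtain ⟨h1, h2, h3⟩ := integral_fderiv_mul_lipschitz hD hL hgc hgD hw (unitVec i)
    have h4 := hweak g hg hgc (unitVec i)
    have h5 : ∀ x, ⟪G x, unitVec i⟫ = G x i := fun x => by
      rw [EuclideanSpace.inner_single_right]
      simp
    simp only [h5] at h4
    have h6 : Integrable fun x => G x i * g x := by
      simpa [mul_comm] using hGi.integrable_smul_left_of_hasCompactSupport hg.continuous hgc
    have h7 : ∀ x, g x • (G x i - fderiv ℝ w x (unitVec i)) =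
        G x i * g x - fderiv ℝ w x (unitVec i) * g x := fun x => by
      rw [smul_eq_mul]; ring
    simp only [h7]
    rw [integral_sub h6 h1, h3, h4]
    ring
  filter_upwards [hcoord 0, hcoord 1] with x hx0 hx1 hxD
  ext i
  rw [gradient_apply]
  fin_cases i
  · exact sub_eq_zero.1 (hx0 hxD)
  · exact sub_eq_zero.1 (hx1 hxD)

/-- The Lipschitz cutoff `min(1, (n|x| - 1)⁺)` of a neighbourhood of the origin. -/
def originCutoff (n : ℕ) (x : Plane) : ℝ := min 1 (max 0 (n * ‖x‖ - 1))

lemma lipschitz_originCutoff (n : ℕ) : LipschitzWith n (originCutoff n) := by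
  have h1 : LipschitzWith n fun x : Plane => (n : ℝ) * ‖x‖ - 1 := by
    refine LipschitzWith.of_dist_le_mul fun x y => ?_
    rw [Real.dist_eq, show (n : ℝ) * ‖x‖ - 1 - (n * ‖y‖ - 1) = n * (‖x‖ - ‖y‖) by ring, abs_mul,
      abs_of_nonneg (Nat.cast_nonneg n), dist_eq_norm]
    simpa using mul_le_mul_of_nonneg_left (abs_norm_sub_norm_le x y) (Nat.cast_nonneg n)
  exact (h1.const_max 0).const_min 1

lemma originCutoff_mem (n : ℕ) (x : Plane) : 0 ≤ originCutoff n x ∧ originCutoff n x ≤ 1 :=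
  ⟨le_min zero_le_one (le_max_left _ _), min_le_left _ _⟩

lemma originCutoff_of_small {n : ℕ} {x : Plane} (h : n * ‖x‖ ≤ 1) : originCutoff n x = 0 := by
  rw [originCutoff, max_eq_left (by linarith)]
  simp

lemma originCutoff_of_large {n : ℕ} {x : Plane} (h : 2 ≤ n * ‖x‖) : originCutoff n x = 1 := by
  rw [originCutoff, min_eq_left]
  exact le_max_of_le_right (by linarith)

/-- The origin is negligible: the gradient is bounded, while a cutoff at scale `1/n` costs a
gradient of size `n` on an area of size `1/n²`. -/
lemma weakForm_nonneg_of_away {μ ω : ℝ} {w : Plane → ℝ} {G : Plane → Plane} (hb : LocBdd w G)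
    (h : ∀ φ, IsTest φ → (0 : Plane) ∉ tsupport φ → 0 ≤ weakForm μ ω w G φ)
    {φ : Plane → ℝ} (hφ : IsTest φ) : 0 ≤ weakForm μ ω w G φ := by
  obtain ⟨⟨L, hL⟩, hφc, hφ0⟩ := hφ
  obtain ⟨M, hM0, hM⟩ := exists_bound_of_hasCompactSupport hL.continuous hφc
  obtain ⟨C, hC0, hC⟩ := hb.exists_bound μ ω 2
  have habs : ∀ n x, |originCutoff n x| ≤ 1 := fun n x => by
    rw [abs_of_nonneg (originCutoff_mem n x).1]; exact (originCutoff_mem n x).2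
  have habs' : ∀ n x, |1 - originCutoff n x| ≤ 1 := fun n x => by
    have := originCutoff_mem n x
    rw [abs_le]; constructor <;> linarith
  have hkey : ∀ n : ℕ, 1 ≤ n →
      -(C * (1 * L + 2 * M) * volume.real (Metric.closedBall (0 : Plane) 1) * 4 * (1 / n)) ≤
        weakForm μ ω w G φ := by
    intro n hn
    have hn0 : (1 : ℝ) ≤ n := by exact_mod_cast hn
    have h1L := lipschitz_mul hL (lipschitz_originCutoff n) hM (habs n)
    have h2c : LipschitzWith n fun x => 1 - originCutoff n x := by
      refine LipschitzWith.of_dist_le_mul fun x y => ?_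
      rw [Real.dist_eq, show 1 - originCutoff n x - (1 - originCutoff n y) =
        -(originCutoff n x - originCutoff n y) by ring, abs_neg, ← Real.dist_eq]
      exact (lipschitz_originCutoff n).dist_le_mul x y
    have h2L := lipschitz_mul hL h2c hM (habs' n)
    have hsplit := weakForm_add_test (μ := μ) (ω := ω) hb h1L (hφc.mul_right) h2L (hφc.mul_right)
    have heq : (fun x => φ x * originCutoff n x + φ x * (1 - originCutoff n x)) = φ := by
      ext x; ring
    rw [heq] at hsplit
    have hpos : 0 ≤ weakForm μ ω w G (fun x => φ x * originCutoff n x) := by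
      refine h _ ⟨⟨_, h1L⟩, hφc.mul_right, fun x => mul_nonneg (hφ0 x) (originCutoff_mem n x).1⟩ ?_
      rw [notMem_tsupport_iff_eventuallyEq]
      have : ∀ᶠ x : Plane in 𝓝 0, (n : ℝ) * ‖x‖ < 1 := by
        have hc : ContinuousAt (fun x : Plane => (n : ℝ) * ‖x‖) 0 := by fun_prop
        exact hc.eventually_lt_const (by simp)
      filter_upwards [this] with x hx
      simp [originCutoff_of_small hx.le]
    set ψ : Plane → ℝ := fun x => φ x * (1 - originCutoff n x) with hψ
    have hψM : ∀ x, |ψ x| ≤ M := fun x => by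
      rw [hψ, abs_mul]
      calc |φ x| * |1 - originCutoff n x| ≤ M * 1 := by gcongr; exacts [hM x, habs' n x]
        _ = M := mul_one M
    have hψsupp : tsupport ψ ⊆ Metric.closedBall 0 (2 / n) := by
      refine closure_minimal (fun x hx => ?_) Metric.isClosed_closedBall
      rw [mem_closedBall_zero_iff, le_div_iff₀ (by linarith)]
      by_contra hlt
      push Not at hlt
      refine hx ?_
      simp [hψ, originCutoff_of_large (n := n) (x := x) (by linarith)]
    have hball : volume.real (Metric.closedBall (0 : Plane) (2 / n)) =
        (2 / n) ^ 2 * volume.real (Metric.closedBall (0 : Plane) 1) := by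
      have := Measure.addHaar_real_closedBall' (volume : Measure Plane) 0
        (r := 2 / (n : ℝ)) (by positivity)
      simpa using this
    have hbound : |weakForm μ ω w G ψ| ≤
        C * (1 * L + 2 * M) * volume.real (Metric.closedBall (0 : Plane) 1) * 4 * (1 / n) := by
      rw [weakForm_eq, ← setIntegral_eq_integral_of_forall_compl_eq_zero
        (s := Metric.closedBall (0 : Plane) (2 / n))
        (fun x hx => weakIntegrand_of_notMem fun hx' => hx (hψsupp hx'))]
      have h3 := norm_setIntegral_le_of_norm_le_const (μ := volume)
        (s := Metric.closedBall (0 : Plane) (2 / n)) (f := weakIntegrand μ ω w G ψ)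
        (C := C * ((Real.toNNReal (M * n + 1 * L) : NNReal) + M)) measure_closedBall_lt_top
        (fun x hx => hC ψ _ M h2L hψM x ((mem_closedBall_zero_iff.1 hx).trans (by
          rw [div_le_iff₀ (by linarith)]; linarith)))
      refine h3.trans ?_
      rw [hball, Real.coe_toNNReal _ (by positivity)]
      have h4 : M * n + 1 * L + M ≤ (1 * L + 2 * M) * n := by
        have : (0 : ℝ) ≤ L := L.2
        nlinarith
      calc C * (M * n + 1 * L + M) * ((2 / n) ^ 2 * volume.real (Metric.closedBall (0 : Plane) 1))
          ≤ C * ((1 * L + 2 * M) * n) *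
            ((2 / n) ^ 2 * volume.real (Metric.closedBall (0 : Plane) 1)) := by gcongr
        _ = _ := by field_simp; ring
    have := (abs_le.1 hbound).1
    linarith
  have hlim : Tendsto (fun n : ℕ => -(C * (1 * L + 2 * M) *
      volume.real (Metric.closedBall (0 : Plane) 1) * 4 * (1 / (n : ℝ)))) atTop (𝓝 0) := by
    have := (tendsto_one_div_atTop_nhds_zero_nat (𝕜 := ℝ)).const_mul
      (C * (1 * L + 2 * M) * volume.real (Metric.closedBall (0 : Plane) 1) * 4)
    simpa using this.neg
  refine le_of_tendsto hlim ?_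
  filter_upwards [eventually_ge_atTop 1] with n hn
  exact hkey n hn

/-- Let `w = ∑ κ_j u_j` with `κ_j ≤ 0` for `j ≠ i`, where the `u_j` are nonnegative, with locally
bounded gradient, and solve the equation where they are positive. If `w` solves the equation in a
neighbourhood of the closure of `{u_i > 0}`, apart from the origin, then `w` is a weak
supersolution. Indeed, a test function splits into a part supported where `w` is a solution, and
a part that vanishes near `{u_i > 0}`, where `w` is a nonpositive combination of subsolutions. -/
lemma weakForm_combination_nonneg {ι : Type*} [Fintype ι] {μ ω : ℝ} {u : ι → Plane → ℝ} {κ : ι → ℝ}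
    {i : ι} (h0 : ∀ j x, 0 ≤ u j x) (hb : ∀ j, LocBdd (u j) (gradient (u j)))
    (hu : ∀ j x, 0 < u j x → ClassicalAt μ ω (u j) x) (hκ : ∀ j, j ≠ i → κ j ≤ 0)
    (hw : ∀ x ∈ closure {x | 0 < u i x}, x ≠ 0 →
      ∀ᶠ y in 𝓝 x, ClassicalAt μ ω (∑ j, κ j • u j) y)
    {φ : Plane → ℝ} (hφ : IsTest φ) :
    0 ≤ weakForm μ ω (∑ j, κ j • u j) (∑ j, κ j • gradient (u j)) φ := by
  have hbw : LocBdd (∑ j, κ j • u j) (∑ j, κ j • gradient (u j)) :=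
    LocBdd.sum _ fun j => (hb j).smul (κ j)
  refine weakForm_nonneg_of_away hbw ?_ hφ
  rintro φ ⟨⟨L, hL⟩, hφc, hφ0⟩ hzero
  obtain ⟨M, hM0, hM⟩ := exists_bound_of_hasCompactSupport hL.continuous hφc
  set D : Set Plane := interior {y | ClassicalAt μ ω (∑ j, κ j • u j) y} with hD
  have hDc : ∀ y ∈ D, ClassicalAt μ ω (∑ j, κ j • u j) y :=
    fun y hy => (interior_subset hy : y ∈ {y | ClassicalAt μ ω (∑ j, κ j • u j) y})
  -- `χ` is `1` near the part of the closure of `{u_i > 0}` met by the test function, inside `D`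
  obtain ⟨χ, hχs, hχc, hχD, hχ1, hχI⟩ := exists_smooth_cutoff
    (C := tsupport φ ∩ closure {x | 0 < u i x}) (D := D)
    (hφc.isCompact.inter_right isClosed_closure) isOpen_interior (by
      rintro x ⟨hx1, hx2⟩
      exact mem_interior_iff_mem_nhds.2 (hw x hx2 (fun h => hzero (h ▸ hx1))))
  obtain ⟨N, hN⟩ := ContDiff.lipschitzWith_of_hasCompactSupport hχc hχs (by simp)
  have hN' : LipschitzWith N fun x => 1 - χ x := by
    refine LipschitzWith.of_dist_le_mul fun x y => ?_
    rw [Real.dist_eq, show 1 - χ x - (1 - χ y) = -(χ x - χ y) by ring, abs_neg, ← Real.dist_eq]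
    exact hN.dist_le_mul x y
  have hχabs : ∀ x, |χ x| ≤ 1 := fun x => by
    rw [abs_of_nonneg (hχI x).1]; exact (hχI x).2
  have hχabs' : ∀ x, |1 - χ x| ≤ 1 := fun x => by
    have := hχI x
    rw [abs_le]; constructor <;> linarith [this.1, this.2]
  have h1L := lipschitz_mul hL hN hM hχabs
  have h2L := lipschitz_mul hL hN' hM hχabs'
  have hsplit := weakForm_add_test (μ := μ) (ω := ω) hbw h1L (hφc.mul_right) h2L (hφc.mul_right)
  have heq : (fun x => φ x * χ x + φ x * (1 - χ x)) = φ := by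
    ext x; ring
  rw [heq] at hsplit
  rw [hsplit]
  refine add_nonneg (le_of_eq ?_) ?_
  · -- on `D` the combination of the gradients is the gradient of the combination
    have hts : tsupport (fun x => φ x * χ x) ⊆ D := (tsupport_mul_subset_right).trans hχD
    have hae := ae_eq_gradient isOpen_interior hbw (fun ψ hψ hψc e => by
      obtain ⟨P, hP⟩ := ContDiff.lipschitzWith_of_hasCompactSupport hψc hψ (by simp)
      have h1 := fun j => hasWeakGrad_gradient (h0 j) (hb j) (fun x hx => (hu j x hx).1) hP hψc e
      have hi1 : ∀ j, Integrable fun x => κ j * (u j x * fderiv ℝ ψ x e) := fun j => by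
        refine Integrable.const_mul ?_ _
        have hc : Continuous fun x => u j x * fderiv ℝ ψ x e :=
          (hb j).cont.mul ((hψ.continuous_fderiv (by simp)).clm_apply continuous_const)
        refine hc.integrable_of_hasCompactSupport (HasCompactSupport.mul_left ?_)
        exact hψc.fderiv_apply (𝕜 := ℝ) e
      have hi2 : ∀ j, Integrable fun x => κ j * (⟪gradient (u j) x, e⟫ * ψ x) := fun j => by
        refine Integrable.const_mul ?_ _
        obtain ⟨R, hR⟩ := hψc.isBounded.exists_norm_le
        obtain ⟨B, hB0, hB⟩ := (hb j).bdd R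
        obtain ⟨A, hA0, hA⟩ := exists_bound_of_hasCompactSupport hψ.continuous hψc
        refine integrable_of_bounded_of_support (S := tsupport ψ) (C := B * ‖e‖ * A)
          (((hb j).meas.inner (𝕜 := ℝ) measurable_const).mul hψ.continuous.measurable) hψc
          (fun x hx => ?_) (fun x hx => by simp [image_eq_zero_of_notMem_tsupport hx])
        rw [abs_mul]
        refine mul_le_mul ((abs_real_inner_le_norm _ _).trans ?_) (hA x) (abs_nonneg _)
          (by positivity)
        gcongr
        exact hB x (hR x hx)
      simp only [Finset.sum_apply, Pi.smul_apply, smul_eq_mul, sum_inner, real_inner_smul_left,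
        Finset.sum_mul, mul_assoc]
      rw [integral_finsetSum _ fun j _ => hi1 j, integral_finsetSum _ fun j _ => hi2 j,
        ← Finset.sum_neg_distrib]
      refine Finset.sum_congr rfl fun j _ => ?_
      rw [integral_const_mul, integral_const_mul, h1 j]
      ring) (fun x hx => ((hDc x hx).1).of_le one_le_two)
    rw [← weakForm_eq_zero (isOpen_interior) h1L hφc.mul_right hts hDc, weakForm_eq, weakForm_eq]
    refine integral_congr_ae ?_
    filter_upwards [hae] with x hx
    by_cases hxs : x ∈ tsupport fun x => φ x * χ x
    · simp only [weakIntegrand, hx (hts hxs)]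
    · rw [weakIntegrand_of_notMem hxs, weakIntegrand_of_notMem hxs]
  · -- `φ (1 - χ)` does not see `u_i`, and the other components are subsolutions
    rw [weakForm_sum _ _ _ _ hb h2L hφc.mul_right]
    have htest : IsTest fun x => φ x * (1 - χ x) :=
      ⟨⟨_, h2L⟩, hφc.mul_right, fun x => mul_nonneg (hφ0 x) (by linarith [(hχI x).2])⟩
    refine Finset.sum_nonneg fun j _ => ?_
    by_cases hj : j = i
    · subst hj
      refine le_of_eq ?_
      have : weakForm μ ω (u j) (gradient (u j)) (fun x => φ x * (1 - χ x)) = 0 := by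
        rw [weakForm_eq]
        refine integral_eq_zero_of_ae (ae_of_all _ fun x => ?_)
        rcases (h0 j x).eq_or_lt with hx | hx
        · rw [weakIntegrand_gradient, gradient_eq_zero_of_eq_zero (h0 j) hx.symm, ← hx]
          simp
        · refine weakIntegrand_of_notMem ?_
          rw [notMem_tsupport_iff_eventuallyEq]
          by_cases hxφ : x ∈ tsupport φ
          · filter_upwards [hχ1 x ⟨hxφ, subset_closure hx⟩] with y hy
            simp [hy]
          · filter_upwards [notMem_tsupport_iff_eventuallyEq.1 hxφ] with y hy
            simp [hy]
      rw [this, mul_zero]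
    · exact mul_nonneg_of_nonpos_of_nonpos (hκ j hj) (weakForm_nonpos (h0 j) (hb j) (hu j) htest)

lemma hat_eq_sum {K : ℕ} {V : Type*} [AddCommGroup V] [Module ℝ V] (a : Fin K → Fin K → ℝ)
    (u : Fin K → V) (i : Fin K) :
    hat a u i = ∑ j, (if j = i then (1 : ℝ) else -(a i j / a j i)) • u j := by
  rw [hat, ← Finset.add_sum_erase _ _ (Finset.mem_univ i), if_pos rfl, one_smul, sub_eq_add_neg,
    ← Finset.sum_neg_distrib]
  congr 1
  refine Finset.sum_congr rfl fun j hj => ?_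
  rw [if_neg (Finset.ne_of_mem_erase hj), neg_smul]

/-- Reduction of the weak inequalities to pointwise properties: classical solutions on the positivity
sets, bounded gradients, and `û_i` a classical solution near the closure of `{u_i > 0}`, the origin
excepted. -/
lemma isEntireSolution_of_classical {K : ℕ} {a : Fin K → Fin K → ℝ}
    (ha : ∀ i j, i ≠ j → 0 < a i j) {μ ω : ℝ} {u : Fin K → Plane → ℝ}
    (h0 : ∀ j x, 0 ≤ u j x) (hdisj : ∀ i j, i ≠ j → ∀ x, u i x * u j x = 0)
    (hb : ∀ j, LocBdd (u j) (gradient (u j)))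
    (hu : ∀ j x, 0 < u j x → ClassicalAt μ ω (u j) x)
    (hw : ∀ i, ∀ x ∈ closure {x | 0 < u i x}, x ≠ 0 →
      ∀ᶠ y in 𝓝 x, ClassicalAt μ ω (hat a u i) y) :
    IsEntireSolution a μ ω u := by
  refine ⟨h0, hdisj, fun i => gradient (u i),
    fun i => isH1Loc_gradient (h0 i) (hb i) fun x hx => (hu i x hx).1, fun i φ hφ =>
      ⟨weakForm_nonpos (h0 i) (hb i) (hu i) hφ, ?_⟩⟩
  rw [hat_eq_sum, hat_eq_sum]
  refine weakForm_combination_nonneg h0 hb hu (i := i) (fun j hj => ?_) (fun x hx hx0 => ?_) hφ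
  · rw [if_neg hj]
    exact neg_nonpos.2 (div_pos (ha i j (Ne.symm hj)) (ha j i hj)).le
  · have := hw i x hx hx0
    rwa [hat_eq_sum] at this

/-! ### The explicit function in Cartesian coordinates -/

/-- The identification of the plane with `ℂ`. -/
def toC : Plane →L[ℝ] ℂ :=
  Complex.ofRealCLM.comp (EuclideanSpace.proj 0) +
    Complex.I • Complex.ofRealCLM.comp (EuclideanSpace.proj 1)

lemma toC_apply (x : Plane) : toC x = (x 0 : ℂ) + Complex.I * (x 1 : ℂ) := by
  simp [toC]

lemma norm_toC (x : Plane) : ‖toC x‖ = ‖x‖ := by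
  rw [toC_apply, EuclideanSpace.norm_eq, Complex.norm_eq_sqrt_sq_add_sq]
  simp [Fin.sum_univ_two]

lemma toC_injective : Function.Injective toC := by
  intro x y h
  rw [← sub_eq_zero, ← map_sub, ← norm_eq_zero, norm_toC, norm_eq_zero, sub_eq_zero] at h
  exact h

lemma toC_polar (r θ : ℝ) : toC (polar r θ) = r * Complex.exp (θ * Complex.I) := by
  rw [toC_apply, Complex.exp_mul_I]
  simp [polar]
  ring

lemma norm_polar {r : ℝ} (hr : 0 ≤ r) (θ : ℝ) : ‖polar r θ‖ = r := by
  rw [← norm_toC, toC_polar, norm_mul, Complex.norm_exp_ofReal_mul_I, mul_one, Complex.norm_real,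
    Real.norm_of_nonneg hr]

/-- The branch of `log` with imaginary part in `(θ₀ - π, θ₀ + π]`. -/
def logBranch (θ₀ : ℝ) (x : Plane) : ℂ :=
  Complex.log (toC x * Complex.exp (-(θ₀ * Complex.I))) + θ₀ * Complex.I

/-- The plane slit along the half-line opposite to the direction `θ₀`. -/
def slit (θ₀ : ℝ) : Set Plane := {x | toC x * Complex.exp (-(θ₀ * Complex.I)) ∈ Complex.slitPlane}

/-- The angle corresponding to `logBranch`. -/
def angle (θ₀ : ℝ) (x : Plane) : ℝ := (logBranch θ₀ x).im

lemma isOpen_slit (θ₀ : ℝ) : IsOpen (slit θ₀) :=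
  Complex.isOpen_slitPlane.preimage (toC.continuous.mul continuous_const)

lemma toC_ne_zero_of_mem_slit {θ₀ : ℝ} {x : Plane} (hx : x ∈ slit θ₀) : toC x ≠ 0 :=
  left_ne_zero_of_mul (Complex.slitPlane_ne_zero hx)

lemma norm_pos_of_mem_slit {θ₀ : ℝ} {x : Plane} (hx : x ∈ slit θ₀) : 0 < ‖x‖ := by
  rw [← norm_toC]
  exact norm_pos_iff.2 (toC_ne_zero_of_mem_slit hx)

lemma polar_mem_slit {r : ℝ} (hr : 0 < r) (θ₀ : ℝ) : polar r θ₀ ∈ slit θ₀ := by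
  change toC (polar r θ₀) * Complex.exp (-(θ₀ * Complex.I)) ∈ Complex.slitPlane
  rw [toC_polar, mul_assoc, ← Complex.exp_add, add_neg_cancel, Complex.exp_zero, mul_one]
  exact Complex.ofReal_mem_slitPlane.2 hr

lemma angle_polar {r : ℝ} (hr : 0 < r) (θ₀ : ℝ) : angle θ₀ (polar r θ₀) = θ₀ := by
  rw [angle, logBranch, toC_polar, mul_assoc, ← Complex.exp_add, add_neg_cancel, Complex.exp_zero,
    mul_one, ← Complex.ofReal_log hr.le]
  simp

lemma exp_logBranch {θ₀ : ℝ} {x : Plane} (hx : toC x ≠ 0) :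
    Complex.exp (logBranch θ₀ x) = toC x := by
  rw [logBranch, Complex.exp_add, Complex.exp_log (mul_ne_zero hx (Complex.exp_ne_zero _)),
    mul_assoc, ← Complex.exp_add, neg_add_cancel, Complex.exp_zero, mul_one]

lemma logBranch_re (θ₀ : ℝ) (x : Plane) : (logBranch θ₀ x).re = Real.log ‖x‖ := by
  rw [logBranch, Complex.add_re, Complex.log_re, norm_mul, norm_toC, ← neg_mul, ← Complex.ofReal_neg,
    Complex.norm_exp_ofReal_mul_I]
  simp

lemma logBranch_eq (θ₀ : ℝ) (x : Plane) :
    logBranch θ₀ x = Real.log ‖x‖ + angle θ₀ x * Complex.I := by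
  rw [← logBranch_re θ₀ x, angle]
  exact (Complex.re_add_im _).symm

lemma polar_angle {x : Plane} (hx : x ≠ 0) (θ₀ : ℝ) : polar ‖x‖ (angle θ₀ x) = x := by
  have hx' : toC x ≠ 0 := by rw [← norm_pos_iff, norm_toC]; exact norm_pos_iff.2 hx
  have hn : 0 < ‖x‖ := norm_pos_iff.2 hx
  refine toC_injective ?_
  rw [toC_polar]
  have h := exp_logBranch (θ₀ := θ₀) hx'
  rw [logBranch_eq, Complex.exp_add, ← Complex.ofReal_exp, Real.exp_log hn] at h
  exact h

lemma continuousAt_angle {θ₀ : ℝ} {x : Plane} (hx : x ∈ slit θ₀) : ContinuousAt (angle θ₀) x := by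
  refine Complex.continuous_im.continuousAt.comp ?_
  refine ContinuousAt.add ?_ continuousAt_const
  exact (toC.continuous.mul continuous_const).continuousAt.clog hx

/-- The functions `z^c Θ_m(l |z|²)`, for a branch of the power. -/
def powTheta (θ₀ : ℝ) (l c m : ℂ) (x : Plane) : ℂ :=
  Complex.exp (c * logBranch θ₀ x) * Theta m (l * ((‖x‖ ^ 2 : ℝ) : ℂ))

lemma hasFDerivAt_logBranch {θ₀ : ℝ} {x : Plane} (hx : x ∈ slit θ₀) :
    HasFDerivAt (logBranch θ₀) ((toC x)⁻¹ • toC) x := by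
  have h1 : HasFDerivAt (fun x => toC x * Complex.exp (-(θ₀ * Complex.I)))
      (Complex.exp (-(θ₀ * Complex.I)) • toC) x := toC.hasFDerivAt.mul_const _
  have h2 := ((Complex.hasDerivAt_log hx).complexToReal_fderiv.comp x h1).add_const
    (θ₀ * Complex.I)
  refine h2.congr_fderiv ?_
  ext e
  have := Complex.exp_ne_zero (-(θ₀ * Complex.I))
  have := toC_ne_zero_of_mem_slit hx
  simp
  field_simp

lemma powTheta_sub_one {θ₀ : ℝ} (l c m : ℂ) {x : Plane} (hx : x ∈ slit θ₀) :
    toC x * powTheta θ₀ l (c - 1) m x = powTheta θ₀ l c m x := by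
  have h := exp_logBranch (θ₀ := θ₀) (toC_ne_zero_of_mem_slit hx)
  have : Complex.exp (c * logBranch θ₀ x) =
      toC x * Complex.exp ((c - 1) * logBranch θ₀ x) := by
    conv_rhs => rw [← h]
    rw [← Complex.exp_add]
    ring_nf
  rw [powTheta, powTheta, this]
  ring

/-- The family of the functions `z^c Θ_m(l |z|²)` is closed under differentiation. -/
lemma hasFDerivAt_powTheta {θ₀ : ℝ} (l c : ℂ) {m : ℂ} (hm : 0 < m.re) {x : Plane}
    (hx : x ∈ slit θ₀) :
    HasFDerivAt (powTheta θ₀ l c m) ((c * powTheta θ₀ l (c - 1) m x) • toC +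
      (l / 2 * powTheta θ₀ l c (m + 1) x) • Complex.ofRealCLM.comp (innerSL ℝ x)) x := by
  have h1 : HasFDerivAt (fun x => Complex.exp (c * logBranch θ₀ x)) _ x :=
    ((Complex.hasDerivAt_exp _).complexToReal_fderiv).comp x
      ((hasFDerivAt_logBranch hx).const_mul c)
  have h2 : HasFDerivAt (fun x : Plane => ((‖x‖ ^ 2 : ℝ) : ℂ))
      (Complex.ofRealCLM.comp (2 • innerSL ℝ x)) x :=
    Complex.ofRealCLM.hasFDerivAt.comp x (hasStrictFDerivAt_norm_sq x).hasFDerivAt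
  have h3 : HasFDerivAt (fun x : Plane => Theta m (l * ((‖x‖ ^ 2 : ℝ) : ℂ))) _ x :=
    HasFDerivAt.comp (g := Theta m) x
      ((hasDerivAt_Theta hm (l * ((‖x‖ ^ 2 : ℝ) : ℂ))).complexToReal_fderiv) (h2.const_mul l)
  refine (h1.mul h3).congr_fderiv ?_
  ext e
  have h4 := powTheta_sub_one l c m hx
  have h5 := toC_ne_zero_of_mem_slit hx
  have h6 : powTheta θ₀ l (c - 1) m x = (toC x)⁻¹ * powTheta θ₀ l c m x := by
    rw [← h4, inv_mul_cancel_left₀ h5]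
  simp only [h6]
  simp [powTheta]
  ring

lemma contDiffAt_powTheta {θ₀ : ℝ} (l c : ℂ) {m : ℂ} (hm : 0 < m.re) {x : Plane}
    (hx : x ∈ slit θ₀) : ContDiffAt ℝ 2 (powTheta θ₀ l c m) x := by
  have h1 : ContDiffAt ℝ 2 (logBranch θ₀) x := by
    refine ContDiffAt.add ?_ contDiffAt_const
    have h : ContDiffAt ℝ 2 Complex.log (toC x * Complex.exp (-(θ₀ * Complex.I))) :=
      (Complex.contDiffAt_log hx).restrict_scalars ℝ
    exact h.comp x (toC.contDiff.contDiffAt.mul contDiffAt_const)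
  have h2 : ContDiff ℝ 2 (Theta m) := ((differentiable_Theta hm).contDiff (n := 2)).restrict_scalars ℝ
  have h3 : ContDiff ℝ 2 fun x : Plane => l * ((‖x‖ ^ 2 : ℝ) : ℂ) :=
    contDiff_const.mul (Complex.ofRealCLM.contDiff.comp (contDiff_norm_sq ℝ))
  exact ((contDiffAt_const.mul h1).cexp).mul (h2.comp h3).contDiffAt

lemma norm_powTheta (θ₀ : ℝ) (l c m : ℂ) {x : Plane} (hx : 0 < ‖x‖) :
    ‖powTheta θ₀ l c m x‖ = ‖x‖ ^ c.re * Real.exp (-c.im * angle θ₀ x) *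
      ‖Theta m (l * ((‖x‖ ^ 2 : ℝ) : ℂ))‖ := by
  rw [powTheta, norm_mul, Complex.norm_exp, logBranch_eq, Real.rpow_def_of_pos hx, ← Real.exp_add]
  congr 2
  simp
  ring

section Mode

variable {K : ℕ} (a : Fin K → Fin K → ℝ) (μ ω : ℝ)

/-- The explicit function in Cartesian coordinates, for a branch of the angle. -/
def localMode (θ₀ : ℝ) (x : Plane) : ℝ :=
  (powTheta θ₀ (lam a μ ω) (order a) (order a) x).re

lemma localMode_eq {θ₀ : ℝ} {x : Plane} (hx : x ≠ 0) :
    localMode a μ ω θ₀ x = mode a μ ω ‖x‖ (angle θ₀ x) := by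
  have hn : 0 < ‖x‖ := norm_pos_iff.2 hx
  have h1 : order a * logBranch θ₀ x =
      ((asymmetry a * angle θ₀ x + Real.log ‖x‖ * ((K : ℝ) / 2) : ℝ) : ℂ) +
        Complex.I * (((K : ℝ) / 2 * angle θ₀ x - asymmetry a * Real.log ‖x‖ : ℝ) : ℂ) := by
    rw [logBranch_eq, order]
    push_cast
    linear_combination (-(asymmetry a : ℂ) * angle θ₀ x) * Complex.I_sq
  rw [localMode, powTheta, mode, h1, Complex.exp_add, ← Complex.ofReal_exp, mul_assoc,
    Complex.re_ofReal_mul, Real.exp_add, Real.rpow_def_of_pos hn]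
  push_cast
  rfl

variable {a}

lemma fderiv_localMode (hK : 0 < K) {θ₀ : ℝ} {x : Plane} (hx : x ∈ slit θ₀) (e : Plane) :
    fderiv ℝ (localMode a μ ω θ₀) x e =
      (order a * powTheta θ₀ (lam a μ ω) (order a - 1) (order a) x * toC e +
        lam a μ ω / 2 * powTheta θ₀ (lam a μ ω) (order a) (order a + 1) x *
          ((⟪x, e⟫ : ℝ) : ℂ)).re := by
  have hν : 0 < (order a).re := by rw [order_re]; positivity
  have h := Complex.reCLM.hasFDerivAt.comp x
    (hasFDerivAt_powTheta (θ₀ := θ₀) (lam a μ ω) (order a) hν hx)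
  have h' : HasFDerivAt (localMode a μ ω θ₀) _ x := h
  rw [h'.fderiv]
  simp

/-- For `w = z^ν Θ_ν(l |z|²)` one has `x^⊥ · ∇w = iν w` and, by the recurrence for `Θ`, `Δw = l w`;
moreover `λ = iων - μ`. -/
lemma classicalAt_localMode (hK : 0 < K) {θ₀ : ℝ} {x : Plane} (hx : x ∈ slit θ₀) :
    ClassicalAt μ ω (localMode a μ ω θ₀) x := by
  have hν : 0 < (order a).re := by rw [order_re]; positivity
  have hν1 : 0 < (order a + 1).re := by simp; linarith
  set ν := order a with hνdef
  set l := lam a μ ω with hl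
  refine ⟨Complex.reCLM.contDiff.contDiffAt.comp x (contDiffAt_powTheta l ν hν hx), ?_⟩
  have hsecond : ∀ e : Plane, fderiv ℝ (fun y => fderiv ℝ (localMode a μ ω θ₀) y e) x e =
      (ν * ((ν - 1) * powTheta θ₀ l (ν - 1 - 1) ν x * toC e +
          l / 2 * powTheta θ₀ l (ν - 1) (ν + 1) x * ((⟪x, e⟫ : ℝ) : ℂ)) * toC e +
        l / 2 * ((ν * powTheta θ₀ l (ν - 1) (ν + 1) x * toC e +
          l / 2 * powTheta θ₀ l ν (ν + 1 + 1) x * ((⟪x, e⟫ : ℝ) : ℂ)) * ((⟪x, e⟫ : ℝ) : ℂ) +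
          powTheta θ₀ l ν (ν + 1) x * ((⟪e, e⟫ : ℝ) : ℂ))).re := by
    intro e
    have hev : (fun y => fderiv ℝ (localMode a μ ω θ₀) y e) =ᶠ[𝓝 x] fun y =>
        (ν * powTheta θ₀ l (ν - 1) ν y * toC e +
          l / 2 * powTheta θ₀ l ν (ν + 1) y * ((⟪y, e⟫ : ℝ) : ℂ)).re := by
      filter_upwards [(isOpen_slit θ₀).mem_nhds hx] with y hy
      exact fderiv_localMode μ ω hK hy e
    rw [hev.fderiv_eq]
    have h1 := ((hasFDerivAt_powTheta l (ν - 1) hν hx).const_mul ν).mul_const (toC e)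
    have h2 : HasFDerivAt (fun y : Plane => ((⟪y, e⟫ : ℝ) : ℂ))
        (Complex.ofRealCLM.comp (innerSL ℝ e)) x := by
      have h := (Complex.ofRealCLM.comp (innerSL ℝ e)).hasFDerivAt (x := x)
      refine h.congr_of_eventuallyEq (Eventually.of_forall fun y => ?_)
      simp [real_inner_comm]
    have h3 := ((hasFDerivAt_powTheta l ν hν1 hx).const_mul (l / 2)).mul h2
    have h4 : HasFDerivAt (fun y => (ν * powTheta θ₀ l (ν - 1) ν y * toC e +
          l / 2 * powTheta θ₀ l ν (ν + 1) y * ((⟪y, e⟫ : ℝ) : ℂ)).re) _ x :=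
      Complex.reCLM.hasFDerivAt.comp x (h1.add h3)
    rw [h4.fderiv]
    simp only [ContinuousLinearMap.comp_apply, Complex.reCLM_apply]
    congr 1
    simp
    ring
  have hZ := toC_apply x
  have hp1 := powTheta_sub_one l ν (ν + 1) hx
  -- the Laplacian at `x` is `l` times the right-hand side of this recurrence
  have hrec : powTheta θ₀ l ν ν x = (ν + 1) * powTheta θ₀ l ν (ν + 1) x +
      l / 4 * ((‖x‖ ^ 2 : ℝ) : ℂ) * powTheta θ₀ l ν (ν + 1 + 1) x := by
    simp only [powTheta]
    rw [Theta_recurrence hν]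
    ring
  have hnorm : ‖x‖ ^ 2 = x 0 ^ 2 + x 1 ^ 2 := by
    rw [EuclideanSpace.norm_sq_eq]
    simp [Fin.sum_univ_two]
  have hp0 := powTheta_sub_one l ν ν hx
  have hperp : toC (perp x) = Complex.I * toC x := by
    rw [toC_apply, toC_apply]
    simp only [perp]
    simp
    linear_combination (-(x 1 : ℂ)) * Complex.I_sq
  have hperp' : ⟪x, perp x⟫ = 0 := by
    simp [perp, PiLp.inner_apply, Fin.sum_univ_two]
    ring
  have hlam : l = Complex.I * ω * ν - μ := by
    rw [hl, hνdef, lam, order]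
    push_cast
    linear_combination ((ω : ℂ) * asymmetry a) * Complex.I_sq
  rw [fderiv_localMode μ ω hK hx, hperp, hperp', localMode]
  simp only [hsecond]
  have hLHS : ∀ A B : ℂ, A = B → A.re = B.re := fun A B h => h ▸ rfl
  have e0 : toC (unitVec 0) = 1 := by simp [toC_apply]
  have e1 : toC (unitVec 1) = Complex.I := by simp [toC_apply]
  have i0 : ⟪x, unitVec 0⟫ = x 0 := by simp [EuclideanSpace.inner_single_right]
  have i1 : ⟪x, unitVec 1⟫ = x 1 := by simp [EuclideanSpace.inner_single_right]
  have j0 : ∀ i : Fin 2, ⟪unitVec i, unitVec i⟫ = 1 := fun i => by simp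
  rw [Fin.sum_univ_two, ← Complex.add_re, e0, e1, i0, i1, j0, j0, ← Complex.re_ofReal_mul,
    ← Complex.re_ofReal_mul, ← Complex.sub_re]
  refine hLHS _ _ ?_
  rw [← hνdef, ← hl, Complex.ofReal_zero, mul_zero, add_zero]
  have hR : (ω : ℂ) * (ν * powTheta θ₀ l (ν - 1) ν x * (Complex.I * toC x)) -
      μ * powTheta θ₀ l ν ν x = l * powTheta θ₀ l ν ν x := by
    have h : ν * powTheta θ₀ l (ν - 1) ν x * (Complex.I * toC x) =
        Complex.I * ν * powTheta θ₀ l ν ν x := by rw [← hp0]; ring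
    rw [h]
    linear_combination (-powTheta θ₀ l ν ν x) * hlam
  rw [hR, hrec, hnorm, ← hp1, hZ]
  push_cast
  linear_combination (ν * (ν - 1) * powTheta θ₀ l (ν - 1 - 1) ν x) * Complex.I_sq

/-- The gradient is `O(e^{αθ} r^{K/2 - 1})`, hence `O(e^{αθ})` on bounded sets. -/
lemma exists_bound_fderiv_localMode (hK : 2 ≤ K) (R : ℝ) :
    ∃ C : ℝ, 0 ≤ C ∧ ∀ (θ₀ : ℝ), ∀ x ∈ slit θ₀, ‖x‖ ≤ R →
      ‖fderiv ℝ (localMode a μ ω θ₀) x‖ ≤ C * Real.exp (asymmetry a * angle θ₀ x) := by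
  have hK' : (2 : ℝ) ≤ K := by exact_mod_cast hK
  have hν : 0 < (order a).re := by rw [order_re]; positivity
  have hν1 : 0 < (order a + 1).re := by simp; linarith
  set ν := order a with hνdef
  set l := lam a μ ω with hl
  have hb : ∀ m : ℂ, 0 < m.re → ∃ B : ℝ, 0 ≤ B ∧ ∀ x : Plane, ‖x‖ ≤ R →
      ‖Theta m (l * ((‖x‖ ^ 2 : ℝ) : ℂ))‖ ≤ B := by
    intro m hm
    have hc : Continuous fun x : Plane => Theta m (l * ((‖x‖ ^ 2 : ℝ) : ℂ)) :=
      (differentiable_Theta hm).continuous.comp (by fun_prop)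
    obtain ⟨B, hB⟩ := (isCompact_closedBall (0 : Plane) R).exists_bound_of_continuousOn
      hc.continuousOn
    exact ⟨|B|, abs_nonneg _, fun x hx => (hB x (by simpa using hx)).trans (le_abs_self B)⟩
  obtain ⟨B0, hB0, hB0'⟩ := hb ν hν
  obtain ⟨B1, hB1, hB1'⟩ := hb (ν + 1) hν1
  refine ⟨‖ν‖ * (|R| ^ ((K : ℝ) / 2 - 1) * B0) + ‖l / 2‖ * (|R| ^ ((K : ℝ) / 2) * B1) * |R|,
    by positivity, fun θ₀ x hx hxR => ?_⟩
  have hn := norm_pos_of_mem_slit hx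
  have hxR' : ‖x‖ ≤ |R| := hxR.trans (le_abs_self R)
  refine ContinuousLinearMap.opNorm_le_bound _ (by positivity) fun e => ?_
  rw [fderiv_localMode μ ω (by omega) hx]
  refine (Complex.abs_re_le_norm _).trans ?_
  refine (norm_add_le _ _).trans ?_
  rw [norm_mul, norm_mul, norm_mul, norm_mul, norm_toC, Complex.norm_real, norm_powTheta _ _ _ _ hn,
    norm_powTheta _ _ _ _ hn]
  have hi : ‖⟪x, e⟫‖ ≤ |R| * ‖e‖ :=
    (norm_inner_le_norm x e).trans (by gcongr)
  have hre1 : (ν - 1).re = (K : ℝ) / 2 - 1 := by rw [Complex.sub_re, hνdef, order_re]; simp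
  have him1 : -(ν - 1).im = asymmetry a := by rw [Complex.sub_im, hνdef, order_im]; simp
  have hre : ν.re = (K : ℝ) / 2 := by rw [hνdef, order_re]
  have him : -ν.im = asymmetry a := by rw [hνdef, order_im]; simp
  rw [← hνdef, ← hl, hre1, him1, hre, him]
  set E := Real.exp (asymmetry a * angle θ₀ x)
  have hE : 0 < E := Real.exp_pos _
  have hk : 0 ≤ (K : ℝ) / 2 - 1 := by linarith
  calc ‖ν‖ * (‖x‖ ^ ((K : ℝ) / 2 - 1) * E * ‖Theta ν (l * ((‖x‖ ^ 2 : ℝ) : ℂ))‖) * ‖e‖ +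
        ‖l / 2‖ * (‖x‖ ^ ((K : ℝ) / 2) * E * ‖Theta (ν + 1) (l * ((‖x‖ ^ 2 : ℝ) : ℂ))‖) * ‖⟪x, e⟫‖
      ≤ ‖ν‖ * (|R| ^ ((K : ℝ) / 2 - 1) * E * B0) * ‖e‖ +
        ‖l / 2‖ * (|R| ^ ((K : ℝ) / 2) * E * B1) * (|R| * ‖e‖) := by
        gcongr
        · exact hB0' x hxR
        · exact hB1' x hxR
    _ = _ := by ring

end Mode

/-! ### The solution and its sectors -/

section Weights

variable {K : ℕ} [NeZero K]

/-- The residue class modulo `K` of an integer, as an index. -/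
def idx (K : ℕ) [NeZero K] (m : ℤ) : Fin K :=
  ⟨(m % K).toNat, by
    have h0 : (K : ℤ) ≠ 0 := by exact_mod_cast NeZero.ne K
    have h1 := Int.emod_nonneg m h0
    have h2 := Int.emod_lt_of_pos m (by have := NeZero.pos K; omega : (0 : ℤ) < K)
    omega⟩

lemma idx_val (m : ℤ) : ((idx K m : ℕ) : ℤ) = m % K := by
  have h0 : (K : ℤ) ≠ 0 := by exact_mod_cast NeZero.ne K
  have h1 := Int.emod_nonneg m h0
  simp only [idx]
  omega

lemma idx_natCast (i : Fin K) : idx K ((i : ℕ) : ℤ) = i := by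
  ext
  have h := idx_val (K := K) ((i : ℕ) : ℤ)
  rw [Int.emod_eq_of_lt (by omega) (by have := i.2; omega)] at h
  omega

lemma idx_add_mul (m n : ℤ) : idx K (m + n * K) = idx K m := by
  ext
  have h1 := idx_val (K := K) (m + n * K)
  have h2 := idx_val (K := K) m
  rw [Int.add_mul_emod_self_right] at h1
  omega

lemma eq_idx_add (m : ℤ) : m = ((idx K m : ℕ) : ℤ) + (m / K) * K := by
  rw [idx_val]
  have := Int.emod_add_mul_ediv m K
  linarith

lemma idx_succ (hK : 2 ≤ K) (m : ℤ) : idx K (m + 1) = finRotate K (idx K m) := by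
  obtain ⟨n, rfl⟩ : ∃ n, K = n + 1 := ⟨K - 1, by omega⟩
  have h0 := idx_val (K := n + 1) m
  have h1 := idx_val (K := n + 1) (m + 1)
  have hm := eq_idx_add (K := n + 1) m
  have hlt := (idx (n + 1) m).2
  have h2 : ((idx (n + 1) (m + 1) : ℕ) : ℤ) = (((idx (n + 1) m : ℕ) : ℤ) + 1) % ((n + 1 : ℕ) : ℤ) := by
    rw [h1, h0, Int.emod_add_emod]
  ext
  rcases Nat.lt_or_ge ((idx (n + 1) m : ℕ) + 1) (n + 1) with h | h
  · rw [coe_finRotate_of_ne_last (fun he => by rw [he] at h; simp at h)]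
    rw [Int.emod_eq_of_lt (by omega) (by omega)] at h2
    omega
  · have he : idx (n + 1) m = Fin.last n := by ext; simp; omega
    rw [he, finRotate_last]
    rw [he, Fin.val_last] at h2
    push_cast at h2
    rw [Int.emod_self] at h2
    simpa using h2

lemma finRotate_ne (hK : 2 ≤ K) (i : Fin K) : finRotate K i ≠ i := by
  have h := idx_succ hK ((i : ℕ) : ℤ)
  rw [idx_natCast] at h
  rw [← h]
  intro he
  have h1 := idx_val (K := K) (((i : ℕ) : ℤ) + 1)
  rw [he] at h1
  have hi := i.2
  rcases Nat.lt_or_ge ((i : ℕ) + 1) K with h2 | h2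
  · rw [Int.emod_eq_of_lt (by omega) (by omega)] at h1
    omega
  · have h3 : ((i : ℕ) : ℤ) + 1 = K := by omega
    rw [h3, Int.emod_self] at h1
    omega

lemma idx_succ_ne (hK : 2 ≤ K) (m : ℤ) : idx K (m + 1) ≠ idx K m := by
  rw [idx_succ hK]
  exact finRotate_ne hK _

variable {a : Fin K → Fin K → ℝ}

lemma weight_pos (hK : 2 ≤ K) (ha : ∀ i j, i ≠ j → 0 < a i j) (i : Fin K) : 0 < weight a i :=
  Finset.prod_pos fun j _ => div_pos (ha _ _ (finRotate_ne hK j)) (ha _ _ (finRotate_ne hK j).symm)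

/-- The weights continued to all integers: the coefficient of `(-1)^m v` on the `m`-th sector of
the universal covering of the punctured plane. -/
def coverWeight (a : Fin K → Fin K → ℝ) (m : ℤ) : ℝ :=
  Real.exp (-(2 * Real.pi * asymmetry a * ((m / K : ℤ) : ℝ))) * weight a (idx K m)

lemma coverWeight_pos (hK : 2 ≤ K) (ha : ∀ i j, i ≠ j → 0 < a i j) (m : ℤ) :
    0 < coverWeight a m :=
  mul_pos (Real.exp_pos _) (weight_pos hK ha _)

lemma coverWeight_add_mul (m n : ℤ) : coverWeight a (m + n * K) =
    Real.exp (-(2 * Real.pi * asymmetry a * n)) * coverWeight a m := by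
  rw [coverWeight, coverWeight, idx_add_mul, Int.add_mul_ediv_right _ _
    (by exact_mod_cast NeZero.ne K), ← mul_assoc, ← Real.exp_add]
  push_cast
  ring_nf

lemma coverWeight_natCast (i : Fin K) : coverWeight a ((i : ℕ) : ℤ) = weight a i := by
  rw [coverWeight, idx_natCast, Int.ediv_eq_zero_of_lt (by omega) (by have := i.2; omega)]
  simp

/-- The inverse of the factor gained by `v` along one turn is the product of the ratios of the
weights over all the interfaces. -/
lemma exp_asymmetry (hK : 2 ≤ K) (ha : ∀ i j, i ≠ j → 0 < a i j) :
    Real.exp (-(2 * Real.pi * asymmetry a)) =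
      ∏ j, a (finRotate K j) j / a j (finRotate K j) := by
  have hpos : 0 < ∏ i, a i (finRotate K i) / a (finRotate K i) i :=
    Finset.prod_pos fun j _ => div_pos (ha _ _ (finRotate_ne hK j).symm)
      (ha _ _ (finRotate_ne hK j))
  have h : 2 * Real.pi * asymmetry a = Real.log (∏ i, a i (finRotate K i) / a (finRotate K i) i) := by
    rw [asymmetry]
    have := Real.pi_ne_zero
    field_simp
  rw [h, Real.exp_neg, Real.exp_log hpos, ← Finset.prod_inv_distrib]
  simp only [inv_div]

/-- Crossing an interface multiplies the weight by the ratio of the competition coefficients; after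
`K` crossings this is compensated by the factor `e^{2πα}` gained by `v` along one turn. -/
lemma coverWeight_succ (hK : 2 ≤ K) (ha : ∀ i j, i ≠ j → 0 < a i j) (m : ℤ) :
    coverWeight a (m + 1) = coverWeight a m *
      (a (idx K (m + 1)) (idx K m) / a (idx K m) (idx K (m + 1))) := by
  have hm := eq_idx_add (K := K) m
  set i := idx K m with hi
  set q := m / (K : ℤ) with hq
  have hcm : coverWeight a m = Real.exp (-(2 * Real.pi * asymmetry a * q)) * weight a i := rfl
  have hsucc : idx K (m + 1) = finRotate K i := idx_succ hK m
  rcases Nat.lt_or_ge ((i : ℕ) + 1) K with h | h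
  · have h1 : m + 1 = (((⟨(i : ℕ) + 1, h⟩ : Fin K) : ℕ) : ℤ) + q * K := by
      push_cast; omega
    have h2 : idx K (m + 1) = ⟨(i : ℕ) + 1, h⟩ := by rw [h1, idx_add_mul, idx_natCast]
    have h3 : weight a (⟨(i : ℕ) + 1, h⟩ : Fin K) = weight a i *
        (a (finRotate K i) i / a i (finRotate K i)) := by
      have : Finset.Iio (⟨(i : ℕ) + 1, h⟩ : Fin K) = insert i (Finset.Iio i) := by
        ext j
        simp only [Finset.mem_Iio, Finset.mem_insert, Fin.lt_def, Fin.ext_iff]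
        omega
      rw [weight, this, Finset.prod_insert (by simp), mul_comm]
      rfl
    rw [hsucc, hcm]
    conv_lhs => rw [h1, coverWeight_add_mul, coverWeight_natCast, h3]
    ring
  · -- crossing from the last sector to the first one of the next sheet
    have hlast : (i : ℕ) + 1 = K := le_antisymm i.2 h
    have h1 : m + 1 = (((0 : Fin K) : ℕ) : ℤ) + (q + 1) * K := by
      rw [hm]
      have : (((i : ℕ) : ℤ)) + 1 = K := by exact_mod_cast hlast
      simp
      linarith
    have h3 : weight a (0 : Fin K) = 1 := by
      have : Finset.Iio (0 : Fin K) = ∅ := by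
        ext j
        simp
      rw [weight, this, Finset.prod_empty]
    have h4 : Real.exp (-(2 * Real.pi * asymmetry a)) = weight a i *
        (a (finRotate K i) i / a i (finRotate K i)) := by
      have : (Finset.univ : Finset (Fin K)) = insert i (Finset.Iio i) := by
        ext j
        have := j.2
        simp only [Finset.mem_univ, Finset.mem_Iio, Finset.mem_insert, Fin.lt_def, Fin.ext_iff,
          true_iff]
        omega
      rw [exp_asymmetry hK ha, this, Finset.prod_insert (by simp), mul_comm]
      rfl
    rw [hsucc, hcm, mul_assoc, ← h4, ← Real.exp_add]
    conv_lhs => rw [h1, coverWeight_add_mul, coverWeight_natCast, h3]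
    push_cast
    ring_nf

end Weights

section Solution

variable {K : ℕ} {a : Fin K → Fin K → ℝ} {μ ω : ℝ} {A ϑ : ℝ → ℝ}

/-- The amplitude `A` and the angle function `ϑ` of the nodal lines of the explicit function. The
bound on `e^{αϑ}`, uniform up to the origin although `ϑ` may diverge there, is what makes the
solution and its gradient bounded near the origin. -/
structure IsAngle (a : Fin K → Fin K → ℝ) (μ ω : ℝ) (A ϑ : ℝ → ℝ) : Prop where
  pos : ∀ r, 0 < r → 0 < A r
  cont : ContinuousOn ϑ (Set.Ioi 0)
  mode_eq : ∀ r θ : ℝ, 0 < r → mode a μ ω r θ =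
    Real.exp (asymmetry a * θ) * A r * Real.sin (K / 2 * (θ - ϑ r))
  bdd : ∀ R : ℝ, ∃ C : ℝ, 0 ≤ C ∧ ∀ r, 0 < r → r ≤ R → Real.exp (asymmetry a * ϑ r) ≤ C

/-- The angle relative to the zeroth nodal line, in units of the opening of the sectors. -/
def relAngle (K : ℕ) (ϑ : ℝ → ℝ) (r θ : ℝ) : ℝ := (θ - ϑ r) / (2 * Real.pi / K)

lemma IsAngle.continuousAt_relAngle (h : IsAngle a μ ω A ϑ) {θ₀ : ℝ} {x : Plane}
    (hx : x ∈ slit θ₀) : ContinuousAt (fun y => relAngle K ϑ ‖y‖ (angle θ₀ y)) x := by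
  have h1 : ContinuousAt ϑ ‖x‖ := h.cont.continuousAt (Ioi_mem_nhds (norm_pos_of_mem_slit hx))
  have h2 : ContinuousAt (fun y : Plane => ϑ ‖y‖) x :=
    ContinuousAt.comp (g := ϑ) h1 continuous_norm.continuousAt
  exact ((continuousAt_angle hx).sub h2).div_const _

variable [NeZero K]

/-- The solution: on the `m`-th sector of the covering, the weight times the absolute value of the
explicit function, which is `(-1)^m v`, for the component of index `m` modulo `K`, and zero for the
other components. The principal branch of the angle is used, but the value does not depend on the
branch; at the origin the value is `0`, because `0 ^ (K / 2) = 0`. -/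
def solution (a : Fin K → Fin K → ℝ) (μ ω : ℝ) (ϑ : ℝ → ℝ) (i : Fin K) (x : Plane) : ℝ :=
  if idx K ⌊relAngle K ϑ ‖x‖ (angle 0 x)⌋ = i then
    coverWeight a ⌊relAngle K ϑ ‖x‖ (angle 0 x)⌋ * |mode a μ ω ‖x‖ (angle 0 x)| else 0

lemma relAngle_add (r θ : ℝ) (n : ℤ) :
    relAngle K ϑ r (θ + n * (2 * Real.pi)) = relAngle K ϑ r θ + ((n * K : ℤ) : ℝ) := by
  have := Real.pi_ne_zero
  have : (K : ℝ) ≠ 0 := by exact_mod_cast NeZero.ne K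
  rw [relAngle, relAngle]
  push_cast
  field_simp
  ring

lemma relAngle_eq_iff {r θ t : ℝ} :
    relAngle K ϑ r θ = t ↔ θ = ϑ r + t * (2 * Real.pi / K) := by
  have hK : (0 : ℝ) < K := by exact_mod_cast NeZero.pos K
  have : 0 < 2 * Real.pi / K := by have := Real.pi_pos; positivity
  rw [relAngle, div_eq_iff this.ne']
  constructor <;> intro h <;> linarith

lemma mem_sector_iff {r θ : ℝ} {i : Fin K} : (r, θ) ∈ sector ϑ i ↔
    0 < r ∧ relAngle K ϑ r θ ∈ Set.Ioo ((i : ℕ) : ℝ) ((i : ℕ) + 1) := by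
  have hK : (0 : ℝ) < K := by exact_mod_cast NeZero.pos K
  have : 0 < 2 * Real.pi / K := by have := Real.pi_pos; positivity
  simp only [sector, relAngle, Set.mem_Ioo, lt_div_iff₀ this, div_lt_iff₀ this]
  constructor
  · rintro ⟨h1, h2, h3⟩
    exact ⟨h1, by linarith, by linarith⟩
  · rintro ⟨h1, h2, h3⟩
    exact ⟨h1, by linarith, by linarith⟩

lemma IsAngle.mode_eq_sin (h : IsAngle a μ ω A ϑ) {r : ℝ} (hr : 0 < r) (θ : ℝ) :
    mode a μ ω r θ =
      Real.exp (asymmetry a * θ) * A r * Real.sin (relAngle K ϑ r θ * Real.pi) := by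
  have := Real.pi_ne_zero
  have : (K : ℝ) ≠ 0 := by exact_mod_cast NeZero.ne K
  rw [h.mode_eq r θ hr, relAngle]
  congr 2
  field_simp

lemma IsAngle.mode_eq_zero_iff (h : IsAngle a μ ω A ϑ) {r : ℝ} (hr : 0 < r) (θ : ℝ) :
    mode a μ ω r θ = 0 ↔ ∃ m : ℤ, relAngle K ϑ r θ = m := by
  have h1 : Real.exp (asymmetry a * θ) * A r ≠ 0 := mul_ne_zero (Real.exp_pos _).ne' (h.pos r hr).ne'
  rw [h.mode_eq_sin hr, mul_eq_zero, or_iff_right h1, Real.sin_eq_zero_iff]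
  refine exists_congr fun m => ?_
  rw [mul_left_inj' Real.pi_ne_zero, eq_comm]

lemma sin_mul_pi_eq (t : ℝ) (m : ℤ) :
    Real.sin (t * Real.pi) = (-1) ^ m * Real.sin ((t - m) * Real.pi) := by
  have := Real.sin_add_int_mul_pi ((t - m) * Real.pi) m
  rw [← this]
  congr 1
  ring

lemma neg_one_zpow_mul_self (m : ℤ) : ((-1 : ℝ) ^ m) * (-1) ^ m = 1 := by
  rw [← mul_zpow]
  norm_num

lemma IsAngle.sign_mode (h : IsAngle a μ ω A ϑ) {r : ℝ} (hr : 0 < r) {θ : ℝ} {m : ℤ}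
    (h1 : (m : ℝ) ≤ relAngle K ϑ r θ) (h2 : relAngle K ϑ r θ ≤ m + 1) :
    0 ≤ (-1 : ℝ) ^ m * mode a μ ω r θ := by
  rw [h.mode_eq_sin hr, sin_mul_pi_eq _ m]
  have h3 : 0 ≤ Real.sin ((relAngle K ϑ r θ - m) * Real.pi) :=
    Real.sin_nonneg_of_nonneg_of_le_pi (mul_nonneg (by linarith) Real.pi_pos.le)
      (by nlinarith [Real.pi_pos])
  calc (0 : ℝ) ≤ Real.exp (asymmetry a * θ) * A r *
      Real.sin ((relAngle K ϑ r θ - m) * Real.pi) := by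
        have := (h.pos r hr).le
        positivity
    _ = ((-1 : ℝ) ^ m * (-1) ^ m) * (Real.exp (asymmetry a * θ) * A r *
      Real.sin ((relAngle K ϑ r θ - m) * Real.pi)) := by rw [neg_one_zpow_mul_self, one_mul]
    _ = _ := by ring

lemma IsAngle.abs_mode (h : IsAngle a μ ω A ϑ) {r : ℝ} (hr : 0 < r) {θ : ℝ} {m : ℤ}
    (h1 : (m : ℝ) ≤ relAngle K ϑ r θ) (h2 : relAngle K ϑ r θ ≤ m + 1) :
    |mode a μ ω r θ| = (-1 : ℝ) ^ m * mode a μ ω r θ := by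
  rw [← abs_of_nonneg (h.sign_mode hr h1 h2), abs_mul, abs_zpow]
  simp

/-- One turn multiplies `|v|` by `e^{2πα}`. -/
lemma IsAngle.abs_mode_add (h : IsAngle a μ ω A ϑ) {r : ℝ} (hr : 0 < r) (θ : ℝ) (n : ℤ) :
    |mode a μ ω r (θ + n * (2 * Real.pi))| =
      Real.exp (2 * Real.pi * asymmetry a * n) * |mode a μ ω r θ| := by
  rw [h.mode_eq_sin hr, h.mode_eq_sin hr, relAngle_add, add_mul, Real.sin_add_int_mul_pi, abs_mul,
    abs_mul, abs_mul, abs_mul, abs_mul, abs_zpow, abs_neg, abs_one, one_zpow, one_mul,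
    Real.abs_exp, Real.abs_exp, mul_add, Real.exp_add]
  ring_nf

lemma exists_angle_eq {r : ℝ} (hr : 0 < r) (θ : ℝ) :
    ∃ n : ℤ, angle 0 (polar r θ) = θ + n * (2 * Real.pi) := by
  have hx : polar r θ ≠ 0 := by
    rw [← norm_pos_iff, norm_polar hr.le]
    exact hr
  have h := congrArg toC (polar_angle hx 0)
  rw [norm_polar hr.le, toC_polar, toC_polar] at h
  have h2 := mul_left_cancel₀ (by exact_mod_cast hr.ne') h
  rw [Complex.exp_eq_exp_iff_exists_int] at h2
  obtain ⟨n, hn⟩ := h2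
  refine ⟨n, ?_⟩
  have := congrArg Complex.im hn
  simpa using this

/-- The solution may be computed with any choice of the angle. -/
lemma IsAngle.solution_polar (h : IsAngle a μ ω A ϑ) (i : Fin K) {r : ℝ} (hr : 0 < r) (θ : ℝ) :
    solution a μ ω ϑ i (polar r θ) = if idx K ⌊relAngle K ϑ r θ⌋ = i then
      coverWeight a ⌊relAngle K ϑ r θ⌋ * |mode a μ ω r θ| else 0 := by
  obtain ⟨n, hn⟩ := exists_angle_eq hr θ
  rw [solution, norm_polar hr.le, hn, relAngle_add, Int.floor_add_intCast, idx_add_mul,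
    coverWeight_add_mul, h.abs_mode_add hr]
  congr 1
  rw [mul_mul_mul_comm, ← Real.exp_add]
  simp

lemma solution_zero (i : Fin K) : solution a μ ω ϑ i 0 = 0 := by
  have h : mode a μ ω ‖(0 : Plane)‖ (angle 0 0) = 0 := by
    have : (K : ℝ) / 2 ≠ 0 := by
      have : (K : ℝ) ≠ 0 := by exact_mod_cast NeZero.ne K
      positivity
    rw [mode, norm_zero, Real.zero_rpow this]
    ring
  rw [solution, h]
  simp

lemma solution_nonneg (hK : 2 ≤ K) (ha : ∀ i j, i ≠ j → 0 < a i j) (i : Fin K) (x : Plane) :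
    0 ≤ solution a μ ω ϑ i x := by
  rw [solution]
  split_ifs
  · exact mul_nonneg (coverWeight_pos hK ha _).le (abs_nonneg _)
  · exact le_rfl

lemma solution_disjoint {i j : Fin K} (hij : i ≠ j) (x : Plane) :
    solution a μ ω ϑ i x * solution a μ ω ϑ j x = 0 := by
  rw [solution, solution]
  split_ifs with h1 h2
  · exact absurd (h1.symm.trans h2) hij
  · simp
  · simp
  · simp

/-- The formula for the components on a closed sector of the covering. -/
lemma IsAngle.solution_eq (h : IsAngle a μ ω A ϑ) (i : Fin K) {r : ℝ} (hr : 0 < r) {θ : ℝ} {m : ℤ}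
    (h1 : (m : ℝ) ≤ relAngle K ϑ r θ) (h2 : relAngle K ϑ r θ ≤ m + 1) :
    solution a μ ω ϑ i (polar r θ) = if idx K m = i then
      coverWeight a m * ((-1 : ℝ) ^ m * mode a μ ω r θ) else 0 := by
  rw [h.solution_polar i hr]
  rcases h2.lt_or_eq with h3 | h3
  · rw [Int.floor_eq_iff.2 ⟨h1, h3⟩, h.abs_mode hr h1 h2]
  · have : mode a μ ω r θ = 0 := (h.mode_eq_zero_iff hr θ).2 ⟨m + 1, by push_cast; exact h3⟩
    simp [this]

lemma IsAngle.solution_pos (h : IsAngle a μ ω A ϑ) (hK : 2 ≤ K) (ha : ∀ i j, i ≠ j → 0 < a i j)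
    {r : ℝ} (hr : 0 < r) {θ : ℝ} {m : ℤ}
    (h1 : (m : ℝ) < relAngle K ϑ r θ) (h2 : relAngle K ϑ r θ < m + 1) :
    0 < solution a μ ω ϑ (idx K m) (polar r θ) := by
  rw [h.solution_eq _ hr h1.le h2.le, if_pos rfl]
  refine mul_pos (coverWeight_pos hK ha m) (lt_of_le_of_ne (h.sign_mode hr h1.le h2.le) ?_)
  refine (mul_ne_zero (zpow_ne_zero _ (by norm_num)) fun h0 => ?_).symm
  obtain ⟨n, hn⟩ := (h.mode_eq_zero_iff hr θ).1 h0
  rw [hn] at h1 h2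
  have h3 : m < n := by exact_mod_cast h1
  have h4 : n < m + 1 := by exact_mod_cast h2
  omega

lemma IsAngle.of_solution_pos (h : IsAngle a μ ω A ϑ) {i : Fin K} {r : ℝ} (hr : 0 < r) {θ : ℝ}
    (hpos : 0 < solution a μ ω ϑ i (polar r θ)) :
    idx K ⌊relAngle K ϑ r θ⌋ = i ∧ (⌊relAngle K ϑ r θ⌋ : ℝ) < relAngle K ϑ r θ := by
  rw [h.solution_polar i hr] at hpos
  split_ifs at hpos with hi
  · refine ⟨hi, lt_of_le_of_ne (Int.floor_le _) fun he => ?_⟩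
    have := (h.mode_eq_zero_iff hr θ).2 ⟨_, he.symm⟩
    simp [this] at hpos
  · exact absurd hpos (lt_irrefl _)

/-- Every point has polar coordinates in the sectors of index `0, …, K - 1`. -/
lemma exists_polar {x : Plane} (hx : x ≠ 0) (ϑ : ℝ → ℝ) : ∃ θ : ℝ, x = polar ‖x‖ θ ∧
    0 ≤ relAngle K ϑ ‖x‖ θ ∧ relAngle K ϑ ‖x‖ θ < K := by
  have hK : (0 : ℝ) < K := by exact_mod_cast NeZero.pos K
  set t := relAngle K ϑ ‖x‖ (angle 0 x) with ht
  refine ⟨angle 0 x + ((-⌊t / K⌋ : ℤ) : ℝ) * (2 * Real.pi), ?_, ?_⟩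
  · conv_lhs => rw [← polar_angle hx 0]
    simp only [polar, Real.cos_add_int_mul_two_pi, Real.sin_add_int_mul_two_pi]
  · rw [relAngle_add, ← ht]
    have h1 := Int.floor_le (t / K)
    have h2 := Int.lt_floor_add_one (t / K)
    rw [le_div_iff₀ hK] at h1
    rw [div_lt_iff₀ hK] at h2
    push_cast
    constructor <;> linarith

/-- Across the two interfaces bounding a component, `û_i` is a multiple of the explicit
function. -/
lemma IsAngle.hat_solution_eq (h : IsAngle a μ ω A ϑ) (hK : 2 ≤ K)
    (ha : ∀ i j, i ≠ j → 0 < a i j) {r : ℝ} (hr : 0 < r) {θ : ℝ} (m : ℤ)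
    (h1 : (m : ℝ) - 1 ≤ relAngle K ϑ r θ) (h2 : relAngle K ϑ r θ ≤ m + 2) :
    hat a (solution a μ ω ϑ) (idx K m) (polar r θ) =
      coverWeight a m * (-1 : ℝ) ^ m * mode a μ ω r θ := by
  have hgen : ∀ n : ℤ, (n : ℝ) ≤ relAngle K ϑ r θ → relAngle K ϑ r θ ≤ n + 1 →
      hat a (solution a μ ω ϑ) (idx K m) (polar r θ) =
        (if idx K n = idx K m then (1 : ℝ) else
          -(a (idx K m) (idx K n) / a (idx K n) (idx K m))) *
          (coverWeight a n * ((-1 : ℝ) ^ n * mode a μ ω r θ)) := by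
    intro n hn1 hn2
    rw [hat_eq_sum, Finset.sum_apply]
    simp only [Pi.smul_apply, smul_eq_mul, h.solution_eq _ hr hn1 hn2, mul_ite, mul_zero]
    rw [Finset.sum_ite_eq]
    simp
  have hne := idx_succ_ne hK m
  have hne' := idx_succ_ne hK (m - 1)
  rw [sub_add_cancel] at hne'
  have p1 := ha _ _ hne
  have p2 := ha _ _ hne.symm
  have p3 := ha _ _ hne'
  have p4 := ha _ _ hne'.symm
  rcases le_total (relAngle K ϑ r θ) m with h3 | h3
  · rw [hgen (m - 1) (by push_cast; linarith) (by push_cast; linarith), if_neg hne'.symm]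
    have hw := coverWeight_succ hK ha (m - 1)
    rw [sub_add_cancel] at hw
    rw [hw, zpow_sub_one₀ (by norm_num)]
    field_simp
  · rcases le_total (relAngle K ϑ r θ) (m + 1) with h4 | h4
    · rw [hgen m h3 h4, if_pos rfl]
      ring
    · rw [hgen (m + 1) (by push_cast; linarith) (by push_cast; linarith), if_neg hne,
        coverWeight_succ hK ha m, zpow_add_one₀ (by norm_num)]
      field_simp

/-! ### Local structure of the solution -/

/-- The closed unit interval given by the floor of a nearby point contains `t₀`; there are two such
intervals when `t₀` is an integer. -/
lemma eventually_floor (t₀ : ℝ) : ∀ᶠ t in 𝓝 t₀, (⌊t⌋ : ℝ) ≤ t₀ ∧ t₀ ≤ ⌊t⌋ + 1 := by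
  have h1 : (⌈t₀⌉ : ℝ) - 1 < t₀ := by linarith [Int.ceil_lt_add_one t₀]
  filter_upwards [Ioi_mem_nhds h1, Iio_mem_nhds (Int.lt_floor_add_one t₀)] with t ht1 ht2
  constructor
  · have : ⌊t⌋ < ⌊t₀⌋ + 1 := Int.floor_lt.2 (by push_cast; exact ht2)
    have h2 : ⌊t⌋ ≤ ⌊t₀⌋ := by omega
    exact (by exact_mod_cast h2 : (⌊t⌋ : ℝ) ≤ ⌊t₀⌋).trans (Int.floor_le t₀)
  · have h2 : ⌈t₀⌉ - 1 ≤ ⌊t⌋ := Int.le_floor.2 (by push_cast; exact le_of_lt ht1)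
    have h3 : (⌈t₀⌉ : ℝ) - 1 ≤ ⌊t⌋ := by exact_mod_cast h2
    linarith [Int.le_ceil t₀]

/-- Near a point of the open `m`-th sector, the solution is given by the explicit function. -/
lemma IsAngle.solution_eventuallyEq (h : IsAngle a μ ω A ϑ) (i : Fin K) {r : ℝ} (hr : 0 < r)
    {θ : ℝ} {m : ℤ} (h1 : (m : ℝ) < relAngle K ϑ r θ) (h2 : relAngle K ϑ r θ < m + 1) :
    solution a μ ω ϑ i =ᶠ[𝓝 (polar r θ)] fun y =>
      (if idx K m = i then coverWeight a m * (-1 : ℝ) ^ m else 0) * localMode a μ ω θ y := by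
  have hx := polar_mem_slit hr θ
  have hc := h.continuousAt_relAngle hx
  rw [ContinuousAt, norm_polar hr.le, angle_polar hr] at hc
  filter_upwards [hc.eventually (Ioo_mem_nhds h1 h2), (isOpen_slit θ).mem_nhds hx] with y hy hys
  have hn := norm_pos_of_mem_slit hys
  have hy0 : y ≠ 0 := norm_pos_iff.1 hn
  rw [localMode_eq a μ ω hy0]
  conv_lhs => rw [← polar_angle hy0 θ, h.solution_eq i hn hy.1.le hy.2.le]
  split_ifs <;> ring

lemma IsAngle.classicalAt_solution (h : IsAngle a μ ω A ϑ) (i : Fin K) {x : Plane}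
    (hpos : 0 < solution a μ ω ϑ i x) : ClassicalAt μ ω (solution a μ ω ϑ i) x := by
  have hx : x ≠ 0 := by
    rintro rfl
    rw [solution_zero] at hpos
    exact lt_irrefl _ hpos
  have hr : 0 < ‖x‖ := norm_pos_iff.2 hx
  obtain ⟨θ, hθ, -⟩ := exists_polar (K := K) hx ϑ
  generalize ‖x‖ = r at hθ hr
  subst hθ
  obtain ⟨-, h2⟩ := h.of_solution_pos hr hpos
  exact ((classicalAt_localMode μ ω (NeZero.pos K) (polar_mem_slit hr θ)).const_mul _).congr
    (h.solution_eventuallyEq i hr h2 (Int.lt_floor_add_one _))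

lemma IsAngle.eventually_classicalAt_hat (h : IsAngle a μ ω A ϑ) (hK : 2 ≤ K)
    (ha : ∀ i j, i ≠ j → 0 < a i j) (i : Fin K) {x : Plane}
    (hx : x ∈ closure {x | 0 < solution a μ ω ϑ i x}) (hx0 : x ≠ 0) :
    ∀ᶠ y in 𝓝 x, ClassicalAt μ ω (hat a (solution a μ ω ϑ) i) y := by
  have hr : 0 < ‖x‖ := norm_pos_iff.2 hx0
  obtain ⟨θ, hθ, -⟩ := exists_polar (K := K) hx0 ϑ
  generalize ‖x‖ = r at hθ hr
  subst hθ
  have hxs := polar_mem_slit hr θ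
  have hc := h.continuousAt_relAngle hxs
  rw [ContinuousAt, norm_polar hr.le, angle_polar hr] at hc
  -- the point lies in the closure of a sector of the component
  obtain ⟨m, hm, h1, h2⟩ : ∃ m : ℤ, idx K m = i ∧ (m : ℝ) ≤ relAngle K ϑ r θ ∧
      relAngle K ϑ r θ ≤ m + 1 := by
    obtain ⟨y, hyp, hy, hys⟩ := ((mem_closure_iff_frequently.1 hx).and_eventually
      ((hc.eventually (eventually_floor _)).and ((isOpen_slit θ).mem_nhds hxs))).exists
    have hn := norm_pos_of_mem_slit hys
    have hyp' : 0 < solution a μ ω ϑ i y := hyp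
    rw [← polar_angle (norm_pos_iff.1 hn) θ] at hyp'
    exact ⟨_, (h.of_solution_pos hn hyp').1, hy⟩
  subst hm
  have hev : ∀ᶠ y in 𝓝 (polar r θ), hat a (solution a μ ω ϑ) (idx K m) y =
      coverWeight a m * (-1 : ℝ) ^ m * localMode a μ ω θ y := by
    filter_upwards [hc.eventually (Ioo_mem_nhds (by linarith : (m : ℝ) - 1 < _)
      (by linarith : _ < (m : ℝ) + 2)), (isOpen_slit θ).mem_nhds hxs] with y hy hys
    have hn := norm_pos_of_mem_slit hys
    have hy0 : y ≠ 0 := norm_pos_iff.1 hn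
    rw [localMode_eq a μ ω hy0]
    conv_lhs => rw [← polar_angle hy0 θ, h.hat_solution_eq hK ha hn m hy.1.le hy.2.le]
  filter_upwards [hev.eventually_nhds, (isOpen_slit θ).mem_nhds hxs] with y hy hys
  exact ((classicalAt_localMode μ ω (NeZero.pos K) hys).const_mul _).congr hy

/-- On bounded sets, `e^{αθ}` and the weight are bounded on the sectors of index `0, …, K - 1`. -/
lemma IsAngle.exists_bound_exp (h : IsAngle a μ ω A ϑ) (hK : 2 ≤ K)
    (ha : ∀ i j, i ≠ j → 0 < a i j) (R : ℝ) :
    ∃ C : ℝ, 0 ≤ C ∧ ∀ r θ : ℝ, 0 < r → r ≤ R → 0 ≤ relAngle K ϑ r θ → relAngle K ϑ r θ < K →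
      coverWeight a ⌊relAngle K ϑ r θ⌋ * Real.exp (asymmetry a * θ) ≤ C := by
  obtain ⟨C, hC0, hC⟩ := h.bdd R
  have hKpos : (0 : ℝ) < K := by exact_mod_cast NeZero.pos K
  have hW : ∀ i : Fin K, weight a i ≤ ∑ j, weight a j := fun i =>
    Finset.single_le_sum (f := weight a) (fun j _ => (weight_pos hK ha j).le) (Finset.mem_univ i)
  have hW0 : 0 ≤ ∑ j, weight a j := Finset.sum_nonneg fun j _ => (weight_pos hK ha j).le
  refine ⟨(∑ j, weight a j) * (C * Real.exp (|asymmetry a| * (2 * Real.pi))),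
    by positivity, fun r θ hr hrR h0 h1 => ?_⟩
  have hfl0 : 0 ≤ ⌊relAngle K ϑ r θ⌋ := Int.floor_nonneg.2 h0
  have hfl1 : ⌊relAngle K ϑ r θ⌋ < (K : ℤ) := Int.floor_lt.2 (by exact_mod_cast h1)
  have hw : coverWeight a ⌊relAngle K ϑ r θ⌋ ≤ ∑ j, weight a j := by
    rw [coverWeight, Int.ediv_eq_zero_of_lt hfl0 hfl1]
    simpa using hW _
  have hθ : θ = ϑ r + relAngle K ϑ r θ * (2 * Real.pi / K) := relAngle_eq_iff.1 rfl
  have h2 : 0 ≤ relAngle K ϑ r θ * (2 * Real.pi / K) := by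
    have := Real.pi_pos
    positivity
  have h3 : relAngle K ϑ r θ * (2 * Real.pi / K) ≤ 2 * Real.pi := by
    rw [mul_div_assoc', div_le_iff₀ hKpos]
    nlinarith [Real.pi_pos]
  have hexp : Real.exp (asymmetry a * θ) ≤ C * Real.exp (|asymmetry a| * (2 * Real.pi)) := by
    rw [hθ, mul_add, Real.exp_add]
    refine mul_le_mul (hC r hr hrR) (Real.exp_le_exp.2 ?_) (Real.exp_pos _).le hC0
    calc asymmetry a * (relAngle K ϑ r θ * (2 * Real.pi / K))
        ≤ |asymmetry a| * (relAngle K ϑ r θ * (2 * Real.pi / K)) := by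
          gcongr
          exact le_abs_self _
      _ ≤ _ := by gcongr
  exact mul_le_mul hw hexp (Real.exp_pos _).le hW0

lemma IsAngle.exists_bound_solution (h : IsAngle a μ ω A ϑ) (hK : 2 ≤ K)
    (ha : ∀ i j, i ≠ j → 0 < a i j) :
    ∃ C : ℝ, ∀ (i : Fin K) (x : Plane), ‖x‖ ≤ 1 →
      solution a μ ω ϑ i x ≤ C * ‖x‖ ^ ((K : ℝ) / 2) := by
  obtain ⟨C, hC0, hC⟩ := h.exists_bound_exp hK ha 1
  have hKpos : (0 : ℝ) < K := by exact_mod_cast NeZero.pos K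
  have hν : 0 < (order a).re := by rw [order_re]; positivity
  have hc : Continuous fun r : ℝ => Theta (order a) (lam a μ ω * (r : ℂ) ^ 2) :=
    (differentiable_Theta hν).continuous.comp (by fun_prop)
  obtain ⟨B, hB⟩ := (isCompact_Icc (a := (0 : ℝ)) (b := 1)).exists_bound_of_continuousOn
    hc.continuousOn
  have hB0 : 0 ≤ B := (norm_nonneg _).trans (hB 0 (by simp))
  refine ⟨C * B, fun i x hx1 => ?_⟩
  rcases eq_or_ne x 0 with rfl | hx
  · rw [solution_zero, norm_zero]
    positivity
  have hr : 0 < ‖x‖ := norm_pos_iff.2 hx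
  obtain ⟨θ, hθ, h0, h1⟩ := exists_polar (K := K) hx ϑ
  have hmode : |mode a μ ω ‖x‖ θ| ≤ Real.exp (asymmetry a * θ) * (‖x‖ ^ ((K : ℝ) / 2) * B) := by
    rw [mode, mul_assoc, abs_mul, Real.abs_exp, abs_mul, abs_of_pos (Real.rpow_pos_of_pos hr _)]
    gcongr
    refine (Complex.abs_re_le_norm _).trans ?_
    rw [norm_mul, mul_comm Complex.I, Complex.norm_exp_ofReal_mul_I, one_mul]
    exact hB ‖x‖ ⟨hr.le, hx1⟩
  rw [hθ, h.solution_polar i hr, ← hθ]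
  split_ifs
  · have hw := (coverWeight_pos hK ha ⌊relAngle K ϑ ‖x‖ θ⌋).le
    calc coverWeight a ⌊relAngle K ϑ ‖x‖ θ⌋ * |mode a μ ω ‖x‖ θ|
        ≤ coverWeight a ⌊relAngle K ϑ ‖x‖ θ⌋ *
          (Real.exp (asymmetry a * θ) * (‖x‖ ^ ((K : ℝ) / 2) * B)) := by gcongr
      _ = (coverWeight a ⌊relAngle K ϑ ‖x‖ θ⌋ * Real.exp (asymmetry a * θ)) *
          (‖x‖ ^ ((K : ℝ) / 2) * B) := by ring
      _ ≤ C * (‖x‖ ^ ((K : ℝ) / 2) * B) := by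
          gcongr
          exact hC _ _ hr hx1 h0 h1
      _ = _ := by ring
  · positivity

lemma IsAngle.continuous_solution (h : IsAngle a μ ω A ϑ) (hK : 2 ≤ K)
    (ha : ∀ i j, i ≠ j → 0 < a i j) (i : Fin K) : Continuous (solution a μ ω ϑ i) := by
  rw [continuous_iff_continuousAt]
  intro x
  rcases eq_or_ne x 0 with rfl | hx
  · obtain ⟨C, hC⟩ := h.exists_bound_solution hK ha
    have hlim : Tendsto (fun x : Plane => C * ‖x‖ ^ ((K : ℝ) / 2)) (𝓝 0) (𝓝 0) := by
      have hKpos : (0 : ℝ) < (K : ℝ) / 2 := by have := NeZero.pos K; positivity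
      have : ContinuousAt (fun x : Plane => C * ‖x‖ ^ ((K : ℝ) / 2)) 0 :=
        continuousAt_const.mul (continuous_norm.continuousAt.rpow_const (Or.inr hKpos.le))
      simpa [ContinuousAt, Real.zero_rpow hKpos.ne'] using this
    rw [ContinuousAt, solution_zero]
    refine tendsto_of_tendsto_of_tendsto_of_le_of_le' tendsto_const_nhds hlim
      (Eventually.of_forall fun y => solution_nonneg hK ha i y) ?_
    filter_upwards [Metric.closedBall_mem_nhds (0 : Plane) one_pos] with y hy
    exact hC i y (by simpa using hy)
  have hr : 0 < ‖x‖ := norm_pos_iff.2 hx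
  obtain ⟨θ, hθ, -⟩ := exists_polar (K := K) hx ϑ
  generalize ‖x‖ = r at hθ hr
  subst hθ
  have hxs := polar_mem_slit hr θ
  have hloc : ContinuousAt (localMode a μ ω θ) (polar r θ) :=
    ((classicalAt_localMode μ ω (NeZero.pos K) hxs).1).continuousAt
  rcases (Int.floor_le (relAngle K ϑ r θ)).lt_or_eq with hlt | heq
  · exact (continuousAt_const.mul hloc).congr
      (h.solution_eventuallyEq i hr hlt (Int.lt_floor_add_one _)).symm
  · -- on a spiral, the two neighbouring weights bound the solution by a multiple of `|v|`
    set m := ⌊relAngle K ϑ r θ⌋ with hm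
    have hmode : mode a μ ω r θ = 0 := (h.mode_eq_zero_iff hr θ).2 ⟨m, heq.symm⟩
    have hval : solution a μ ω ϑ i (polar r θ) = 0 := by
      rw [h.solution_polar i hr, hmode]
      simp
    have hlocval : localMode a μ ω θ (polar r θ) = 0 := by
      rw [localMode_eq a μ ω (norm_pos_iff.1 (norm_pos_of_mem_slit hxs)), norm_polar hr.le,
        angle_polar hr, hmode]
    have hlim : Tendsto (fun y => (coverWeight a (m - 1) + coverWeight a m) *
        |localMode a μ ω θ y|) (𝓝 (polar r θ)) (𝓝 0) := by
      have := (hloc.abs.const_mul (coverWeight a (m - 1) + coverWeight a m)).tendsto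
      simpa [hlocval] using this
    rw [ContinuousAt, hval]
    refine tendsto_of_tendsto_of_tendsto_of_le_of_le' tendsto_const_nhds hlim
      (Eventually.of_forall fun y => solution_nonneg hK ha i y) ?_
    have hc := h.continuousAt_relAngle hxs
    rw [ContinuousAt, norm_polar hr.le, angle_polar hr] at hc
    filter_upwards [hc.eventually (Ioo_mem_nhds (by linarith : (m : ℝ) - 1 < _)
      (by linarith : _ < (m : ℝ) + 1)), (isOpen_slit θ).mem_nhds hxs] with y hy hys
    have hn := norm_pos_of_mem_slit hys
    have hy0 : y ≠ 0 := norm_pos_iff.1 hn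
    have hw1 := (coverWeight_pos hK ha (m - 1)).le
    have hw2 := (coverWeight_pos hK ha m).le
    rw [localMode_eq a μ ω hy0]
    conv_lhs => rw [← polar_angle hy0 θ, h.solution_polar i hn]
    split_ifs
    · refine mul_le_mul_of_nonneg_right ?_ (abs_nonneg _)
      have h1 : m - 1 ≤ ⌊relAngle K ϑ ‖y‖ (angle θ y)⌋ :=
        Int.le_floor.2 (by push_cast; exact hy.1.le)
      have h2 : ⌊relAngle K ϑ ‖y‖ (angle θ y)⌋ < m + 1 :=
        Int.floor_lt.2 (by push_cast; exact hy.2)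
      rcases (by omega : ⌊relAngle K ϑ ‖y‖ (angle θ y)⌋ = m - 1 ∨
        ⌊relAngle K ϑ ‖y‖ (angle θ y)⌋ = m) with h3 | h3 <;> rw [h3] <;> linarith
    · positivity

lemma IsAngle.locBdd_solution (h : IsAngle a μ ω A ϑ) (hK : 2 ≤ K)
    (ha : ∀ i j, i ≠ j → 0 < a i j) (i : Fin K) :
    LocBdd (solution a μ ω ϑ i) (gradient (solution a μ ω ϑ i)) := by
  refine ⟨h.continuous_solution hK ha i, measurable_gradient _, fun R => ?_⟩
  obtain ⟨C, hC0, hC⟩ := h.exists_bound_exp hK ha R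
  obtain ⟨B, hB0, hB⟩ := exists_bound_fderiv_localMode (a := a) μ ω hK R
  refine ⟨B * C, by positivity, fun x hxR => ?_⟩
  rw [norm_gradient]
  rcases (solution_nonneg hK ha i x).eq_or_lt with hx | hpos
  · rw [gradient_eq_zero_of_eq_zero (solution_nonneg hK ha i) hx.symm, norm_zero]
    positivity
  have hx : x ≠ 0 := by
    rintro rfl
    rw [solution_zero] at hpos
    exact lt_irrefl _ hpos
  have hr : 0 < ‖x‖ := norm_pos_iff.2 hx
  obtain ⟨θ, hθ, h0, h1⟩ := exists_polar (K := K) hx ϑ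
  generalize ‖x‖ = r at hθ hr h0 h1 hxR
  subst hθ
  obtain ⟨hi, h2⟩ := h.of_solution_pos hr hpos
  set m := ⌊relAngle K ϑ r θ⌋ with hm
  have hxs := polar_mem_slit hr θ
  rw [(h.solution_eventuallyEq i hr h2 (Int.lt_floor_add_one _)).fderiv_eq, if_pos hi,
    fderiv_const_mul (((classicalAt_localMode μ ω (NeZero.pos K) hxs).1).differentiableAt
      two_ne_zero), norm_smul, norm_mul, norm_zpow, norm_neg, norm_one, one_zpow, mul_one,
    Real.norm_of_nonneg (coverWeight_pos hK ha m).le]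
  have hbd := hB θ (polar r θ) hxs (by rwa [norm_polar hr.le])
  rw [angle_polar hr] at hbd
  calc coverWeight a m * ‖fderiv ℝ (localMode a μ ω θ) (polar r θ)‖
      ≤ coverWeight a m * (B * Real.exp (asymmetry a * θ)) := by
        have := (coverWeight_pos hK ha m).le
        gcongr
    _ = B * (coverWeight a m * Real.exp (asymmetry a * θ)) := by ring
    _ ≤ B * C := by
        gcongr
        exact hC r θ hr hxR h0 h1

lemma IsAngle.isEntireSolution (h : IsAngle a μ ω A ϑ) (hK : 2 ≤ K)
    (ha : ∀ i j, i ≠ j → 0 < a i j) : IsEntireSolution a μ ω (solution a μ ω ϑ) :=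
  isEntireSolution_of_classical ha (solution_nonneg hK ha) (fun _ _ hij => solution_disjoint hij)
    (h.locBdd_solution hK ha) (fun j _ hx => h.classicalAt_solution j hx)
    (fun i _ hx hx0 => h.eventually_classicalAt_hat hK ha i hx hx0)

/-! ### Positivity sets and free boundary -/

lemma IsAngle.solution_sector (h : IsAngle a μ ω A ϑ) (i : Fin K) {r θ : ℝ}
    (hs : (r, θ) ∈ sector ϑ i) :
    solution a μ ω ϑ i (polar r θ) = (-1) ^ (i : ℕ) * weight a i * mode a μ ω r θ := by
  obtain ⟨hr, h1, h2⟩ := mem_sector_iff.1 hs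
  rw [h.solution_eq i hr (m := ((i : ℕ) : ℤ)) (by exact_mod_cast h1.le) (by exact_mod_cast h2.le),
    idx_natCast, if_pos rfl, coverWeight_natCast, zpow_natCast]
  ring

lemma IsAngle.setOf_solution_pos (h : IsAngle a μ ω A ϑ) (hK : 2 ≤ K)
    (ha : ∀ i j, i ≠ j → 0 < a i j) (i : Fin K) : {x | 0 < solution a μ ω ϑ i x} =
      (fun p : ℝ × ℝ => polar p.1 p.2) '' sector ϑ i := by
  ext x
  constructor
  · intro hpos
    have hpos : 0 < solution a μ ω ϑ i x := hpos
    have hx : x ≠ 0 := by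
      rintro rfl
      rw [solution_zero] at hpos
      exact lt_irrefl _ hpos
    have hr : 0 < ‖x‖ := norm_pos_iff.2 hx
    obtain ⟨θ, hθ, h0, h1⟩ := exists_polar (K := K) hx ϑ
    generalize ‖x‖ = r at hθ hr h0 h1
    subst hθ
    obtain ⟨hi, h2⟩ := h.of_solution_pos hr hpos
    have h3 := Int.lt_floor_add_one (relAngle K ϑ r θ)
    have hfl0 : 0 ≤ ⌊relAngle K ϑ r θ⌋ := Int.floor_nonneg.2 h0
    have hfl1 : ⌊relAngle K ϑ r θ⌋ < (K : ℤ) := Int.floor_lt.2 (by exact_mod_cast h1)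
    have hm : ((i : ℕ) : ℤ) = ⌊relAngle K ϑ r θ⌋ := by
      rw [← hi, idx_val, Int.emod_eq_of_lt hfl0 hfl1]
    have hm' : ((i : ℕ) : ℝ) = ⌊relAngle K ϑ r θ⌋ := by exact_mod_cast hm
    exact ⟨(r, θ), mem_sector_iff.2 ⟨hr, by rw [hm']; exact h2, by rw [hm']; exact h3⟩, rfl⟩
  · rintro ⟨⟨r, θ⟩, hs, rfl⟩
    obtain ⟨hr, h1, h2⟩ := mem_sector_iff.1 hs
    have := h.solution_pos hK ha hr (m := ((i : ℕ) : ℤ)) (by exact_mod_cast h1)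
      (by exact_mod_cast h2)
    rw [idx_natCast] at this
    exact this

/-- The common zero set of the components consists of the origin and of the spirals. -/
lemma IsAngle.setOf_solution_eq_zero (h : IsAngle a μ ω A ϑ) (hK : 2 ≤ K)
    (ha : ∀ i j, i ≠ j → 0 < a i j) : {x | ∀ i, solution a μ ω ϑ i x = 0} =
      {0} ∪ ⋃ i : Fin K, spiral ϑ i := by
  ext x
  simp only [Set.mem_union, Set.mem_singleton_iff, Set.mem_iUnion]
  constructor
  · intro hx
    have hx : ∀ i, solution a μ ω ϑ i x = 0 := hx
    rcases eq_or_ne x 0 with h0 | hx0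
    · exact Or.inl h0
    right
    have hr : 0 < ‖x‖ := norm_pos_iff.2 hx0
    obtain ⟨θ, hθ, h0, h1⟩ := exists_polar (K := K) hx0 ϑ
    generalize ‖x‖ = r at hθ hr h0 h1
    subst hθ
    have h2 := hx (idx K ⌊relAngle K ϑ r θ⌋)
    rw [h.solution_polar _ hr, if_pos rfl, mul_eq_zero,
      or_iff_right (coverWeight_pos hK ha _).ne', abs_eq_zero, h.mode_eq_zero_iff hr] at h2
    obtain ⟨m, hm⟩ := h2
    have hm0 : 0 ≤ m := by rw [hm] at h0; exact_mod_cast h0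
    have hm1 : m < K := by rw [hm] at h1; exact_mod_cast h1
    have hm2 : ((m.toNat : ℕ) : ℝ) = m := by exact_mod_cast Int.toNat_of_nonneg hm0
    refine ⟨⟨m.toNat, by omega⟩, r, hr, ?_⟩
    rw [relAngle_eq_iff.1 hm]
    simp only [hm2]
  · rintro (rfl | ⟨i, r, hr, rfl⟩) j
    · exact solution_zero j
    · have : mode a μ ω r (ϑ r + i * (2 * Real.pi / K)) = 0 :=
        (h.mode_eq_zero_iff hr _).2 ⟨(i : ℕ), by rw [relAngle_eq_iff]; simp⟩
      rw [h.solution_polar j hr, this]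
      simp

lemma continuous_polar : Continuous fun p : ℝ × ℝ => polar p.1 p.2 := by
  refine (PiLp.continuous_toLp 2 _).comp (continuous_pi fun i => ?_)
  fin_cases i <;> simp <;> fun_prop

lemma IsAngle.mem_closure_pos (h : IsAngle a μ ω A ϑ) (hK : 2 ≤ K)
    (ha : ∀ i j, i ≠ j → 0 < a i j) {r : ℝ} (hr : 0 < r) {t : ℝ} {m : ℤ}
    (ht : t ∈ Set.Icc (m : ℝ) (m + 1)) : polar r (ϑ r + t * (2 * Real.pi / K)) ∈
      closure {x | 0 < solution a μ ω ϑ (idx K m) x} := by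
  rw [← closure_Ioo (by simp : (m : ℝ) ≠ m + 1)] at ht
  have hc : Continuous fun t : ℝ => polar r (ϑ r + t * (2 * Real.pi / K)) :=
    continuous_polar.comp (by fun_prop : Continuous fun t : ℝ => (r, ϑ r + t * (2 * Real.pi / K)))
  refine map_mem_closure (f := fun t : ℝ => polar r (ϑ r + t * (2 * Real.pi / K))) hc ht
    fun s hs => ?_
  have hs' : relAngle K ϑ r (ϑ r + s * (2 * Real.pi / K)) = s := relAngle_eq_iff.2 rfl
  exact h.solution_pos hK ha hr (by rw [hs']; exact hs.1) (by rw [hs']; exact hs.2)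

lemma IsAngle.freeBoundary_solution (h : IsAngle a μ ω A ϑ) (hK : 2 ≤ K)
    (ha : ∀ i j, i ≠ j → 0 < a i j) : freeBoundary (solution a μ ω ϑ) =
      {0} ∪ ⋃ i : Fin K, spiral ϑ i := by
  have hcont := h.continuous_solution hK ha
  have hopen : ∀ i, IsOpen {x | 0 < solution a μ ω ϑ i x} := fun i =>
    isOpen_lt continuous_const (hcont i)
  refine Set.Subset.antisymm ?_ ?_
  · rw [← h.setOf_solution_eq_zero hK ha]
    refine closure_minimal ?_ ?_
    · rintro x ⟨i, j, hij, hxi, hxj⟩ m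
      by_contra hne
      have hpos : x ∈ {x | 0 < solution a μ ω ϑ m x} :=
        lt_of_le_of_ne (solution_nonneg hK ha m x) (Ne.symm hne)
      -- an open positivity set does not meet the frontier of another one
      have hdis : ∀ n, x ∈ frontier {y | 0 < solution a μ ω ϑ n y} → m = n := by
        intro n hn
        by_contra hmn
        obtain ⟨y, hym, hyn⟩ := mem_closure_iff.1 (frontier_subset_closure hn) _ (hopen m) hpos
        have hym : 0 < solution a μ ω ϑ m y := hym
        have hyn : 0 < solution a μ ω ϑ n y := hyn
        exact (mul_pos hym hyn).ne' (solution_disjoint hmn y)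
      exact hij ((hdis i hxi).symm.trans (hdis j hxj))
    · have : {x | ∀ i, solution a μ ω ϑ i x = 0} = ⋂ i, {x | solution a μ ω ϑ i x = 0} := by
        ext x
        simp
      rw [this]
      exact isClosed_iInter fun i => isClosed_eq (hcont i) continuous_const
  · have hspiral : ∀ i : Fin K, spiral ϑ i ⊆ {x | ∃ i j, i ≠ j ∧
        x ∈ frontier {y | 0 < solution a μ ω ϑ i y} ∧
        x ∈ frontier {y | 0 < solution a μ ω ϑ j y}} := by
      intro i x hx
      have hzero : ∀ j, solution a μ ω ϑ j x = 0 := by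
        have : x ∈ {0} ∪ ⋃ i : Fin K, spiral ϑ i := Or.inr (Set.mem_iUnion.2 ⟨i, hx⟩)
        rw [← h.setOf_solution_eq_zero hK ha] at this
        exact this
      obtain ⟨r, hr, rfl⟩ := hx
      -- the `i`-th spiral separates the sectors of index `i - 1` and `i` modulo `K`
      have hne := idx_succ_ne hK (((i : ℕ) : ℤ) - 1)
      rw [sub_add_cancel] at hne
      have hfr : ∀ m : ℤ, ((i : ℕ) : ℝ) ∈ Set.Icc (m : ℝ) (m + 1) →
          polar r (ϑ r + i * (2 * Real.pi / K)) ∈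
            frontier {y | 0 < solution a μ ω ϑ (idx K m) y} := fun m hm =>
        ⟨h.mem_closure_pos hK ha hr hm, fun hint => by
          have h1 := interior_subset hint
          have h2 : 0 < solution a μ ω ϑ (idx K m) (polar r (ϑ r + i * (2 * Real.pi / K))) := h1
          rw [hzero] at h2
          exact lt_irrefl _ h2⟩
      exact ⟨_, _, hne, hfr _ (by simp), hfr _ (by simp)⟩
    refine Set.union_subset ?_ (Set.iUnion_subset fun i => (hspiral i).trans subset_closure)
    -- the origin is a limit point of each spiral
    rw [Set.singleton_subset_iff]
    have hlim : Tendsto (fun r : ℝ => polar r (ϑ r + ((0 : Fin K) : ℕ) * (2 * Real.pi / K)))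
        (𝓝[>] 0) (𝓝 0) := by
      rw [tendsto_zero_iff_norm_tendsto_zero]
      have h1 : Tendsto (fun r : ℝ => r) (𝓝[>] 0) (𝓝 0) := tendsto_id.mono_left nhdsWithin_le_nhds
      refine h1.congr' ?_
      filter_upwards [self_mem_nhdsWithin] with r hr
      exact (norm_polar (le_of_lt hr) _).symm
    refine mem_closure_of_tendsto hlim ?_
    filter_upwards [self_mem_nhdsWithin] with r hr
    exact hspiral 0 ⟨r, hr, rfl⟩

end Solution

/-- The logarithmic behaviour at the origin keeps `e^{αϑ(r)}`, which is comparable to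
`r^{2α²/K}` there, bounded. -/
lemma exists_bound_exp_angle {K : ℕ} {a : Fin K → Fin K → ℝ} {ϑ : ℝ → ℝ} {β : ℝ}
    (hc : ContinuousOn ϑ (Set.Ioi 0))
    (hlim : Tendsto (fun r => ϑ r - 2 / K * (β + asymmetry a * Real.log r)) (𝓝[>] 0) (𝓝 0))
    (R : ℝ) : ∃ C : ℝ, 0 ≤ C ∧ ∀ r, 0 < r → r ≤ R → Real.exp (asymmetry a * ϑ r) ≤ C := by
  set α := asymmetry a with hα
  have h1 : ∀ᶠ r in 𝓝[>] (0 : ℝ), |ϑ r - 2 / K * (β + α * Real.log r)| < 1 := by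
    have := hlim.abs
    rw [abs_zero] at this
    exact this.eventually_lt_const one_pos
  obtain ⟨ε, hε, hsub⟩ := (mem_nhdsGT_iff_exists_Ioo_subset.1
    (h1.and (Ioo_mem_nhdsGT one_pos)))
  have hε : 0 < ε := hε
  have hcc : ContinuousOn (fun r => Real.exp (α * ϑ r)) (Set.Icc (ε / 2) R) :=
    (Real.continuous_exp.comp_continuousOn (continuousOn_const.mul hc)).mono fun r hr =>
      (half_pos hε).trans_le hr.1
  obtain ⟨B, hB⟩ := isCompact_Icc.exists_bound_of_continuousOn hcc
  refine ⟨max |B| (Real.exp (|α| + |α * (2 / K * β)|)), le_max_of_le_left (abs_nonneg _),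
    fun r hr hrR => ?_⟩
  rcases lt_or_ge r ε with hrε | hrε
  · refine le_max_of_le_right (Real.exp_le_exp.2 ?_)
    obtain ⟨h2, -, h4⟩ := hsub ⟨hr, hrε⟩
    have hlog : Real.log r ≤ 0 := Real.log_nonpos hr.le h4.le
    have h5 : α * (ϑ r - 2 / K * (β + α * Real.log r)) ≤ |α| := by
      refine (le_abs_self _).trans ?_
      rw [abs_mul]
      exact mul_le_of_le_one_right (abs_nonneg _) h2.le
    have h6 : α * α * (2 / K) * Real.log r ≤ 0 :=
      mul_nonpos_of_nonneg_of_nonpos (mul_nonneg (mul_self_nonneg _) (by positivity)) hlog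
    have h7 := le_abs_self (α * (2 / K * β))
    linarith
  · refine le_max_of_le_left ?_
    have := hB r ⟨by linarith, hrR⟩
    rw [Real.norm_of_nonneg (Real.exp_pos _).le] at this
    exact this.trans (le_abs_self B)

end RotatingSpirals

end

theorem theorem1p4 (K : ℕ) (hK : 3 ≤ K) (a : Fin K → Fin K → ℝ)
    (ha : ∀ i j, i ≠ j → 0 < a i j) :
    (∀ᵐ p : ℝ × ℝ, RotatingSpirals.NonResonant a p.1 p.2) ∧
    ∀ μ ω : ℝ, RotatingSpirals.NonResonant a μ ω →
      ∃ (U : Fin K → RotatingSpirals.Plane → ℝ) (ϑ : ℝ → ℝ) (β : ℝ),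
        RotatingSpirals.IsEntireSolution a μ ω U ∧
        -- the angle function of the spirals, and the nodal lines of the explicit function
        AnalyticOnNhd ℝ ϑ (Set.Ioi 0) ∧
        (∀ r θ : ℝ, 0 < r → (RotatingSpirals.mode a μ ω r θ = 0 ↔
          ∃ h : ℤ, θ = ϑ r + h * (2 * Real.pi / K))) ∧
        -- the solution is explicit
        (∀ (i : Fin K) (r θ : ℝ), (r, θ) ∈ RotatingSpirals.sector ϑ i →
          U i (RotatingSpirals.polar r θ) =
            (-1) ^ (i : ℕ) * RotatingSpirals.weight a i * RotatingSpirals.mode a μ ω r θ) ∧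
        (∀ i : Fin K, {x | 0 < U i x} =
          (fun p : ℝ × ℝ => RotatingSpirals.polar p.1 p.2) '' RotatingSpirals.sector ϑ i) ∧
        -- the free boundary consists of the origin and of `K` equi-distributed spirals
        RotatingSpirals.freeBoundary U =
          {0} ∪ ⋃ i : Fin K, RotatingSpirals.spiral ϑ i ∧
        -- they are logarithmic near the origin
        Tendsto (fun r => ϑ r - 2 / K * (β + RotatingSpirals.asymmetry a * Real.log r))
          (𝓝[>] 0) (𝓝 0) ∧
        -- and arithmetic at infinity
        (ω ≠ 0 → RotatingSpirals.slope a μ ω ≠ 0 ∧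
          (fun r => ϑ r - RotatingSpirals.slope a μ ω * r) =O[atTop] (fun _ => (1 : ℝ))) := by
  refine ⟨RotatingSpirals.ae_nonResonant (by omega) a, fun μ ω hres => ?_⟩
  have : NeZero K := ⟨by omega⟩
  have hK2 : 2 ≤ K := by omega
  obtain ⟨A, ϑ, β, hA, hϑ, hmode, hlog, hinf⟩ := RotatingSpirals.exists_angle hK a hres
  have h : RotatingSpirals.IsAngle a μ ω A ϑ :=
    ⟨hA, hϑ.continuousOn, hmode, RotatingSpirals.exists_bound_exp_angle hϑ.continuousOn hlog⟩
  refine ⟨RotatingSpirals.solution a μ ω ϑ, ϑ, β, h.isEntireSolution hK2 ha, hϑ,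
    fun r θ hr => ?_, fun i r θ hs => h.solution_sector i hs, h.setOf_solution_pos hK2 ha,
    h.freeBoundary_solution hK2 ha, hlog, hinf⟩
  rw [h.mode_eq_zero_iff hr]
  exact exists_congr fun m => RotatingSpirals.relAngle_eq_iff
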